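/- **Mixture lemma.** Let $\mathbb T_L^3=(\mathbb R/L\mathbb Z)^3$ be the torus of side $L>0$ with normalised measure $dx/L^3$, and let $\|f\|_{L^2_xL^2_\xi}^2=L^{-3}\int_{\mathbb T_L^3}\int_{\mathbb R^3}|f|^2\,d\xi\,dx$. For $j\ge 0$ let $L^2_xH^j_\xi$ be the space of (real- or complex-valued) $f\in L^2_xL^2_\xi$ whose weak derivatives $\partial_\xi^\alpha f$, $|\alpha|\le j$, lie in $L^2_xL^2_\xi$, with $\|f\|^2_{L^2_xH^j_\xi}=\sum_{|\alpha|\le j}\|\partial_\xi^\alpha f\|^2_{L^2_xL^2_\xi}$; and write $\|\partial_x^jf\|^2_{L^2_xL^2_\xi}=\sum_{|\alpha|=j}\|\partial_x^\alpha f\|^2_{L^2_xL^2_\xi}$ (weak derivatives). Let the collision frequency and the kernel of the linearized hard-sphere Boltzmann operator $L_{\rm coll}=-\nu+K$ be, up to positive normalising constants $a,b,c,d$, $$\nu(\xi)=a\Big[2e^{-|\xi|^2/2}+b\,(|\xi|+|\xi|^{-1})\int_0^{|\xi|}e^{-u^2/2}\,du\Big]$$ (extended continuously to $\xi=0$), $$W(\xi,\xi_*)=\frac{c}{|\xi-\xi_*|}\exp\Big\{-\frac{(|\xi|^2-|\xi_*|^2)^2}{8|\xi-\xi_*|^2}-\frac{|\xi-\xi_*|^2}{8}\Big\}-d\,|\xi-\xi_*|\exp\Big\{-\frac{|\xi|^2+|\xi_*|^2}{4}\Big\},$$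 and $Kf(x,\xi)=\int_{\mathbb R^3}W(\xi,\xi_*)f(x,\xi_*)\,d\xi_*$. Let $\mathbb S^t$ be the solution operator of the damped transport equation $\partial_tg+\xi\cdot\nabla_xg+\nu(\xi)g=0$, that is, $\mathbb S^tg_0(x,\xi)=e^{-\nu(\xi)t}g_0(x-t\xi,\xi)$, and define the $j$-th mixture operator by $$\mathbb M^t_jf_0=\int_0^t\int_0^{s_1}\cdots\int_0^{s_{2j-1}}\mathbb S^{t-s_1}K\,\mathbb S^{s_1-s_2}K\cdots\mathbb S^{s_{2j-1}-s_{2j}}K\,\mathbb S^{s_{2j}}f_0\;ds_{2j}\cdots ds_1 .$$ Let $\nu_0>0$ be such that $\nu(\xi)\ge\nu_0$ for all $\xi\in\mathbb R^3$. Then there is a constant $C>0$, depending only on $\nu_0$ and the normalising constants $a,b,c,d$ (in particular not on $t$, $f_0$ or $L$), such that for $j=1,2$, every $L>0$, every $f_0\in L^2_xH^j_\xi$ and every $t\ge0$, the function $\mathbb M^t_jf_0$ lies in $L^2_xL^2_\xi$, its weak derivatives $\partial_x^\alpha\mathbb M^t_jf_0$, $|\alpha|=j$, exist in $L^2_xL^2_\xi$,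 and $$\|\partial_x^j\mathbb M^t_jf_0\|_{L^2_xL^2_\xi}\le C\,t^j e^{-2\nu_0t/3}\,\|f_0\|_{L^2_xH^j_\xi}.$$ -/

import Mathlib

open MeasureTheory Set
open scoped ENNReal ContDiff

noncomputable section

namespace MixtureLemma

/-- Velocity space, with the Euclidean norm. -/
abbrev V : Type := EuclideanSpace ℝ (Fin 3)

/-- The three-dimensional torus with side length `L`. -/
abbrev Torus (L : ℝ) : Type := Fin 3 → AddCircle L

/-- Phase space: pairs `(x, ξ)`. -/
abbrev Phase (L : ℝ) : Type := Torus L × V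

/-- The quotient map from Euclidean space to the torus. -/
def toTorus (L : ℝ) (y : V) : Torus L := fun i => (y i : AddCircle L)

/-- Normalised Lebesgue measure `dx / |𝕋|` on the torus. -/
def torusMeasure (L : ℝ) [Fact (0 < L)] : Measure (Torus L) :=
  Measure.pi fun _ => AddCircle.haarAddCircle

/-- The measure `|𝕋|⁻¹ dx dξ` on phase space. -/
def phaseMeasure (L : ℝ) [Fact (0 < L)] : Measure (Phase L) :=
  (torusMeasure L).prod volume

/-- `torusMeasure` is Lebesgue measure divided by the volume of the torus. -/
theorem volume_eq_smul_torusMeasure (L : ℝ) [Fact (0 < L)] :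
    (volume : Measure (Torus L)) = ENNReal.ofReal L ^ 3 • torusMeasure L := by
  refine Measure.pi_eq fun s _ => ?_
  simp [torusMeasure, AddCircle.volume_eq_smul_haarAddCircle, Measure.pi_pi,
    Finset.prod_mul_distrib]

/-! ### Collision frequency and collision kernel -/

/-- The hard-sphere collision frequency
`ν(ξ) = a (2 exp(-|ξ|²/2) + b (|ξ| + |ξ|⁻¹) ∫₀^{|ξ|} exp(-u²/2) du)` with normalising constants
`a`, `b`. The integral is rescaled to `[0, 1]`, so that the formula also holds at `ξ = 0`. -/
def nu (a b : ℝ) (ξ : V) : ℝ :=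
  a * (2 * Real.exp (-‖ξ‖ ^ 2 / 2) +
    b * ((‖ξ‖ ^ 2 + 1) * ∫ u in (0 : ℝ)..1, Real.exp (-(‖ξ‖ * u) ^ 2 / 2)))

theorem nu_eq (a b : ℝ) {ξ : V} (hξ : ξ ≠ 0) :
    nu a b ξ = a * (2 * Real.exp (-‖ξ‖ ^ 2 / 2) +
      b * ((‖ξ‖ + ‖ξ‖⁻¹) * ∫ u in (0 : ℝ)..‖ξ‖, Real.exp (-u ^ 2 / 2))) := by
  have h0 : ‖ξ‖ ≠ 0 := norm_ne_zero_iff.mpr hξ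
  have h := intervalIntegral.integral_comp_mul_left (a := 0) (b := 1)
    (fun u : ℝ => Real.exp (-u ^ 2 / 2)) h0
  simp only [mul_zero, mul_one, smul_eq_mul] at h
  rw [nu, h]
  field_simp

/-- The kernel
`W(ξ, ξ⋆) = c |ξ - ξ⋆|⁻¹ exp(-(|ξ|² - |ξ⋆|²)² / (8 |ξ - ξ⋆|²) - |ξ - ξ⋆|² / 8)
  - d |ξ - ξ⋆| exp(-(|ξ|² + |ξ⋆|²) / 4)` of the collision operator, with normalising constants
`c`, `d`. -/
def W (c d : ℝ) (ξ η : V) : ℝ :=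
  c / ‖ξ - η‖ * Real.exp (-(‖ξ‖ ^ 2 - ‖η‖ ^ 2) ^ 2 / (8 * ‖ξ - η‖ ^ 2) - ‖ξ - η‖ ^ 2 / 8)
    - d * ‖ξ - η‖ * Real.exp (-(‖ξ‖ ^ 2 + ‖η‖ ^ 2) / 4)

variable {𝕜 : Type*} [RCLike 𝕜] {L : ℝ}

/-- The integral operator `K f (x, ξ) = ∫ W(ξ, ξ⋆) f(x, ξ⋆) dξ⋆`. -/
def K (c d : ℝ) (f : Phase L → 𝕜) : Phase L → 𝕜 :=
  fun z => ∫ η : V, W c d z.2 η • f (z.1, η)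

/-! ### The damped transport semigroup -/

/-- The solution operator of `∂ₜ g + ξ · ∇ₓ g + ν(ξ) g = 0`, `g|ₜ₌₀ = g₀`, that is,
`(x, ξ) ↦ exp(-ν(ξ) t) g₀(x - t ξ, ξ)`. See `S_zero`, `S_solves` and `S_unique`. -/
def S (a b t : ℝ) (g : Phase L → 𝕜) : Phase L → 𝕜 :=
  fun z => Real.exp (-nu a b z.2 * t) • g (z.1 - toTorus L (t • z.2), z.2)

theorem toTorus_zero : toTorus L 0 = 0 := by
  funext i; simp [toTorus]

theorem toTorus_sub (y y' : V) : toTorus L (y - y') = toTorus L y - toTorus L y' := by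
  funext i; simp [toTorus]

theorem toTorus_surjective : Function.Surjective (toTorus L) := by
  intro x
  choose y hy using fun i => QuotientAddGroup.mk_surjective (x i)
  exact ⟨WithLp.toLp 2 y, funext fun i => hy i⟩

theorem S_zero (a b : ℝ) (g : Phase L → 𝕜) : S a b 0 g = g := by
  funext z; simp [S, toTorus_zero]

/-- `S` solves the damped transport equation; the torus variable is lifted to `y`, and the
derivative of the lifted solution in the direction `(1, ξ)` is `(∂ₜ + ξ · ∇ₓ) g`. -/
theorem S_solves (a b : ℝ) (g : Phase L → 𝕜) (ξ : V)
    (hg : Differentiable ℝ fun y : V => g (toTorus L y, ξ)) (t : ℝ) (y : V) :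
    DifferentiableAt ℝ (fun p : ℝ × V => S a b p.1 g (toTorus L p.2, ξ)) (t, y) ∧
      fderiv ℝ (fun p : ℝ × V => S a b p.1 g (toTorus L p.2, ξ)) (t, y) (1, ξ)
        + nu a b ξ • S a b t g (toTorus L y, ξ) = 0 := by
  have hd : Differentiable ℝ (fun p : ℝ × V => S a b p.1 g (toTorus L p.2, ξ)) := by
    simp only [S, ← toTorus_sub]
    have h2 : Differentiable ℝ
        (fun p : ℝ × V => g (toTorus L (p.2 - p.1 • ξ), ξ)) :=
      hg.comp (f := fun p : ℝ × V => p.2 - p.1 • ξ) (by fun_prop)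
    have h3 : Differentiable ℝ (fun p : ℝ × V => Real.exp (-nu a b ξ * p.1)) := by fun_prop
    exact h3.smul h2
  refine ⟨hd _, ?_⟩
  have hc : HasDerivAt (fun s : ℝ => (s, y + (s - t) • ξ)) ((1 : ℝ), ξ) t := by
    refine (hasDerivAt_id t).prodMk ?_
    simpa using (((hasDerivAt_id t).sub_const t).smul_const ξ).const_add y
  have h1 := HasFDerivAt.comp_hasDerivAt t
    (by simpa using (hd (t, y)).hasFDerivAt :
      HasFDerivAt _ (fderiv ℝ (fun p : ℝ × V => S a b p.1 g (toTorus L p.2, ξ)) (t, y))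
        ((fun s : ℝ => (s, y + (s - t) • ξ)) t)) hc
  have h2 : HasDerivAt (fun s : ℝ => Real.exp (-nu a b ξ * s) • g (toTorus L (y - t • ξ), ξ))
      ((Real.exp (-nu a b ξ * t) * (-nu a b ξ)) • g (toTorus L (y - t • ξ), ξ)) t := by
    have := ((hasDerivAt_id t).const_mul (-nu a b ξ)).exp.smul_const (g (toTorus L (y - t • ξ), ξ))
    simpa using this
  have h3 : ((fun p : ℝ × V => S a b p.1 g (toTorus L p.2, ξ)) ∘
      fun s : ℝ => (s, y + (s - t) • ξ)) =
      fun s : ℝ => Real.exp (-nu a b ξ * s) • g (toTorus L (y - t • ξ), ξ) := by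
    funext s
    simp only [Function.comp, S, ← toTorus_sub]
    congr 4
    module
  rw [h3] at h1
  rw [h1.unique h2]
  simp only [S, ← toTorus_sub, smul_smul, ← add_smul]
  rw [show Real.exp (-nu a b ξ * t) * -nu a b ξ + nu a b ξ * Real.exp (-nu a b ξ * t) = 0 by ring,
    zero_smul]

/-- `S` gives the only classical solution of the damped transport equation. -/
theorem S_unique (a b : ℝ) (g : Phase L → 𝕜) (v : ℝ → Phase L → 𝕜) (h0 : v 0 = g)
    (hv : ∀ ξ : V, Differentiable ℝ fun p : ℝ × V => v p.1 (toTorus L p.2, ξ))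
    (hpde : ∀ (ξ : V) (t : ℝ) (y : V),
      fderiv ℝ (fun p : ℝ × V => v p.1 (toTorus L p.2, ξ)) (t, y) (1, ξ)
        + nu a b ξ • v t (toTorus L y, ξ) = 0) (t : ℝ) : v t = S a b t g := by
  funext z
  obtain ⟨x, ξ⟩ := z
  obtain ⟨y, rfl⟩ := toTorus_surjective x
  set y0 : V := y - t • ξ with hy0
  have hder : ∀ s : ℝ, HasDerivAt
      (fun s : ℝ => Real.exp (nu a b ξ * s) • v s (toTorus L (y0 + s • ξ), ξ)) 0 s := by
    intro s
    have hc : HasDerivAt (fun s : ℝ => (s, y0 + s • ξ)) ((1 : ℝ), ξ) s := by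
      refine (hasDerivAt_id s).prodMk ?_
      simpa using ((hasDerivAt_id s).smul_const ξ).const_add y0
    have h1 := HasFDerivAt.comp_hasDerivAt s (hv ξ (s, y0 + s • ξ)).hasFDerivAt hc
    have he := ((hasDerivAt_id s).const_mul (nu a b ξ)).exp
    have h2 := he.smul h1
    rw [eq_neg_of_add_eq_zero_left (hpde ξ s (y0 + s • ξ))] at h2
    refine HasDerivAt.congr_deriv h2 ?_
    simp [smul_smul]
  have hconst := is_const_of_deriv_eq_zero (fun s => (hder s).differentiableAt)
    (fun s => (hder s).deriv) t 0
  have hyt : y0 + t • ξ = y := by simp [hy0]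
  simp only [hyt, zero_smul, add_zero, mul_zero, Real.exp_zero, one_smul, h0] at hconst
  simp only [S, ← toTorus_sub, ← hy0, ← hconst, smul_smul, ← Real.exp_add]
  simp

/-! ### Mixture operators -/

/-- Iterated ordered time integral: `mixtureAux a b c d m A s f` is
`∫₀^s ∫₀^{r₁} ⋯ ∫₀^{r_{m-1}} A S^{s-r₁} K S^{r₁-r₂} K ⋯ S^{r_{m-1}-r_m} K S^{r_m} f dr_m ⋯ dr₁`. -/
def mixtureAux (a b c d : ℝ) :
    ℕ → ((Phase L → 𝕜) → (Phase L → 𝕜)) → ℝ → (Phase L → 𝕜) → (Phase L → 𝕜)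
  | 0, A, s, f => A (S a b s f)
  | m + 1, A, s, f => fun z =>
      ∫ r in (0 : ℝ)..s, mixtureAux a b c d m (fun g => A (S a b (s - r) (K c d g))) r f z

/-- The `j`-th mixture operator, with `2j` time integrals and `2j` factors `K`. -/
def mixture (a b c d : ℝ) (j : ℕ) (t : ℝ) (f : Phase L → 𝕜) : Phase L → 𝕜 :=
  mixtureAux a b c d (2 * j) id t f

theorem mixture_one (a b c d t : ℝ) (f : Phase L → 𝕜) (z : Phase L) :
    mixture a b c d 1 t f z = ∫ s₁ in (0 : ℝ)..t, ∫ s₂ in (0 : ℝ)..s₁,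
      S a b (t - s₁) (K c d (S a b (s₁ - s₂) (K c d (S a b s₂ f)))) z := rfl

theorem mixture_two (a b c d t : ℝ) (f : Phase L → 𝕜) (z : Phase L) :
    mixture a b c d 2 t f z =
      ∫ s₁ in (0 : ℝ)..t, ∫ s₂ in (0 : ℝ)..s₁, ∫ s₃ in (0 : ℝ)..s₂, ∫ s₄ in (0 : ℝ)..s₃,
        S a b (t - s₁) (K c d (S a b (s₁ - s₂) (K c d (S a b (s₂ - s₃)
          (K c d (S a b (s₃ - s₄) (K c d (S a b s₄ f)))))))) z := rfl

/-! ### Weak derivatives and norms -/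

/-- Smooth compactly supported test functions on phase space (smoothness is that of the lift to
Euclidean space). -/
def IsTestFunction (φ : Phase L → ℝ) : Prop :=
  ContDiff ℝ ∞ (fun p : V × V => φ (toTorus L p.1, p.2)) ∧ HasCompactSupport φ

/-- The classical partial derivative `∂φ/∂xᵢ`. -/
def dx (i : Fin 3) (φ : Phase L → ℝ) : Phase L → ℝ :=
  fun z => deriv (fun s : ℝ => φ (z.1 + toTorus L (s • EuclideanSpace.single i 1), z.2)) 0

/-- The classical partial derivative `∂φ/∂ξᵢ`. -/
def dxi (i : Fin 3) (φ : Phase L → ℝ) : Phase L → ℝ :=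
  fun z => deriv (fun s : ℝ => φ (z.1, z.2 + s • EuclideanSpace.single i 1)) 0

/-- The multi-index power `∂^α = ∂₀^{α₀} ∂₁^{α₁} ∂₂^{α₂}` of a family of partial derivatives. -/
def multiDeriv (D : Fin 3 → (Phase L → ℝ) → (Phase L → ℝ)) (α : Fin 3 → ℕ) (φ : Phase L → ℝ) :
    Phase L → ℝ :=
  (D 0)^[α 0] ((D 1)^[α 1] ((D 2)^[α 2] φ))

/-- `g ∈ L²` is the weak derivative `∂^α f`, for the partial derivatives `D` (`dx` or `dxi`). -/
def IsL2WeakDeriv [Fact (0 < L)] (D : Fin 3 → (Phase L → ℝ) → (Phase L → ℝ)) (α : Fin 3 → ℕ)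
    (f g : Phase L → 𝕜) : Prop :=
  MemLp g 2 (phaseMeasure L) ∧ ∀ φ : Phase L → ℝ, IsTestFunction φ →
    ∫ z, multiDeriv D α φ z • f z ∂(phaseMeasure L) =
      (-1 : ℝ) ^ (∑ i, α i) • ∫ z, φ z • g z ∂(phaseMeasure L)

/-- `‖∂^α f‖` in `L²ₓ L²_ξ`. The infimum is over the representatives of the weak derivative, which
is unique up to null sets; the value is `∞` if there is no weak derivative in `L²`. -/
def weakDerivNorm [Fact (0 < L)] (D : Fin 3 → (Phase L → ℝ) → (Phase L → ℝ)) (α : Fin 3 → ℕ)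
    (f : Phase L → 𝕜) : ℝ≥0∞ :=
  ⨅ (g : Phase L → 𝕜) (_ : IsL2WeakDeriv D α f g), eLpNorm g 2 (phaseMeasure L)

/-- `‖∂ₓ^j f‖` in `L²ₓ L²_ξ`: the square root of the sum over `|α| = j` of `‖∂ₓ^α f‖²`. -/
def xDerivNorm [Fact (0 < L)] (j : ℕ) (f : Phase L → 𝕜) : ℝ≥0∞ :=
  (∑ α ∈ (Finset.univ : Finset (Fin 3)).piAntidiag j, weakDerivNorm dx α f ^ 2) ^ (1 / 2 : ℝ)

/-- Membership in `L²ₓ H^j_ξ`. -/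
def MemL2H [Fact (0 < L)] (j : ℕ) (f : Phase L → 𝕜) : Prop :=
  MemLp f 2 (phaseMeasure L) ∧
    ∀ α : Fin 3 → ℕ, ∑ i, α i ≤ j → ∃ g : Phase L → 𝕜, IsL2WeakDeriv dxi α f g

/-- The norm of `L²ₓ H^j_ξ`: the square root of the sum over `|α| ≤ j` of `‖∂_ξ^α f‖²`. -/
def l2HNorm [Fact (0 < L)] (j : ℕ) (f : Phase L → 𝕜) : ℝ≥0∞ :=
  (∑ k ∈ Finset.range (j + 1), ∑ α ∈ (Finset.univ : Finset (Fin 3)).piAntidiag k,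
    weakDerivNorm dxi α f ^ 2) ^ (1 / 2 : ℝ)

end MixtureLemma

end

open MeasureTheory Set
open scoped ENNReal ContDiff

noncomputable section

namespace MixtureLemma

section


/-! ### Integrals over velocity space -/

/-! Transport converts velocity regularity into spatial regularity. Since `x + τ h e - τ ξ = x - τ
(ξ - h e)`, shifting `S^τ g` by `τ h e` in space is the same as shifting by `-h e` in velocity the
function obtained by transporting `g(·, · + h e)` with the damping factor taken at `ξ + h e`. If `K`
is applied afterwards, the outer velocity shift is absorbed by the kernel, the change of damping is
controlled because `ν` is Lipschitz, and what remains is a velocity difference of `g`. So a spatial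
difference of size `δ` of `K S^τ G` is `O(|δ| / τ)` as soon as `G` is Lipschitz under velocity
translations in `L²` (`norm_tr_Kop_Sop_sub_le`). This regularity of `G` comes from a further factor
`K`, if `G = K F` (`norm_tr_Kop_sub_le`), or from the initial datum.

In the first mixture operator, with time gaps `τ₁, τ₂` between and after the two factors `K`, the
difference can be spent at either gap, with bound `1/τ₁` or `1/τ₂`. Neither is integrable in time,
but their geometric mean `(τ₁ τ₂)^(-1/2)` is, and its integral over the time simplex is `O(t)`. In
the second one, two differences are spent on the gaps `τ₁, τ₃` or on `τ₂, τ₄`; the geometric mean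
`(τ₁ τ₂ τ₃ τ₄)^(-1/2)` has integral `O(t²)`. Only one velocity derivative of the datum enters in
either case. The gaps sum to `t` together with the outermost one, so the damping factors multiply to
`exp(-ν₀ t)`, and the polynomial `(1 + t)^j` left by the Lipschitz constant of the damping is
absorbed by giving up a third of the rate.

The kernel enters through Schur's test for its velocity differences
(`exists_lintegral_gradBound_le`). The gradient of `W` grows like `1 + |ξ|`, but its Gaussian
concentrates `ξ - η` near the plane orthogonal to `ξ`, and integrating across this plane gains
`|ξ|⁻¹` (`exists_lintegral_angular_le`).

Weak derivatives are produced by duality: a bound `|∫ ∂φ u| ≤ A ‖φ‖` on test functions gives an `L²`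
derivative by Hahn-Banach and Riesz (`exists_representative`), and such bounds can be integrated
over the time simplex (`exists_representative_integral`). -/

theorem lintegral_eq_lintegral_cons (f : V → ℝ≥0∞) (hf : Measurable f) :
    ∫⁻ v, f v = ∫⁻ w : EuclideanSpace ℝ (Fin 2), ∫⁻ y : ℝ, f (WithLp.toLp 2 (Fin.cons y w)) := by
  rw [← (PiLp.volume_preserving_toLp (Fin 3)).lintegral_comp hf]
  have h1 := (volume_preserving_piFinSuccAbove (fun _ : Fin 3 => ℝ) 0).symm
  have hm : Measurable fun x : Fin 3 → ℝ => f (WithLp.toLp 2 x) :=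
    hf.comp (PiLp.volume_preserving_toLp (Fin 3)).measurable
  rw [← h1.lintegral_comp hm]
  have hm2 := hm.comp h1.measurable
  have e1 : (volume : Measure (ℝ × (Fin 2 → ℝ))) = (volume : Measure ℝ).prod volume := rfl
  rw [e1]
  refine (lintegral_prod_symm _ hm2.aemeasurable).trans ?_
  have hm3 : Measurable fun w : Fin 2 → ℝ => ∫⁻ y : ℝ,
      f (WithLp.toLp 2 ((MeasurableEquiv.piFinSuccAbove (fun _ : Fin 3 => ℝ) 0).symm (y, w))) :=
    Measurable.lintegral_prod_left' hm2
  refine ((PiLp.volume_preserving_ofLp (Fin 2)).lintegral_comp hm3).symm.trans ?_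
  refine lintegral_congr fun w => lintegral_congr fun y => ?_
  simp [MeasurableEquiv.piFinSuccAbove, Fin.insertNthEquiv]

/-- Scaling makes the mass of the Cauchy density independent of `s`. This is the mechanism that
compensates the growth `|ξ|` of the kernel's gradient. -/
theorem lintegral_cauchy_density {s ρ : ℝ} (hs : 0 < s) (hρ : 0 < ρ) :
    ∫⁻ y : ℝ, ENNReal.ofReal (s / (16 * ρ ^ 2 + s ^ 2 * y ^ 2)) =
      ENNReal.ofReal (Real.pi / 4 * ρ⁻¹) := by
  have h : (fun y : ℝ => s / (16 * ρ ^ 2 + s ^ 2 * y ^ 2)) =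
      fun y => (s / (16 * ρ ^ 2)) * (1 + (s / (4 * ρ) * y) ^ 2)⁻¹ := by
    funext y
    field_simp
    ring
  have hne : s / (4 * ρ) ≠ 0 := by positivity
  have hint : Integrable fun y : ℝ => s / (16 * ρ ^ 2 + s ^ 2 * y ^ 2) := by
    rw [h]
    exact (integrable_inv_one_add_sq.comp_mul_left' hne).const_mul _
  rw [← ofReal_integral_eq_lintegral_ofReal hint (ae_of_all _ fun y => by positivity), h,
    integral_const_mul, Measure.integral_comp_mul_left (fun x : ℝ => (1 + x ^ 2)⁻¹),
    integral_univ_inv_one_add_sq, abs_of_pos (by positivity), smul_eq_mul]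
  congr 1
  field_simp
  ring

/-- In polar coordinates the singularity is cancelled by the Jacobian, leaving a one-dimensional
Gaussian. -/
theorem lintegral_norm_inv_mul_exp_lt_top :
    ∫⁻ w : EuclideanSpace ℝ (Fin 2), ENNReal.ofReal (‖w‖⁻¹ * Real.exp (-(‖w‖ ^ 2 / 64))) < ⊤ := by
  have h : Integrable (fun w : EuclideanSpace ℝ (Fin 2) =>
      (fun r : ℝ => r⁻¹ * Real.exp (-(r ^ 2 / 64))) ‖w‖) := by
    rw [integrable_fun_norm_addHaar volume (f := fun r : ℝ => r⁻¹ * Real.exp (-(r ^ 2 / 64)))]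
    have h0 := (integrable_exp_neg_mul_sq (b := 1 / 64) (by norm_num)).integrableOn (s := Ioi 0)
    refine h0.congr_fun (fun r hr => ?_) measurableSet_Ioi
    have hr : (0 : ℝ) < r := hr
    simp only [finrank_euclideanSpace, Fintype.card_fin, smul_eq_mul]
    field_simp
    simp
  exact h.lintegral_lt_top

theorem lintegral_norm_sq_inv_mul_exp_lt_top :
    ∫⁻ v : V, ENNReal.ofReal ((‖v‖ ^ 2)⁻¹ * Real.exp (-(‖v‖ ^ 2 / 64))) < ⊤ := by
  have h : Integrable (fun w : V =>
      (fun r : ℝ => (r ^ 2)⁻¹ * Real.exp (-(r ^ 2 / 64))) ‖w‖) := by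
    rw [integrable_fun_norm_addHaar volume
      (f := fun r : ℝ => (r ^ 2)⁻¹ * Real.exp (-(r ^ 2 / 64)))]
    have h0 := (integrable_exp_neg_mul_sq (b := 1 / 64) (by norm_num)).integrableOn (s := Ioi 0)
    refine h0.congr_fun (fun r hr => ?_) measurableSet_Ioi
    have hr : (0 : ℝ) < r := hr
    simp only [finrank_euclideanSpace, Fintype.card_fin, smul_eq_mul]
    field_simp
  exact h.lintegral_lt_top

theorem lintegral_exp_neg_norm_sq_lt_top :
    ∫⁻ v : V, ENNReal.ofReal (Real.exp (-(‖v‖ ^ 2 / 8))) < ⊤ := by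
  have h : Integrable (fun w : V => (fun r : ℝ => Real.exp (-(r ^ 2 / 8))) ‖w‖) := by
    rw [integrable_fun_norm_addHaar volume (f := fun r : ℝ => Real.exp (-(r ^ 2 / 8)))]
    have h0 := (integrable_rpow_mul_exp_neg_mul_sq (b := 1 / 8) (s := 2) (by norm_num)
      (by norm_num)).integrableOn (s := Ioi 0)
    refine h0.congr_fun (fun r hr => ?_) measurableSet_Ioi
    simp only [finrank_euclideanSpace, Fintype.card_fin, smul_eq_mul]
    norm_num
    left
    ring
  exact h.lintegral_lt_top

/-- The angular average of a kernel concentrated near the plane orthogonal to `x` gains a factor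
`|x|⁻¹`. -/
theorem exists_lintegral_angular_le : ∃ C : ℝ≥0∞, C < ⊤ ∧ ∀ x : V,
    ∫⁻ v : V, ENNReal.ofReal
      (‖x‖ / (16 * ‖v‖ ^ 2 + inner ℝ x v ^ 2) * Real.exp (-(‖v‖ ^ 2 / 64))) ≤ C := by
  refine ⟨ENNReal.ofReal (Real.pi / 4) * ∫⁻ w : EuclideanSpace ℝ (Fin 2),
    ENNReal.ofReal (‖w‖⁻¹ * Real.exp (-(‖w‖ ^ 2 / 64))),
    ENNReal.mul_lt_top ENNReal.ofReal_lt_top lintegral_norm_inv_mul_exp_lt_top, fun x => ?_⟩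
  rcases eq_or_ne x 0 with rfl | hx
  · simp
  have hs : 0 < ‖x‖ := norm_pos_iff.mpr hx
  set e : V := ‖x‖ • EuclideanSpace.single 0 1 with he
  have hxe : ‖e‖ = ‖x‖ := by simp [he, norm_smul]
  -- A reflection carries the first coordinate axis to the direction of `x`, after which the inner
  -- product is `‖x‖ * v 0`.
  set R : V ≃ₗᵢ[ℝ] V := Submodule.reflection (ℝ ∙ (e - x))ᗮ with hR
  have hRe : R e = x := Submodule.reflection_sub hxe
  have hm : Measurable fun v : V => ENNReal.ofReal
      (‖x‖ / (16 * ‖v‖ ^ 2 + inner ℝ x v ^ 2) * Real.exp (-(‖v‖ ^ 2 / 64))) := by fun_prop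
  rw [← R.measurePreserving.lintegral_comp hm]
  have h1 : ∀ v : V, inner ℝ x (R v) = ‖x‖ * v 0 := by
    intro v
    conv_lhs => rw [← hRe]
    rw [R.inner_map_map, he, inner_smul_left, EuclideanSpace.inner_single_left]
    simp
  simp only [h1, R.norm_map]
  rw [lintegral_eq_lintegral_cons _ (by fun_prop)]
  rw [← lintegral_const_mul _ (by fun_prop)]
  have hne : ∀ᵐ w : EuclideanSpace ℝ (Fin 2), w ≠ 0 := by
    simp [ae_iff]
  refine lintegral_mono_ae ?_
  filter_upwards [hne] with w hw
  have hρ : 0 < ‖w‖ := norm_pos_iff.mpr hw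
  have hn : ∀ y : ℝ, ‖(WithLp.toLp 2 (Fin.cons y w) : V)‖ ^ 2 = y ^ 2 + ‖w‖ ^ 2 := by
    intro y
    rw [EuclideanSpace.real_norm_sq_eq, EuclideanSpace.real_norm_sq_eq, Fin.sum_univ_succ]
    simp
  -- The axial coordinate `y` is dropped from `‖v‖` in both places and survives only in the inner
  -- product, so a Cauchy density in `y` remains.
  calc _ ≤ ∫⁻ y : ℝ, ENNReal.ofReal (‖x‖ / (16 * ‖w‖ ^ 2 + ‖x‖ ^ 2 * y ^ 2)) *
        ENNReal.ofReal (Real.exp (-(‖w‖ ^ 2 / 64))) := by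
        refine lintegral_mono fun y => ?_
        rw [← ENNReal.ofReal_mul (by positivity), hn]
        refine ENNReal.ofReal_le_ofReal ?_
        rw [Fin.cons_zero, mul_pow]
        gcongr
        · nlinarith [sq_nonneg y]
        · nlinarith [sq_nonneg y]
    _ = _ := by
        rw [lintegral_mul_const _ (by fun_prop), lintegral_cauchy_density hs hρ,
          ← ENNReal.ofReal_mul (by positivity), ← ENNReal.ofReal_mul (by positivity)]
        ring_nf

end

section


/-! ### The collision frequency is Lipschitz -/

theorem abs_mul_exp_neg_sq_le (x : ℝ) : |x * Real.exp (-x ^ 2 / 2)| ≤ 1 := by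
  rw [abs_mul, abs_of_pos (Real.exp_pos _)]
  have h1 : 1 + x ^ 2 / 2 ≤ Real.exp (x ^ 2 / 2) := by
    linarith [Real.add_one_le_exp (x ^ 2 / 2)]
  have h2 : Real.exp (x ^ 2 / 2) * Real.exp (-x ^ 2 / 2) = 1 := by
    rw [← Real.exp_add]; simp [neg_div]
  have h3 : |x| ≤ Real.exp (x ^ 2 / 2) := by
    nlinarith [sq_nonneg (|x| - 1), sq_abs x]
  calc |x| * Real.exp (-x ^ 2 / 2) ≤ Real.exp (x ^ 2 / 2) * Real.exp (-x ^ 2 / 2) := by gcongr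
    _ = 1 := h2

theorem abs_exp_neg_sq_sub_le (x y : ℝ) :
    |Real.exp (-x ^ 2 / 2) - Real.exp (-y ^ 2 / 2)| ≤ |x - y| := by
  have hd : ∀ z ∈ (univ : Set ℝ), HasDerivWithinAt (fun x : ℝ => Real.exp (-x ^ 2 / 2))
      (-(z * Real.exp (-z ^ 2 / 2))) univ z := by
    intro z _
    have := (((hasDerivAt_id z).pow 2).neg.div_const 2).exp
    refine (HasDerivAt.congr_deriv this ?_).hasDerivWithinAt
    simp
    ring
  have := convex_univ.norm_image_sub_le_of_norm_hasDerivWithin_le (C := 1) hd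
    (fun z _ => by rw [norm_neg]; exact abs_mul_exp_neg_sq_le z) (mem_univ y) (mem_univ x)
  simpa using this

theorem abs_integral_exp_neg_sq_le (s : ℝ) :
    |∫ u in (0 : ℝ)..s, Real.exp (-u ^ 2 / 2)| ≤ ∫ u : ℝ, Real.exp (-u ^ 2 / 2) := by
  have hi : Integrable fun u : ℝ => Real.exp (-u ^ 2 / 2) := by
    convert integrable_exp_neg_mul_sq (b := 1 / 2) (by norm_num) using 3
    ring
  have := intervalIntegral.norm_integral_le_integral_norm_uIoc (a := 0) (b := s) (μ := volume)
    (f := fun u : ℝ => Real.exp (-u ^ 2 / 2))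
  refine this.trans ?_
  simp only [Real.norm_eq_abs, Real.abs_exp]
  exact setIntegral_le_integral hi (ae_of_all _ fun u => (Real.exp_pos _).le)

/-- With `f` the rescaled integral and `P s = s * f s` the integral up to `s`, the factor `(s² + 1)
f s` splits as `s P s + f s`. The first term has derivative `P s + s exp(-s²/2)`, at most `M + 1`;
the second inherits the Lipschitz constant of the Gaussian. -/
theorem exists_abs_nu_sub_le (a b : ℝ) :
    ∃ C : ℝ, 0 ≤ C ∧ ∀ ξ η : V, |nu a b ξ - nu a b η| ≤ C * ‖ξ - η‖ := by
  set M := ∫ u : ℝ, Real.exp (-u ^ 2 / 2) with hM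
  have hM0 : 0 ≤ M := integral_nonneg fun u => (Real.exp_pos _).le
  set f : ℝ → ℝ := fun s => ∫ u in (0 : ℝ)..1, Real.exp (-(s * u) ^ 2 / 2) with hf
  set P : ℝ → ℝ := fun s => ∫ u in (0 : ℝ)..s, Real.exp (-u ^ 2 / 2) with hP
  have hf1 : ∀ s r : ℝ, |f s - f r| ≤ |s - r| := by
    intro s r
    simp only [hf]
    rw [← intervalIntegral.integral_sub
      ((by fun_prop : Continuous _).intervalIntegrable _ _)
      ((by fun_prop : Continuous _).intervalIntegrable _ _)]
    have := intervalIntegral.norm_integral_le_of_norm_le_const (a := 0) (b := 1) (C := |s - r|)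
      (f := fun u : ℝ => Real.exp (-(s * u) ^ 2 / 2) - Real.exp (-(r * u) ^ 2 / 2)) ?_
    · simpa using this
    · intro u hu
      rw [uIoc_of_le zero_le_one] at hu
      refine (abs_exp_neg_sq_sub_le _ _).trans ?_
      rw [← sub_mul, abs_mul, abs_of_pos hu.1]
      exact mul_le_of_le_one_right (abs_nonneg _) hu.2
  have hsf : ∀ s, s * f s = P s := by
    intro s
    have := intervalIntegral.smul_integral_comp_mul_left (a := 0) (b := 1)
      (fun u : ℝ => Real.exp (-u ^ 2 / 2)) s
    simpa using this
  have hP1 : ∀ s r : ℝ, |s * P s - r * P r| ≤ (M + 1) * |s - r| := by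
    intro s r
    have hd : ∀ z ∈ (univ : Set ℝ), HasDerivWithinAt (fun x : ℝ => x * P x)
        (1 * P z + z * Real.exp (-z ^ 2 / 2)) univ z := by
      intro z _
      refine ((hasDerivAt_id z).mul ?_).hasDerivWithinAt
      exact intervalIntegral.integral_hasDerivAt_right
        ((by fun_prop : Continuous _).intervalIntegrable _ _)
        (by fun_prop : Continuous _).stronglyMeasurable.stronglyMeasurableAtFilter
        (by fun_prop : Continuous _).continuousAt
    have := convex_univ.norm_image_sub_le_of_norm_hasDerivWithin_le (C := M + 1) hd
      (fun z _ => (norm_add_le _ _).trans (add_le_add ?_ (abs_mul_exp_neg_sq_le z)))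
      (mem_univ r) (mem_univ s)
    · simpa using this
    · rw [one_mul]; exact abs_integral_exp_neg_sq_le z
  refine ⟨|a| * (2 + |b| * (M + 2)), by positivity, fun ξ η => ?_⟩
  have hkey : ∀ ζ : V, nu a b ζ = a * (2 * Real.exp (-‖ζ‖ ^ 2 / 2) +
      b * (‖ζ‖ * P ‖ζ‖ + f ‖ζ‖)) := by
    intro ζ
    rw [nu, ← hsf]
    ring
  have hn := abs_norm_sub_norm_le ξ η
  rw [hkey, hkey, ← mul_sub, abs_mul, mul_assoc]
  refine mul_le_mul_of_nonneg_left ?_ (abs_nonneg _)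
  have e : 2 * Real.exp (-‖ξ‖ ^ 2 / 2) + b * (‖ξ‖ * P ‖ξ‖ + f ‖ξ‖) -
      (2 * Real.exp (-‖η‖ ^ 2 / 2) + b * (‖η‖ * P ‖η‖ + f ‖η‖)) =
      2 * (Real.exp (-‖ξ‖ ^ 2 / 2) - Real.exp (-‖η‖ ^ 2 / 2)) +
      b * ((‖ξ‖ * P ‖ξ‖ - ‖η‖ * P ‖η‖) + (f ‖ξ‖ - f ‖η‖)) := by ring
  rw [e]
  calc _ ≤ 2 * |‖ξ‖ - ‖η‖| + |b| * ((M + 1) * |‖ξ‖ - ‖η‖| + |‖ξ‖ - ‖η‖|) := by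
        refine (abs_add_le _ _).trans ?_
        rw [abs_mul, abs_mul, abs_two]
        refine add_le_add (mul_le_mul_of_nonneg_left (abs_exp_neg_sq_sub_le _ _) two_pos.le) ?_
        gcongr
        exact (abs_add_le _ _).trans (add_le_add (hP1 _ _) (hf1 _ _))
    _ = (2 + |b| * (M + 2)) * |‖ξ‖ - ‖η‖| := by ring
    _ ≤ _ := by gcongr

theorem continuous_nu (a b : ℝ) : Continuous (nu a b) := by
  obtain ⟨C, hC, h⟩ := exists_abs_nu_sub_le a b
  refine LipschitzWith.continuous (K := C.toNNReal) (LipschitzWith.of_dist_le_mul fun ξ η => ?_)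
  rw [Real.dist_eq, dist_eq_norm, Real.coe_toNNReal _ hC]
  exact h ξ η

theorem measurable_nu (a b : ℝ) : Measurable (nu a b) := (continuous_nu a b).measurable

/-! ### The collision kernel -/

theorem W_comm (c d : ℝ) (ξ η : V) : W c d ξ η = W c d η ξ := by
  unfold W
  rw [norm_sub_rev ξ η, add_comm (‖ξ‖ ^ 2)]
  congr 4
  ring

theorem measurable_W (c d : ℝ) : Measurable fun p : V × V => W c d p.1 p.2 := by
  unfold W
  fun_prop

/-- A majorant for the first derivatives of `W`. -/
def gradBound (c d : ℝ) (ξ η : V) : ℝ :=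
  8 * c * ((1 + ‖ξ‖) * (‖ξ - η‖ ^ 2)⁻¹ *
      Real.exp (-((‖ξ‖ ^ 2 - ‖η‖ ^ 2) ^ 2 / ‖ξ - η‖ ^ 2 + ‖ξ - η‖ ^ 2) / 16)) +
    8 * d * Real.exp (-(‖ξ‖ ^ 2 + ‖η‖ ^ 2) / 8)

theorem measurable_gradBound (c d : ℝ) : Measurable fun p : V × V => gradBound c d p.1 p.2 := by
  unfold gradBound
  fun_prop

/-- The device by which a polynomial factor is paid for with part of a Gaussian exponent. -/
theorem exp_neg_le_mul_exp_neg {A y z : ℝ} (h : A ≤ 1 + y) :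
    A * Real.exp (-(y + z)) ≤ Real.exp (-z) := by
  have h1 : A ≤ Real.exp y := h.trans (by linarith [Real.add_one_le_exp y])
  calc A * Real.exp (-(y + z)) ≤ Real.exp y * Real.exp (-(y + z)) := by gcongr
    _ = _ := by rw [← Real.exp_add]; congr 1; ring

/-- Here `r = |ξ - η|`, `q = |ξ|² - |η|²`, `X = |ξ|`, and primes are derivatives along a line in
`ξ`. With `p = |q| / r`, differentiation costs `r⁻²` times a quadratic polynomial in `p, r` with one
factor `X`; half of the exponent absorbs everything except `1 + X`. -/
theorem abs_deriv_singular_le {r q r' q' X : ℝ} (hr : 0 < r) (hr' : |r'| ≤ 1)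
    (hq' : |q'| ≤ 2 * X) (hX : 0 ≤ X) :
    |-r' / r ^ 2 + (-(q * q') / (4 * r ^ 2) + q ^ 2 * r' / (4 * r ^ 3) - r * r' / 4) / r| *
      Real.exp (-(q ^ 2 / r ^ 2 + r ^ 2) / 8) ≤
    8 * ((1 + X) * (r ^ 2)⁻¹ * Real.exp (-(q ^ 2 / r ^ 2 + r ^ 2) / 16)) := by
  set p := |q| / r with hp
  have hp0 : 0 ≤ p := by positivity
  have hp2 : q ^ 2 / r ^ 2 = p ^ 2 := by rw [hp, div_pow, sq_abs]
  have h1 : |-r' / r ^ 2 + (-(q * q') / (4 * r ^ 2) + q ^ 2 * r' / (4 * r ^ 3) - r * r' / 4) / r|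
      ≤ (r ^ 2)⁻¹ * (1 + p * X / 2 + p ^ 2 / 4 + r ^ 2 / 4) := by
    have e : -r' / r ^ 2 + (-(q * q') / (4 * r ^ 2) + q ^ 2 * r' / (4 * r ^ 3) - r * r' / 4) / r
        = (r ^ 2)⁻¹ * (-r' + -(q / r * q') / 4 + (q / r) ^ 2 * r' / 4 - r ^ 2 * r' / 4) := by
      field_simp
      ring
    rw [e, abs_mul, abs_of_pos (by positivity)]
    refine mul_le_mul_of_nonneg_left ?_ (by positivity)
    have hqr : |q / r| = p := by rw [abs_div, abs_of_pos hr]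
    have a2 : |-(q / r * q') / 4| ≤ p * X / 2 := by
      rw [abs_div, abs_neg, abs_mul, hqr, abs_of_pos (by norm_num : (0 : ℝ) < 4)]
      nlinarith [mul_le_mul_of_nonneg_left hq' hp0]
    have a3 : |(q / r) ^ 2 * r' / 4| ≤ p ^ 2 / 4 := by
      rw [abs_div, abs_mul, abs_pow, hqr, abs_of_pos (by norm_num : (0 : ℝ) < 4)]
      nlinarith [mul_le_mul_of_nonneg_left hr' (sq_nonneg p)]
    have a4 : |r ^ 2 * r' / 4| ≤ r ^ 2 / 4 := by
      rw [abs_div, abs_mul, abs_pow, abs_of_pos hr, abs_of_pos (by norm_num : (0 : ℝ) < 4)]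
      nlinarith [mul_le_mul_of_nonneg_left hr' (sq_nonneg r)]
    rw [abs_le] at *
    constructor <;> linarith [a2.1, a2.2, a3.1, a3.2, a4.1, a4.2, hr'.1, hr'.2]
  have h2 : (1 + p * X / 2 + p ^ 2 / 4 + r ^ 2 / 4) ≤
      8 * (1 + X) * (1 + (p ^ 2 + r ^ 2) / 16) := by
    nlinarith [mul_nonneg hX (sq_nonneg (p - 1)), mul_nonneg hX (sq_nonneg r),
      mul_nonneg hX (sq_nonneg p), sq_nonneg p, sq_nonneg r]
  rw [hp2]
  calc _ ≤ (r ^ 2)⁻¹ * (8 * (1 + X) * (1 + (p ^ 2 + r ^ 2) / 16)) *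
        Real.exp (-(p ^ 2 + r ^ 2) / 8) := by
        gcongr
        exact h1.trans (mul_le_mul_of_nonneg_left h2 (by positivity))
    _ = 8 * ((1 + X) * (r ^ 2)⁻¹ * ((1 + (p ^ 2 + r ^ 2) / 16) *
        Real.exp (-((p ^ 2 + r ^ 2) / 16 + (p ^ 2 + r ^ 2) / 16)))) := by ring_nf
    _ ≤ 8 * ((1 + X) * (r ^ 2)⁻¹ * Real.exp (-((p ^ 2 + r ^ 2) / 16))) := by
        gcongr
        exact exp_neg_le_mul_exp_neg le_rfl
    _ = _ := by rw [neg_div]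

/-- The counterpart for the regular part of `W`, with `X = |ξ|` and `Y = |η|`; here the Gaussian
absorbs the whole polynomial. -/
theorem abs_deriv_regular_le {r r' q' X Y : ℝ} (hr0 : 0 ≤ r) (hr : r ≤ X + Y) (hr' : |r'| ≤ 1)
    (hq' : |q'| ≤ 2 * X) (hX : 0 ≤ X) (hY : 0 ≤ Y) :
    |r' - r * q' / 4| * Real.exp (-(X ^ 2 + Y ^ 2) / 4) ≤
      8 * Real.exp (-(X ^ 2 + Y ^ 2) / 8) := by
  have h1 : |r' - r * q' / 4| ≤ 8 * (1 + (X ^ 2 + Y ^ 2) / 8) := by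
    have a2 : |r * q' / 4| ≤ (X + Y) * X / 2 := by
      rw [abs_div, abs_mul, abs_of_nonneg hr0, abs_of_pos (by norm_num : (0 : ℝ) < 4)]
      nlinarith [mul_le_mul hr hq' (abs_nonneg _) (by positivity)]
    rw [abs_le] at *
    constructor <;> nlinarith [sq_nonneg (X - Y)]
  calc _ ≤ 8 * (1 + (X ^ 2 + Y ^ 2) / 8) * Real.exp (-(X ^ 2 + Y ^ 2) / 4) := by gcongr
    _ = 8 * ((1 + (X ^ 2 + Y ^ 2) / 8) *
        Real.exp (-((X ^ 2 + Y ^ 2) / 8 + (X ^ 2 + Y ^ 2) / 8))) := by ring_nf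
    _ ≤ 8 * Real.exp (-((X ^ 2 + Y ^ 2) / 8)) := by
        gcongr
        exact exp_neg_le_mul_exp_neg le_rfl
    _ = _ := by rw [neg_div]

theorem exists_hasDerivAt_W {c d : ℝ} (hc : 0 ≤ c) (hd : 0 ≤ d) {e : V} (he : ‖e‖ = 1) (ξ η : V)
    (s : ℝ) (hs : ξ + s • e ≠ η) :
    ∃ W' : ℝ, HasDerivAt (fun s : ℝ => W c d (ξ + s • e) η) W' s ∧
      |W'| ≤ gradBound c d (ξ + s • e) η := by
  have hγ : ∀ x, HasDerivAt (fun s : ℝ => ξ + s • e) e x := fun x => by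
    simpa using ((hasDerivAt_id x).smul_const e).const_add ξ
  have hγ2 : HasDerivAt (fun s : ℝ => ξ + s • e - η) e s := (hγ s).sub_const η
  have hne : ξ + s • e - η ≠ 0 := sub_ne_zero.mpr hs
  have hr0 : 0 < ‖ξ + s • e - η‖ := norm_pos_iff.mpr hne
  have hr := (hγ2.differentiableAt.norm ℝ hne).hasDerivAt
  have hr' : |deriv (fun s : ℝ => ‖ξ + s • e - η‖) s| ≤ 1 := by
    rw [← Real.norm_eq_abs]
    refine norm_deriv_le_of_lip' (𝕜 := ℝ) zero_le_one (Filter.Eventually.of_forall fun x => ?_)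
    rw [Real.norm_eq_abs]
    refine (abs_norm_sub_norm_le _ _).trans ?_
    rw [sub_sub_sub_cancel_right, add_sub_add_left_eq_sub, ← sub_smul, norm_smul, he]
    simp
  have hm := (hγ s).norm_sq
  have hq : |2 * inner ℝ (ξ + s • e) e| ≤ 2 * ‖ξ + s • e‖ := by
    rw [abs_mul, abs_two]
    have := abs_real_inner_le_norm (ξ + s • e) e
    rw [he, mul_one] at this
    linarith
  set r' := deriv (fun s : ℝ => ‖ξ + s • e - η‖) s
  set q' := 2 * inner ℝ (ξ + s • e) e
  have hq1 := hm.sub_const (‖η‖ ^ 2)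
  have h1 := ((hr.fun_inv hr0.ne').const_mul c).mul
    ((((hq1.fun_pow 2).neg.div ((hr.fun_pow 2).const_mul 8) (by positivity)).sub
      ((hr.fun_pow 2).div_const 8)).exp)
  have h2 := (hr.const_mul d).mul (((hm.add_const (‖η‖ ^ 2)).neg.div_const 4).exp)
  have h3 := h1.sub h2
  -- The derivative is put in the factored form to which the bounds on the singular and regular
  -- parts apply.
  refine ⟨_, HasDerivAt.congr_deriv (f' := c * ((-r' / ‖ξ + s • e - η‖ ^ 2 +
      (-((‖ξ + s • e‖ ^ 2 - ‖η‖ ^ 2) * q') / (4 * ‖ξ + s • e - η‖ ^ 2) +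
        (‖ξ + s • e‖ ^ 2 - ‖η‖ ^ 2) ^ 2 * r' / (4 * ‖ξ + s • e - η‖ ^ 3) -
        ‖ξ + s • e - η‖ * r' / 4) / ‖ξ + s • e - η‖) *
      Real.exp (-((‖ξ + s • e‖ ^ 2 - ‖η‖ ^ 2) ^ 2 / ‖ξ + s • e - η‖ ^ 2 +
        ‖ξ + s • e - η‖ ^ 2) / 8)) -
      d * ((r' - ‖ξ + s • e - η‖ * q' / 4) * Real.exp (-(‖ξ + s • e‖ ^ 2 + ‖η‖ ^ 2) / 4)))
      (HasDerivAt.congr_deriv h3 ?_) rfl, ?_⟩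
  · have e1 : -(‖ξ + s • e‖ ^ 2 - ‖η‖ ^ 2) ^ 2 / (8 * ‖ξ + s • e - η‖ ^ 2) -
        ‖ξ + s • e - η‖ ^ 2 / 8 = -((‖ξ + s • e‖ ^ 2 - ‖η‖ ^ 2) ^ 2 / ‖ξ + s • e - η‖ ^ 2 +
        ‖ξ + s • e - η‖ ^ 2) / 8 := by
      field_simp
      ring
    simp only [Pi.neg_apply, Pi.sub_apply, Pi.div_apply, e1]
    field_simp
    ring
  · refine (abs_sub _ _).trans ?_
    rw [abs_mul, abs_mul, abs_mul, abs_mul, Real.abs_exp, Real.abs_exp, abs_of_nonneg hc,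
      abs_of_nonneg hd, gradBound]
    have b1 := mul_le_mul_of_nonneg_left (abs_deriv_singular_le
      (q := ‖ξ + s • e‖ ^ 2 - ‖η‖ ^ 2) hr0 hr' hq (norm_nonneg _)) hc
    have b2 := mul_le_mul_of_nonneg_left (abs_deriv_regular_le hr0.le (norm_sub_le _ _) hr' hq
      (norm_nonneg _) (norm_nonneg η)) hd
    linarith

end

/-! ### Schur integrals of the kernel and of its gradient bound -/

section


/-- Here `a` is the inner product of `ξ - η` with a centre of norm `X`, either `ξ` or `η`. In `(1 +
X)` the summand `1` needs no decay in `a`, while the summand `X` keeps it, in the rational form `X /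
(16 r² + a²)`. -/
theorem singular_le_of_angle {r q a X X' : ℝ} (hr : 0 ≤ r) (hX : 0 ≤ X)
    (hXX' : X' ≤ X + r) (hq : 2 * a ^ 2 / r ^ 2 ≤ q ^ 2 / r ^ 2 + r ^ 2) :
    (1 + X') * (r ^ 2)⁻¹ * Real.exp (-(q ^ 2 / r ^ 2 + r ^ 2) / 16) ≤
      64 * ((r ^ 2)⁻¹ * Real.exp (-(r ^ 2 / 64))) +
        1024 * (X / (16 * r ^ 2 + a ^ 2) * Real.exp (-(r ^ 2 / 64))) := by
  rcases hr.eq_or_lt with rfl | hr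
  -- At `r = 0` the left side vanishes because `0⁻¹ = 0`.
  · simp
    positivity
  -- `exp(-y) ≤ 1 / (1 + y)` replaces the angular Gaussian by a rational factor, whose axial
  -- integral is explicit.
  have hy : Real.exp (-(a ^ 2 / (16 * r ^ 2))) ≤ 16 * r ^ 2 / (16 * r ^ 2 + a ^ 2) := by
    have h := exp_neg_le_mul_exp_neg (A := 1 + a ^ 2 / (16 * r ^ 2)) (y := a ^ 2 / (16 * r ^ 2))
      (z := 0) le_rfl
    have e : 1 + a ^ 2 / (16 * r ^ 2) = (16 * r ^ 2 + a ^ 2) / (16 * r ^ 2) := by field_simp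
    rw [e, add_zero, neg_zero, Real.exp_zero] at h
    rw [le_div_iff₀ (by positivity)]
    rw [div_mul_eq_mul_div, div_le_one (by positivity)] at h
    linarith
  have hy1 : Real.exp (-(a ^ 2 / (16 * r ^ 2))) ≤ 1 := by
    rw [Real.exp_le_one_iff]
    have : 0 ≤ a ^ 2 / (16 * r ^ 2) := by positivity
    linarith
  have hz : (1 + r) * Real.exp (-(r ^ 2 / 64 + r ^ 2 / 64)) ≤ 64 * Real.exp (-(r ^ 2 / 64)) := by
    have := exp_neg_le_mul_exp_neg (A := (1 + r) / 64) (y := r ^ 2 / 64) (z := r ^ 2 / 64)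
      (by nlinarith [sq_nonneg (r - 1)])
    linarith
  -- The exponent is cut in two halves: one dominates `a² / (16 r²)` by `hq`, the other `r² / 32`,
  -- of which half will absorb `1 + r`.
  have hexp : Real.exp (-(q ^ 2 / r ^ 2 + r ^ 2) / 16) ≤
      Real.exp (-(a ^ 2 / (16 * r ^ 2))) * Real.exp (-(r ^ 2 / 64 + r ^ 2 / 64)) := by
    rw [← Real.exp_add]
    refine Real.exp_le_exp.mpr ?_
    have h1 : 0 ≤ q ^ 2 / r ^ 2 := by positivity
    have e : a ^ 2 / (16 * r ^ 2) = 2 * a ^ 2 / r ^ 2 / 32 := by field_simp; ring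
    rw [e]
    linarith
  calc _ ≤ ((1 + X) * (1 + r)) * (r ^ 2)⁻¹ * (Real.exp (-(a ^ 2 / (16 * r ^ 2))) *
        Real.exp (-(r ^ 2 / 64 + r ^ 2 / 64))) := by
        gcongr
        nlinarith [mul_nonneg hX hr.le]
    _ = (1 + X) * (r ^ 2)⁻¹ * Real.exp (-(a ^ 2 / (16 * r ^ 2))) *
        ((1 + r) * Real.exp (-(r ^ 2 / 64 + r ^ 2 / 64))) := by ring
    _ ≤ (1 + X) * (r ^ 2)⁻¹ * Real.exp (-(a ^ 2 / (16 * r ^ 2))) *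
        (64 * Real.exp (-(r ^ 2 / 64))) := by gcongr
    _ = 64 * ((r ^ 2)⁻¹ * Real.exp (-(a ^ 2 / (16 * r ^ 2))) * Real.exp (-(r ^ 2 / 64))) +
        64 * (X * ((r ^ 2)⁻¹ * Real.exp (-(a ^ 2 / (16 * r ^ 2)))) * Real.exp (-(r ^ 2 / 64))) := by
        ring
    _ ≤ 64 * ((r ^ 2)⁻¹ * 1 * Real.exp (-(r ^ 2 / 64))) +
        64 * (X * ((r ^ 2)⁻¹ * (16 * r ^ 2 / (16 * r ^ 2 + a ^ 2))) * Real.exp (-(r ^ 2 / 64))) := by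
        gcongr
    _ = _ := by
        field_simp
        ring

/-- With `r = ‖ξ - η‖` and `a` the inner product, `|ξ|² - |η|² = 2a - r²`, and `(2a - r²)² + r⁴ -
2a² = 2 (a - r²)²`. -/
theorem angle_le_left (ξ η : V) :
    2 * (inner ℝ ξ (ξ - η)) ^ 2 / ‖ξ - η‖ ^ 2 ≤
      (‖ξ‖ ^ 2 - ‖η‖ ^ 2) ^ 2 / ‖ξ - η‖ ^ 2 + ‖ξ - η‖ ^ 2 := by
  rcases eq_or_ne ξ η with rfl | h
  · simp
  have hr : 0 < ‖ξ - η‖ := norm_pos_iff.mpr (sub_ne_zero.mpr h)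
  have e : ‖η‖ ^ 2 = ‖ξ‖ ^ 2 - 2 * inner ℝ ξ (ξ - η) + ‖ξ - η‖ ^ 2 := by
    rw [← norm_sub_sq_real, sub_sub_cancel]
  set r := ‖ξ - η‖
  set a := inner ℝ ξ (ξ - η)
  rw [e, div_add' _ _ _ (by positivity), div_le_div_iff_of_pos_right (by positivity)]
  nlinarith [sq_nonneg (a - r ^ 2)]

theorem angle_le_right (ξ η : V) :
    2 * (inner ℝ η (ξ - η)) ^ 2 / ‖ξ - η‖ ^ 2 ≤
      (‖ξ‖ ^ 2 - ‖η‖ ^ 2) ^ 2 / ‖ξ - η‖ ^ 2 + ‖ξ - η‖ ^ 2 := by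
  have h := angle_le_left η ξ
  rw [← neg_sub ξ η, inner_neg_right, norm_neg, neg_sq] at h
  refine h.trans (le_of_eq ?_)
  ring

/-- A translation-invariant-type majorant used in Schur's test. -/
def schurMajorant (x v : V) : ℝ≥0∞ :=
  64 * ENNReal.ofReal ((‖v‖ ^ 2)⁻¹ * Real.exp (-(‖v‖ ^ 2 / 64))) +
    1024 * ENNReal.ofReal
      (‖x‖ / (16 * ‖v‖ ^ 2 + inner ℝ x v ^ 2) * Real.exp (-(‖v‖ ^ 2 / 64)))

theorem exists_lintegral_schurMajorant_le :
    ∃ C : ℝ≥0∞, C < ⊤ ∧ ∀ x : V, ∫⁻ v, schurMajorant x v ≤ C := by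
  obtain ⟨C, hC, h⟩ := exists_lintegral_angular_le
  refine ⟨64 * (∫⁻ v : V, ENNReal.ofReal ((‖v‖ ^ 2)⁻¹ * Real.exp (-(‖v‖ ^ 2 / 64)))) + 1024 * C,
    ENNReal.add_lt_top.mpr ⟨ENNReal.mul_lt_top (by simp) lintegral_norm_sq_inv_mul_exp_lt_top,
      ENNReal.mul_lt_top (by simp) hC⟩, fun x => ?_⟩
  unfold schurMajorant
  rw [lintegral_add_left (by fun_prop), lintegral_const_mul _ (by fun_prop),
    lintegral_const_mul _ (by fun_prop)]
  gcongr
  exact h x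

/-- The minimum keeps both choices of centre available. In each Schur integral the frozen variable
is taken as centre, so that the majorant becomes a function of `ξ - η` alone. -/
theorem ofReal_gradBound_le {c d : ℝ} (hc : 0 ≤ c) (hd : 0 ≤ d) (ξ η : V) :
    ENNReal.ofReal (gradBound c d ξ η) ≤
      ENNReal.ofReal (8 * c) * min (schurMajorant ξ (ξ - η)) (schurMajorant η (ξ - η)) +
      ENNReal.ofReal (8 * d) * min (ENNReal.ofReal (Real.exp (-(‖ξ‖ ^ 2 / 8))))
        (ENNReal.ofReal (Real.exp (-(‖η‖ ^ 2 / 8)))) := by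
  have key : ∀ x : V, ‖ξ‖ ≤ ‖x‖ + ‖ξ - η‖ → 2 * (inner ℝ x (ξ - η)) ^ 2 / ‖ξ - η‖ ^ 2 ≤
      (‖ξ‖ ^ 2 - ‖η‖ ^ 2) ^ 2 / ‖ξ - η‖ ^ 2 + ‖ξ - η‖ ^ 2 →
      ENNReal.ofReal ((1 + ‖ξ‖) * (‖ξ - η‖ ^ 2)⁻¹ *
        Real.exp (-((‖ξ‖ ^ 2 - ‖η‖ ^ 2) ^ 2 / ‖ξ - η‖ ^ 2 + ‖ξ - η‖ ^ 2) / 16)) ≤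
      schurMajorant x (ξ - η) := by
    intro x h1 h2
    refine (ENNReal.ofReal_le_ofReal (singular_le_of_angle (norm_nonneg _) (norm_nonneg _)
      h1 h2)).trans ?_
    rw [ENNReal.ofReal_add (by positivity) (by positivity), ENNReal.ofReal_mul (by norm_num),
      ENNReal.ofReal_mul (p := 1024) (by norm_num), schurMajorant]
    simp
  unfold gradBound
  rw [ENNReal.ofReal_add (by positivity) (by positivity), ENNReal.ofReal_mul (by positivity),
    ENNReal.ofReal_mul (p := 8 * d) (by positivity)]
  gcongr
  · refine le_min (key ξ (by simp) (angle_le_left ξ η)) (key η ?_ (angle_le_right ξ η))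
    calc ‖ξ‖ = ‖η + (ξ - η)‖ := by rw [add_sub_cancel]
      _ ≤ _ := norm_add_le _ _
  · refine le_min (ENNReal.ofReal_le_ofReal (Real.exp_le_exp.mpr ?_))
      (ENNReal.ofReal_le_ofReal (Real.exp_le_exp.mpr ?_))
    · nlinarith [sq_nonneg ‖η‖]
    · nlinarith [sq_nonneg ‖ξ‖]

theorem measurable_schurMajorant (x : V) : Measurable (schurMajorant x) := by
  unfold schurMajorant
  fun_prop

theorem exists_lintegral_gradBound_le {c d : ℝ} (hc : 0 ≤ c) (hd : 0 ≤ d) :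
    ∃ C : ℝ≥0∞, C < ⊤ ∧ (∀ ξ : V, ∫⁻ η, ENNReal.ofReal (gradBound c d ξ η) ≤ C) ∧
      ∀ η : V, ∫⁻ ξ, ENNReal.ofReal (gradBound c d ξ η) ≤ C := by
  obtain ⟨C, hC, h⟩ := exists_lintegral_schurMajorant_le
  refine ⟨ENNReal.ofReal (8 * c) * C + ENNReal.ofReal (8 * d) *
    ∫⁻ v : V, ENNReal.ofReal (Real.exp (-(‖v‖ ^ 2 / 8))),
    ENNReal.add_lt_top.mpr ⟨ENNReal.mul_lt_top ENNReal.ofReal_lt_top hC,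
      ENNReal.mul_lt_top ENNReal.ofReal_lt_top lintegral_exp_neg_norm_sq_lt_top⟩, fun ξ => ?_, fun η => ?_⟩
  · calc _ ≤ ∫⁻ η, (ENNReal.ofReal (8 * c) * schurMajorant ξ (ξ - η) +
          ENNReal.ofReal (8 * d) * ENNReal.ofReal (Real.exp (-(‖η‖ ^ 2 / 8)))) := by
          refine lintegral_mono fun η => (ofReal_gradBound_le hc hd ξ η).trans ?_
          gcongr
          exacts [min_le_left _ _, min_le_right _ _]
      _ ≤ _ := by
          have hm : Measurable fun η => schurMajorant ξ (ξ - η) :=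
            (measurable_schurMajorant ξ).comp (by fun_prop)
          rw [lintegral_add_left (by fun_prop), lintegral_const_mul _ hm,
            lintegral_const_mul _ (by fun_prop), lintegral_sub_left_eq_self (schurMajorant ξ) ξ]
          gcongr
          exact h ξ
  · calc _ ≤ ∫⁻ ξ, (ENNReal.ofReal (8 * c) * schurMajorant η (ξ - η) +
          ENNReal.ofReal (8 * d) * ENNReal.ofReal (Real.exp (-(‖ξ‖ ^ 2 / 8)))) := by
          refine lintegral_mono fun ξ => (ofReal_gradBound_le hc hd ξ η).trans ?_
          gcongr
          exacts [min_le_right _ _, min_le_left _ _]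
      _ ≤ _ := by
          have hm : Measurable fun ξ => schurMajorant η (ξ - η) :=
            (measurable_schurMajorant η).comp (by fun_prop)
          rw [lintegral_add_left (by fun_prop), lintegral_const_mul _ hm,
            lintegral_const_mul _ (by fun_prop), lintegral_sub_right_eq_self (schurMajorant η) η]
          gcongr
          exact h η

/-- The true singularity is only `|ξ - η|⁻¹`; it is worsened to `|ξ - η|⁻²` at the price of some
Gaussian decay, so that an integral already known to be finite can be reused. -/
theorem abs_W_le {c d : ℝ} (hc : 0 ≤ c) (hd : 0 ≤ d) (ξ η : V) :
    |W c d ξ η| ≤ 64 * c * ((‖ξ - η‖ ^ 2)⁻¹ * Real.exp (-(‖ξ - η‖ ^ 2 / 64))) +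
      8 * d * Real.exp (-(‖η‖ ^ 2 / 8)) := by
  unfold W
  refine (abs_sub _ _).trans ?_
  rw [abs_mul, abs_mul, Real.abs_exp, Real.abs_exp, abs_div, abs_norm, abs_of_nonneg hc, abs_mul,
    abs_norm, abs_of_nonneg hd]
  refine add_le_add ?_ ?_
  · rcases eq_or_ne ξ η with rfl | h
    · simp
    have hr : 0 < ‖ξ - η‖ := norm_pos_iff.mpr (sub_ne_zero.mpr h)
    set r := ‖ξ - η‖
    have h1 := exp_neg_le_mul_exp_neg (A := r / 64) (y := r ^ 2 / 64) (z := r ^ 2 / 64)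
      (by nlinarith [sq_nonneg (r - 1)])
    calc _ ≤ c / r * Real.exp (-(r ^ 2 / 64 + r ^ 2 / 64)) := by
          gcongr
          have : 0 ≤ (‖ξ‖ ^ 2 - ‖η‖ ^ 2) ^ 2 / (8 * r ^ 2) := by positivity
          rw [neg_div]
          nlinarith [sq_nonneg r]
      _ = 64 * c * ((r ^ 2)⁻¹ * (r / 64 * Real.exp (-(r ^ 2 / 64 + r ^ 2 / 64)))) := by
          field_simp
      _ ≤ _ := by gcongr
  · have h1 := exp_neg_le_mul_exp_neg (A := (‖ξ‖ + ‖η‖) / 8) (y := (‖ξ‖ ^ 2 + ‖η‖ ^ 2) / 8)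
      (z := (‖ξ‖ ^ 2 + ‖η‖ ^ 2) / 8) (by nlinarith [sq_nonneg (‖ξ‖ - 1), sq_nonneg (‖η‖ - 1)])
    calc _ ≤ d * (‖ξ‖ + ‖η‖) * Real.exp (-(‖ξ‖ ^ 2 + ‖η‖ ^ 2) / 4) := by
          gcongr
          exact norm_sub_le _ _
      _ = 8 * d * ((‖ξ‖ + ‖η‖) / 8 *
          Real.exp (-((‖ξ‖ ^ 2 + ‖η‖ ^ 2) / 8 + (‖ξ‖ ^ 2 + ‖η‖ ^ 2) / 8))) := by ring_nf
      _ ≤ 8 * d * Real.exp (-((‖ξ‖ ^ 2 + ‖η‖ ^ 2) / 8)) := by gcongr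
      _ ≤ _ := by
          gcongr
          nlinarith [sq_nonneg ‖ξ‖]

/-- One Schur integral suffices, since `W` is symmetric. -/
theorem exists_lintegral_W_le {c d : ℝ} (hc : 0 ≤ c) (hd : 0 ≤ d) :
    ∃ C : ℝ≥0∞, C < ⊤ ∧ ∀ ξ : V, ∫⁻ η, ‖W c d ξ η‖ₑ ≤ C := by
  refine ⟨ENNReal.ofReal (64 * c) * (∫⁻ v : V, ENNReal.ofReal
      ((‖v‖ ^ 2)⁻¹ * Real.exp (-(‖v‖ ^ 2 / 64)))) + ENNReal.ofReal (8 * d) *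
    ∫⁻ v : V, ENNReal.ofReal (Real.exp (-(‖v‖ ^ 2 / 8))),
    ENNReal.add_lt_top.mpr ⟨ENNReal.mul_lt_top ENNReal.ofReal_lt_top lintegral_norm_sq_inv_mul_exp_lt_top,
      ENNReal.mul_lt_top ENNReal.ofReal_lt_top lintegral_exp_neg_norm_sq_lt_top⟩, fun ξ => ?_⟩
  calc _ ≤ ∫⁻ η, (ENNReal.ofReal (64 * c) * (fun v : V => ENNReal.ofReal
          ((‖v‖ ^ 2)⁻¹ * Real.exp (-(‖v‖ ^ 2 / 64)))) (ξ - η) +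
          ENNReal.ofReal (8 * d) * ENNReal.ofReal (Real.exp (-(‖η‖ ^ 2 / 8)))) := by
        refine lintegral_mono fun η => ?_
        rw [← ofReal_norm, Real.norm_eq_abs]
        refine (ENNReal.ofReal_le_ofReal (abs_W_le hc hd ξ η)).trans ?_
        rw [ENNReal.ofReal_add (by positivity) (by positivity), ENNReal.ofReal_mul (by positivity),
          ENNReal.ofReal_mul (p := 8 * d) (by positivity)]
    _ = _ := by
        rw [lintegral_add_left (by fun_prop), lintegral_const_mul _ (by fun_prop),
          lintegral_const_mul _ (by fun_prop), lintegral_sub_left_eq_self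
          (fun v : V => ENNReal.ofReal ((‖v‖ ^ 2)⁻¹ * Real.exp (-(‖v‖ ^ 2 / 64)))) ξ]

end

/-! ### Velocity differences of the kernel -/

section


/-- `W` is singular on the diagonal, so a difference of `W` can be integrated along a segment only
if the segment avoids `η`. This discards the exceptional points. -/
theorem volume_line_eq_zero (x e : V) : volume {y : V | ∃ s : ℝ, x + s • e = y} = 0 := by
  have hne : AffineSubspace.mk' x (ℝ ∙ e) ≠ ⊤ := by
    intro h
    have h1 := congrArg AffineSubspace.direction h
    rw [AffineSubspace.direction_mk', AffineSubspace.direction_top] at h1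
    have h2 := finrank_span_le_card (R := ℝ) ({e} : Set V)
    rw [h1, finrank_top, finrank_euclideanSpace] at h2
    simp at h2
  refine measure_mono_null ?_ (Measure.addHaar_affineSubspace volume _ hne)
  rintro y ⟨s, rfl⟩
  rw [SetLike.mem_coe, AffineSubspace.mem_mk', vsub_eq_sub, add_sub_cancel_left]
  exact Submodule.smul_mem _ _ (Submodule.mem_span_singleton_self e)

theorem enorm_W_sub_le {c d : ℝ} (hc : 0 ≤ c) (hd : 0 ≤ d) {e : V} (he : ‖e‖ = 1) (ξ η : V)
    (hne : ∀ s : ℝ, ξ + s • e ≠ η) (h : ℝ) :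
    ‖W c d (ξ + h • e) η - W c d ξ η‖ₑ ≤
      ∫⁻ s in Set.uIoc 0 h, ENNReal.ofReal (gradBound c d (ξ + s • e) η) := by
  choose W' hW' hb using fun s => exists_hasDerivAt_W hc hd he ξ η s (hne s)
  have hn0 : ∀ s : ℝ, ‖ξ + s • e - η‖ ≠ 0 := fun s => norm_ne_zero_iff.mpr (sub_ne_zero.mpr (hne s))
  -- Off the diagonal `W` is `C¹` along the line. Continuity of the derivative gives the
  -- integrability required by the fundamental theorem of calculus.
  have hr : ContDiff ℝ 1 (fun s : ℝ => ‖ξ + s • e - η‖) :=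
    ContDiff.norm ℝ (by fun_prop) fun s => sub_ne_zero.mpr (hne s)
  have hm : ContDiff ℝ 1 (fun s : ℝ => ‖ξ + s • e‖ ^ 2) := ContDiff.norm_sq ℝ (by fun_prop)
  have hC : ContDiff ℝ 1 (fun s : ℝ => W c d (ξ + s • e) η) := by
    unfold W
    refine ((contDiff_const.div hr hn0).mul (ContDiff.exp ?_)).sub
      ((contDiff_const.mul hr).mul (ContDiff.exp ?_))
    · exact (((hm.sub contDiff_const).pow 2).neg.div (contDiff_const.mul (hr.pow 2))
        fun s => mul_ne_zero (by norm_num) (pow_ne_zero 2 (hn0 s))).sub ((hr.pow 2).div_const 8)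
    · exact ((hm.add contDiff_const).neg).div_const 4
  have hWeq : deriv (fun s : ℝ => W c d (ξ + s • e) η) = W' := funext fun s => (hW' s).deriv
  have hcont : Continuous W' := hWeq ▸ hC.continuous_deriv le_rfl
  have hint := intervalIntegral.integral_eq_sub_of_hasDerivAt (a := 0) (b := h)
    (fun s _ => hW' s) (hcont.intervalIntegrable _ _)
  rw [zero_smul, add_zero] at hint
  rw [← hint, enorm_eq_iff_norm_eq.mpr (intervalIntegral.norm_integral_eq_norm_integral_uIoc W')]
  refine (enorm_integral_le_lintegral_enorm _).trans (lintegral_mono fun s => ?_)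
  rw [← ofReal_norm]
  exact ENNReal.ofReal_le_ofReal (hb s)

/-- Both Schur integrals of the kernel of a velocity difference of `K` are `O(|h|)`. -/
theorem exists_lintegral_W_sub_le {c d : ℝ} (hc : 0 ≤ c) (hd : 0 ≤ d) :
    ∃ C : ℝ≥0∞, C < ⊤ ∧ ∀ e : V, ‖e‖ = 1 → ∀ h : ℝ,
      (∀ ξ : V, ∫⁻ η, ‖W c d (ξ + h • e) η - W c d ξ η‖ₑ ≤ C * ENNReal.ofReal |h|) ∧
      ∀ η : V, ∫⁻ ξ, ‖W c d (ξ + h • e) η - W c d ξ η‖ₑ ≤ C * ENNReal.ofReal |h| := by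
  obtain ⟨C, hC, h1, h2⟩ := exists_lintegral_gradBound_le hc hd
  have hm := (measurable_gradBound c d).ennreal_ofReal
  refine ⟨C, hC, fun e he h => ⟨fun ξ => ?_, fun η => ?_⟩⟩
  · have hae : ∀ᵐ η : V, ∀ s : ℝ, ξ + s • e ≠ η := by
      have := volume_line_eq_zero ξ e
      rw [measure_eq_zero_iff_ae_notMem] at this
      filter_upwards [this] with η hη s hs using hη ⟨s, hs⟩
    calc _ ≤ ∫⁻ η, ∫⁻ s in Set.uIoc 0 h, ENNReal.ofReal (gradBound c d (ξ + s • e) η) := by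
          refine lintegral_mono_ae ?_
          filter_upwards [hae] with η hη using enorm_W_sub_le hc hd he ξ η hη h
      _ = ∫⁻ s in Set.uIoc 0 h, ∫⁻ η, ENNReal.ofReal (gradBound c d (ξ + s • e) η) :=
          lintegral_lintegral_swap (Measurable.aemeasurable (hm.comp
            (f := fun p : V × ℝ => (ξ + p.2 • e, p.1)) (by fun_prop)))
      _ ≤ ∫⁻ s in Set.uIoc 0 h, C := lintegral_mono fun s => h1 _
      _ = _ := by simp [Real.volume_uIoc]
  · have hae : ∀ᵐ ξ : V, ∀ s : ℝ, ξ + s • e ≠ η := by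
      have := volume_line_eq_zero η e
      rw [measure_eq_zero_iff_ae_notMem] at this
      filter_upwards [this] with ξ hξ s hs
      exact hξ ⟨-s, by rw [← hs]; module⟩
    calc _ ≤ ∫⁻ ξ, ∫⁻ s in Set.uIoc 0 h, ENNReal.ofReal (gradBound c d (ξ + s • e) η) := by
          refine lintegral_mono_ae ?_
          filter_upwards [hae] with ξ hξ using enorm_W_sub_le hc hd he ξ η hξ h
      _ = ∫⁻ s in Set.uIoc 0 h, ∫⁻ ξ, ENNReal.ofReal (gradBound c d (ξ + s • e) η) :=
          lintegral_lintegral_swap (Measurable.aemeasurable (hm.comp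
            (f := fun p : V × ℝ => (p.1 + p.2 • e, η)) (by fun_prop)))
      _ ≤ ∫⁻ s in Set.uIoc 0 h, C := by
          refine lintegral_mono fun s => ?_
          rw [lintegral_add_right_eq_self (fun ξ => ENNReal.ofReal (gradBound c d ξ η))]
          exact h2 η
      _ = _ := by simp [Real.volume_uIoc]

end

section


variable {𝕜 : Type*} [RCLike 𝕜] {L : ℝ}

/-! ### Phase space -/

instance [Fact (0 < L)] : IsProbabilityMeasure (torusMeasure L) := by
  unfold torusMeasure; infer_instance

instance [Fact (0 < L)] : (torusMeasure L).IsAddLeftInvariant := by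
  unfold torusMeasure; infer_instance

instance [Fact (0 < L)] : SigmaFinite (phaseMeasure L) := by
  unfold phaseMeasure; infer_instance

instance [Fact (0 < L)] : IsLocallyFiniteMeasure (phaseMeasure L) := by
  unfold phaseMeasure; infer_instance

instance [Fact (0 < L)] : (phaseMeasure L).IsAddLeftInvariant :=
  Measure.prod.instIsAddLeftInvariant

/-- The quotient map from `V × V` to phase space. -/
def phaseProj (L : ℝ) (p : V × V) : Phase L := (toTorus L p.1, p.2)

theorem toTorus_add (y y' : V) : toTorus L (y + y') = toTorus L y + toTorus L y' := by
  funext i; simp [toTorus]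

theorem phaseProj_add (p q : V × V) : phaseProj L (p + q) = phaseProj L p + phaseProj L q := by
  simp [phaseProj, toTorus_add]

theorem phaseProj_zero : phaseProj L 0 = 0 := by
  simp [phaseProj, toTorus_zero]

theorem phaseProj_neg (p : V × V) : phaseProj L (-p) = -phaseProj L p := by
  rw [eq_neg_iff_add_eq_zero, ← phaseProj_add, neg_add_cancel, phaseProj_zero]

theorem continuous_toTorus : Continuous (toTorus L) :=
  continuous_pi fun i => (AddCircle.continuous_mk' L).comp (by fun_prop)

theorem continuous_phaseProj : Continuous (phaseProj L) :=
  (continuous_toTorus.comp continuous_fst).prodMk continuous_snd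

theorem phaseProj_surjective : Function.Surjective (phaseProj L) := by
  rintro ⟨x, ξ⟩
  obtain ⟨y, rfl⟩ := toTorus_surjective x
  exact ⟨(y, ξ), rfl⟩

/-- Test functions are smooth through their lift; the open quotient map brings continuity back down
to phase space. -/
theorem isOpenQuotientMap_toTorus : IsOpenQuotientMap (toTorus L) := by
  have h1 : IsOpenQuotientMap (fun y : Fin 3 → ℝ => fun i => (y i : AddCircle L)) :=
    IsOpenQuotientMap.piMap fun i => QuotientAddGroup.isOpenQuotientMap_mk
  exact h1.comp (PiLp.homeomorph 2 (fun _ : Fin 3 => ℝ)).isOpenQuotientMap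

theorem isOpenQuotientMap_phaseProj : IsOpenQuotientMap (phaseProj L) :=
  isOpenQuotientMap_toTorus.prodMap (IsOpenQuotientMap.id)

/-! ### Test functions -/

theorem IsTestFunction.contDiff {φ : Phase L → ℝ} (h : IsTestFunction φ) :
    ContDiff ℝ ∞ (fun p => φ (phaseProj L p)) := h.1

theorem IsTestFunction.continuous {φ : Phase L → ℝ} (h : IsTestFunction φ) : Continuous φ :=
  isOpenQuotientMap_phaseProj.continuous_comp_iff.mp h.contDiff.continuous

theorem isTestFunction_zero : IsTestFunction (0 : Phase L → ℝ) :=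
  ⟨contDiff_const, HasCompactSupport.zero⟩

theorem IsTestFunction.add {φ ψ : Phase L → ℝ} (h : IsTestFunction φ) (h' : IsTestFunction ψ) :
    IsTestFunction (φ + ψ) :=
  ⟨h.1.add h'.1, h.2.add h'.2⟩

theorem IsTestFunction.const_smul {φ : Phase L → ℝ} (r : ℝ) (h : IsTestFunction φ) :
    IsTestFunction (r • φ) :=
  ⟨h.1.const_smul r, h.2.mono (Function.support_const_smul_subset r φ)⟩

theorem IsTestFunction.sum {ι : Type*} (s : Finset ι) {φ : ι → Phase L → ℝ}
    (h : ∀ i, IsTestFunction (φ i)) : IsTestFunction (∑ i ∈ s, φ i) := by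
  classical
  induction s using Finset.induction_on with
  | empty => exact isTestFunction_zero
  | insert i s hi ih => rw [Finset.sum_insert hi]; exact (h i).add ih

theorem IsTestFunction.comp_smooth {φ : Phase L → ℝ} (h : IsTestFunction φ) {g : ℝ → ℝ}
    (hg : ContDiff ℝ ∞ g) (hg0 : g 0 = 0) : IsTestFunction (fun z => g (φ z)) :=
  ⟨hg.comp h.1, h.2.comp_left hg0⟩

theorem IsTestFunction.comp_add_right {φ : Phase L → ℝ} (h : IsTestFunction φ) (q : Phase L) :
    IsTestFunction (fun z => φ (z + q)) := by
  obtain ⟨q, rfl⟩ := phaseProj_surjective q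
  refine ⟨?_, h.2.comp_homeomorph (Homeomorph.addRight (phaseProj L q))⟩
  have : (fun p : V × V => φ (phaseProj L p + phaseProj L q)) =
      fun p => φ (phaseProj L (p + q)) := by
    funext p; rw [phaseProj_add]
  exact this ▸ h.contDiff.comp (contDiff_id.add contDiff_const)

/-- The derivative of a function on phase space in the direction `w`. -/
def dirDeriv (w : V × V) (φ : Phase L → ℝ) : Phase L → ℝ :=
  fun z => deriv (fun s : ℝ => φ (z + phaseProj L (s • w))) 0

theorem dx_eq_dirDeriv (i : Fin 3) :
    (dx i : (Phase L → ℝ) → _) = dirDeriv (EuclideanSpace.single i 1, 0) := by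
  funext φ z
  simp only [dx, dirDeriv, phaseProj, Prod.smul_mk, smul_zero]
  congr 1
  funext s
  congr 1
  exact Prod.ext rfl (add_zero _).symm

theorem dxi_eq_dirDeriv (i : Fin 3) :
    (dxi i : (Phase L → ℝ) → _) = dirDeriv (0, EuclideanSpace.single i 1) := by
  funext φ z
  simp only [dxi, dirDeriv, phaseProj, Prod.smul_mk, smul_zero, toTorus_zero]
  congr 1
  funext s
  congr 1
  exact Prod.ext (add_zero _).symm rfl

theorem IsTestFunction.hasDerivAt {φ : Phase L → ℝ} (h : IsTestFunction φ) (w : V × V)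
    (z : Phase L) (s : ℝ) :
    HasDerivAt (fun s : ℝ => φ (z + phaseProj L (s • w)))
      (dirDeriv w φ (z + phaseProj L (s • w))) s := by
  have key : ∀ (p : V × V) (s : ℝ), HasDerivAt (fun s : ℝ => φ (phaseProj L p + phaseProj L (s • w)))
      (fderiv ℝ (fun p => φ (phaseProj L p)) (p + s • w) w) s := by
    intro p s
    have h1 : HasDerivAt (fun s : ℝ => p + s • w) w s := by
      simpa using ((hasDerivAt_id s).smul_const w).const_add p
    have h2 := (h.contDiff.differentiable (by simp) (p + s • w)).hasFDerivAt.comp_hasDerivAt s h1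
    refine h2.congr_of_eventuallyEq (Filter.Eventually.of_forall fun s => ?_)
    simp [phaseProj_add]
  obtain ⟨p, rfl⟩ := phaseProj_surjective z
  refine (key p s).congr_deriv ?_
  rw [dirDeriv, ← phaseProj_add, (key (p + s • w) 0).deriv]
  simp

theorem IsTestFunction.dirDeriv_phaseProj {φ : Phase L → ℝ} (h : IsTestFunction φ) (w p : V × V) :
    dirDeriv w φ (phaseProj L p) = fderiv ℝ (fun p => φ (phaseProj L p)) p w := by
  have h1 : HasDerivAt (fun s : ℝ => p + s • w) w 0 := by
    simpa using ((hasDerivAt_id (0 : ℝ)).smul_const w).const_add p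
  have h3 : DifferentiableAt ℝ (fun p => φ (phaseProj L p)) (p + (0 : ℝ) • w) :=
    h.contDiff.differentiable (by simp) _
  have h2 := h3.hasFDerivAt.comp_hasDerivAt (0 : ℝ) h1
  rw [zero_smul, add_zero] at h2
  rw [dirDeriv, ← h2.deriv]
  congr 1

theorem IsTestFunction.dirDeriv {φ : Phase L → ℝ} (h : IsTestFunction φ) (w : V × V) :
    IsTestFunction (dirDeriv w φ) := by
  constructor
  · have : (fun p : V × V => MixtureLemma.dirDeriv w φ (toTorus L p.1, p.2)) =
        fun p => fderiv ℝ (fun p => φ (phaseProj L p)) p w :=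
      funext fun p => h.dirDeriv_phaseProj w p
    rw [this]
    exact (h.contDiff.fderiv_right (m := ∞) (by simp)).clm_apply contDiff_const
  · refine HasCompactSupport.intro h.2 fun z hz => ?_
    have h0 : φ =ᶠ[nhds z] 0 := notMem_tsupport_iff_eventuallyEq.mp hz
    have hc : Filter.Tendsto (fun s : ℝ => z + phaseProj L (s • w)) (nhds 0) (nhds z) := by
      have : Continuous fun s : ℝ => z + phaseProj L (s • w) :=
        continuous_const.add (continuous_phaseProj.comp (by fun_prop))
      have := this.tendsto 0
      simpa [phaseProj_zero] using this
    have h1 : (fun s : ℝ => φ (z + phaseProj L (s • w))) =ᶠ[nhds 0] fun _ => (0 : ℝ) :=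
      hc.eventually h0
    rw [MixtureLemma.dirDeriv, h1.deriv_eq]
    simp

variable [Fact (0 < L)]

theorem IsTestFunction.memLp {φ : Phase L → ℝ} (h : IsTestFunction φ) :
    MemLp φ 2 (phaseMeasure L) :=
  h.continuous.memLp_of_hasCompactSupport h.2

theorem IsTestFunction.integrable_smul {φ : Phase L → ℝ} (h : IsTestFunction φ) {u : Phase L → 𝕜}
    (hu : LocallyIntegrable u (phaseMeasure L)) :
    Integrable (fun z => φ z • u z) (phaseMeasure L) :=
  hu.integrable_smul_left_of_hasCompactSupport h.continuous h.2

/-- Differentiation under the integral. As `u` is only locally integrable, the dominating function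
must live on a compact set. -/
theorem IsTestFunction.hasDerivAt_integral {φ : Phase L → ℝ} (h : IsTestFunction φ) (w : V × V)
    {u : Phase L → 𝕜} (hu : LocallyIntegrable u (phaseMeasure L)) :
    HasDerivAt (fun s : ℝ => ∫ z, φ (z + phaseProj L (s • w)) • u z ∂phaseMeasure L)
      (∫ z, MixtureLemma.dirDeriv w φ z • u z ∂phaseMeasure L) 0 := by
  have hD := h.dirDeriv w
  obtain ⟨M, hM⟩ := hD.2.exists_bound_of_continuous hD.continuous
  -- `T` contains the supports of all translates of the derivative with parameter in `[-1, 1]`.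
  set T : Set (Phase L) := (fun p : Phase L × ℝ => p.1 - phaseProj L (p.2 • w)) ''
    (tsupport (MixtureLemma.dirDeriv w φ) ×ˢ Icc (-1) 1) with hT
  have hTc : IsCompact T := by
    refine (hD.2.isCompact.prod isCompact_Icc).image ?_
    exact continuous_fst.sub (continuous_phaseProj.comp (by fun_prop))
  have hTm : MeasurableSet T := hTc.isClosed.measurableSet
  have := hasDerivAt_integral_of_dominated_loc_of_deriv_le (μ := phaseMeasure L)
    (F := fun (s : ℝ) z => φ (z + phaseProj L (s • w)) • u z)
    (F' := fun (s : ℝ) z => MixtureLemma.dirDeriv w φ (z + phaseProj L (s • w)) • u z)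
    (x₀ := 0) (s := Ioo (-1) 1) (bound := T.indicator fun z => M * ‖u z‖)
    (Ioo_mem_nhds (by norm_num) (by norm_num))
    (Filter.Eventually.of_forall fun s =>
      ((h.comp_add_right _).integrable_smul hu).aestronglyMeasurable)
    ((h.comp_add_right _).integrable_smul hu)
    ((hD.comp_add_right _).integrable_smul hu).aestronglyMeasurable
    (ae_of_all _ fun z s hs => ?_) ?_ (ae_of_all _ fun z s hs => ?_)
  · have h2 := this.2
    simpa only [zero_smul, phaseProj_zero, add_zero] using h2
  · by_cases hz : z ∈ T
    · rw [indicator_of_mem hz, norm_smul]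
      gcongr
      exact hM _
    · rw [indicator_of_notMem hz]
      have : z + phaseProj L (s • w) ∉ tsupport (MixtureLemma.dirDeriv w φ) := fun hz' =>
        hz ⟨(_, s), ⟨hz', Ioo_subset_Icc_self hs⟩, by simp⟩
      simp [image_eq_zero_of_notMem_tsupport this]
  · rw [integrable_indicator_iff hTm]
    exact ((hu.integrableOn_isCompact hTc).norm).const_mul M
  · exact (h.hasDerivAt w z s).smul_const (u z)

end

section


variable {𝕜 : Type*} [RCLike 𝕜] {L : ℝ}

/-! ### Separation by test functions -/

/-- A function on phase space with a smooth lift, vanishing only at the origin. -/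
def originGauge (z : Phase L) : ℝ :=
  (∑ i, (1 - ((z.1 i).toCircle : ℂ).re)) + ‖z.2‖ ^ 2

theorem one_sub_re_circle_nonneg (w : Circle) : 0 ≤ 1 - (w : ℂ).re := by
  have := Complex.re_le_norm (w : ℂ)
  rw [Circle.norm_coe] at this
  linarith

theorem norm_sq_le_originGauge (z : Phase L) : ‖z.2‖ ^ 2 ≤ originGauge z :=
  le_add_of_nonneg_left (Finset.sum_nonneg fun _ _ => one_sub_re_circle_nonneg _)

theorem continuous_originGauge : Continuous (originGauge (L := L)) := by
  unfold originGauge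
  have : ∀ i : Fin 3, Continuous fun z : Phase L => ((z.1 i).toCircle : ℂ) := fun i =>
    continuous_subtype_val.comp (AddCircle.continuous_toCircle.comp (by fun_prop))
  fun_prop

theorem contDiff_originGauge :
    ContDiff ℝ ∞ fun p : V × V => originGauge ((toTorus L p.1, p.2) : Phase L) := by
  unfold originGauge toTorus
  have h : ∀ y : ℝ, ((AddCircle.toCircle (y : AddCircle L) : Circle) : ℂ).re =
      Real.cos (2 * Real.pi / L * y) := by
    intro y
    rw [AddCircle.toCircle_apply_mk, Circle.coe_exp, Complex.exp_ofReal_mul_I_re]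
  simp only [h]
  refine ContDiff.add (ContDiff.sum fun i _ => contDiff_const.sub (Real.contDiff_cos.comp ?_)) ?_
  · exact contDiff_const.mul ((contDiff_piLp_apply (p := 2) (i := i)).comp contDiff_fst)
  · exact contDiff_snd.norm_sq ℝ

variable [Fact (0 < L)]

theorem originGauge_pos {z : Phase L} (hz : z ≠ 0) : 0 < originGauge z := by
  refine lt_of_le_of_ne ((sq_nonneg _).trans (norm_sq_le_originGauge z)) fun h => hz ?_
  have hs := Finset.sum_nonneg fun (i : Fin 3) (_ : i ∈ Finset.univ) =>
    one_sub_re_circle_nonneg (z.1 i).toCircle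
  have h2 : ‖z.2‖ ^ 2 = 0 := by
    unfold originGauge at h
    nlinarith [sq_nonneg ‖z.2‖]
  have h1 : ∑ i, (1 - ((z.1 i).toCircle : ℂ).re) = 0 := by
    unfold originGauge at h
    linarith
  refine Prod.ext (funext fun i => ?_) (by simpa using h2)
  have h3 := (Finset.sum_eq_zero_iff_of_nonneg
    (fun (i : Fin 3) _ => one_sub_re_circle_nonneg (z.1 i).toCircle)).mp h1 i (Finset.mem_univ i)
  have hL : L ≠ 0 := (Fact.out : 0 < L).ne'
  refine AddCircle.injective_toCircle hL ?_
  rw [Prod.fst_zero, Pi.zero_apply, AddCircle.toCircle_zero]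
  have hre : ((z.1 i).toCircle : ℂ).re = 1 := by linarith
  have hn := Complex.sq_norm ((z.1 i).toCircle : ℂ)
  rw [Circle.norm_coe, Complex.normSq_apply, hre] at hn
  exact Circle.ext (Complex.ext (by simpa using hre) (by simpa using hn))

/-- The gauge is at least `1` outside the unit velocity ball and attains a positive minimum on the
compact part of the complement of `U`. A smooth cutoff of the gauge below the resulting `ε`
therefore vanishes off `U`. -/
theorem exists_bump_at_zero {U : Set (Phase L)} (hU : IsOpen U) (h0 : (0 : Phase L) ∈ U) :
    ∃ φ : Phase L → ℝ, IsTestFunction φ ∧ 0 < φ 0 ∧ (∀ z, 0 ≤ φ z) ∧ ∀ z ∉ U, φ z = 0 := by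
  obtain ⟨ε, hε, hε1, hεU⟩ : ∃ ε : ℝ, 0 < ε ∧ ε ≤ 1 ∧ ∀ z ∉ U, ε ≤ originGauge z := by
    have hK : IsCompact (((univ : Set (Torus L)) ×ˢ Metric.closedBall (0 : V) 1) \ U) :=
      (isCompact_univ.prod (isCompact_closedBall _ _)).diff hU
    have hout : ∀ z : Phase L,
        z ∉ (univ : Set (Torus L)) ×ˢ Metric.closedBall (0 : V) 1 → 1 ≤ originGauge z := by
      intro z hz
      have : 1 < ‖z.2‖ := by simpa using hz
      nlinarith [norm_sq_le_originGauge z]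
    rcases eq_empty_or_nonempty (((univ : Set (Torus L)) ×ˢ Metric.closedBall (0 : V) 1) \ U)
      with he | hne
    · refine ⟨1, one_pos, le_rfl, fun z hz => hout z fun h => ?_⟩
      exact (he ▸ (⟨h, hz⟩ : z ∈ _ \ U) : z ∈ (∅ : Set (Phase L)))
    · obtain ⟨z₁, hz₁, hmin⟩ := hK.exists_isMinOn hne continuous_originGauge.continuousOn
      have hz0 : z₁ ≠ 0 := fun h => hz₁.2 (h ▸ h0)
      refine ⟨min 1 (originGauge z₁), lt_min one_pos (originGauge_pos hz0), min_le_left _ _,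
        fun z hz => ?_⟩
      by_cases hzc : z ∈ (univ : Set (Torus L)) ×ˢ Metric.closedBall (0 : V) 1
      · exact (min_le_right _ _).trans (hmin ⟨hzc, hz⟩)
      · exact (min_le_left _ _).trans (hout z hzc)
  have hzero : ∀ z : Phase L, ε ≤ originGauge z →
      Real.smoothTransition (1 - originGauge z / ε) = 0 := fun z hz =>
    Real.smoothTransition.zero_of_nonpos (by rw [sub_nonpos, one_le_div hε]; exact hz)
  refine ⟨fun z => Real.smoothTransition (1 - originGauge z / ε), ⟨?_, ?_⟩, ?_,
    fun z => Real.smoothTransition.nonneg _, fun z hz => hzero z (hεU z hz)⟩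
  · exact Real.smoothTransition.contDiff.comp
      (contDiff_const.sub (contDiff_originGauge.div_const ε))
  · refine HasCompactSupport.intro (isCompact_univ.prod (isCompact_closedBall (0 : V) 1))
      fun z hz => hzero z ?_
    have : 1 < ‖z.2‖ := by simpa using hz
    nlinarith [norm_sq_le_originGauge z]
  · refine Real.smoothTransition.pos_of_pos ?_
    simp [originGauge]

theorem exists_bump {U : Set (Phase L)} (hU : IsOpen U) {z₀ : Phase L} (h0 : z₀ ∈ U) :
    ∃ φ : Phase L → ℝ, IsTestFunction φ ∧ 0 < φ z₀ ∧ (∀ z, 0 ≤ φ z) ∧ ∀ z ∉ U, φ z = 0 := by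
  obtain ⟨φ, h1, h2, h3, h4⟩ := exists_bump_at_zero (U := (fun z => z + z₀) ⁻¹' U)
    (hU.preimage (by fun_prop)) (by simpa using h0)
  refine ⟨fun z => φ (z + -z₀), h1.comp_add_right _, by simpa using h2, fun z => h3 _,
    fun z hz => h4 _ (by simpa using hz)⟩

/-- A finite sum of bumps is positive on `K`. Dividing it by its minimum there and applying a
transition function that saturates at `1` gives the cutoff. -/
theorem exists_cutoff {K U : Set (Phase L)} (hK : IsCompact K) (hU : IsOpen U) (hKU : K ⊆ U) :
    ∃ φ : Phase L → ℝ, IsTestFunction φ ∧ (∀ z ∈ K, φ z = 1) ∧ (∀ z, |φ z| ≤ 1) ∧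
      ∀ z ∉ U, φ z = 0 := by
  rcases K.eq_empty_or_nonempty with rfl | hne
  · exact ⟨0, isTestFunction_zero, by simp, by simp, by simp⟩
  choose! ψ h1 h2 h3 h4 using fun z₀ (h : z₀ ∈ K) => exists_bump hU (hKU h)
  have hψ : ∀ z₀ : K, IsTestFunction (ψ z₀) := fun z₀ => h1 z₀ z₀.2
  obtain ⟨t, ht⟩ := hK.elim_finite_subcover (fun z₀ : K => {z | 0 < ψ z₀ z})
    (fun z₀ => isOpen_lt continuous_const (hψ z₀).continuous)
    (fun z hz => mem_iUnion.mpr ⟨⟨z, hz⟩, h2 z hz⟩)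
  set Ψ : Phase L → ℝ := ∑ z₀ ∈ t, ψ z₀ with hΨ
  have hΨt : IsTestFunction Ψ := IsTestFunction.sum t hψ
  have hΨpos : ∀ z ∈ K, 0 < Ψ z := by
    intro z hz
    obtain ⟨z₀, hz₀, hpos⟩ := mem_iUnion₂.mp (ht hz)
    rw [hΨ, Finset.sum_apply]
    exact Finset.sum_pos' (fun i _ => h3 i i.2 z) ⟨z₀, hz₀, hpos⟩
  obtain ⟨z₁, hz₁, hmin⟩ := hK.exists_isMinOn hne hΨt.continuous.continuousOn
  refine ⟨fun z => Real.smoothTransition (Ψ z / Ψ z₁),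
    hΨt.comp_smooth (g := fun x => Real.smoothTransition (x / Ψ z₁))
      (Real.smoothTransition.contDiff.comp (contDiff_id.div_const _)) (by simp),
    fun z hz => Real.smoothTransition.one_of_one_le ?_, fun z => ?_, fun z hz => ?_⟩
  · rw [one_le_div (hΨpos z₁ hz₁)]
    exact hmin hz
  · rw [abs_of_nonneg (Real.smoothTransition.nonneg _)]
    exact Real.smoothTransition.le_one _
  · have : Ψ z = 0 := by
      rw [hΨ, Finset.sum_apply]
      exact Finset.sum_eq_zero fun z₀ _ => h4 z₀ z₀.2 z hz
    simp [this]

/-- A locally integrable function with vanishing integrals against test functions is zero. -/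
theorem ae_eq_zero_of_forall_test {u : Phase L → 𝕜} (hu : LocallyIntegrable u (phaseMeasure L))
    (h : ∀ φ : Phase L → ℝ, IsTestFunction φ → ∫ z, φ z • u z ∂phaseMeasure L = 0) :
    u =ᵐ[phaseMeasure L] 0 := by
  refine ae_eq_zero_of_forall_setIntegral_isCompact_eq_zero' hu fun K hK => ?_
  rcases K.eq_empty_or_nonempty with rfl | hne
  · simp
  -- Cutoffs supported in shrinking thickenings of `K` converge pointwise to its indicator,
  -- dominated by `‖u‖` on the compact unit thickening.
  choose φ h1 h2 h3 h4 using fun n : ℕ => exists_cutoff hK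
    (Metric.isOpen_thickening (δ := 1 / ((n : ℝ) + 1)) (E := K))
    (Metric.self_subset_thickening Nat.one_div_pos_of_nat K)
  have hc : IsCompact (Metric.cthickening 1 K) := hK.cthickening
  have hKm : MeasurableSet K := hK.isClosed.measurableSet
  rw [← integral_indicator hKm]
  have hlim : Filter.Tendsto (fun n => ∫ z, φ n z • u z ∂phaseMeasure L) Filter.atTop
      (nhds (∫ z, K.indicator u z ∂phaseMeasure L)) := by
    refine tendsto_integral_of_dominated_convergence
      ((Metric.cthickening 1 K).indicator fun z => ‖u z‖)
      (fun n => ((h1 n).integrable_smul hu).aestronglyMeasurable) ?_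
      (fun n => ae_of_all _ fun z => ?_) (ae_of_all _ fun z => ?_)
    · rw [integrable_indicator_iff hc.isClosed.measurableSet]
      exact (hu.integrableOn_isCompact hc).norm
    · by_cases hz : z ∈ Metric.cthickening 1 K
      · rw [indicator_of_mem hz, norm_smul]
        exact mul_le_of_le_one_left (norm_nonneg _) (h3 n z)
      · have : z ∉ Metric.thickening (1 / ((n : ℝ) + 1)) K := fun hz' => hz
          (Metric.thickening_subset_cthickening_of_le (by
            rw [div_le_one (by positivity)]; linarith [n.cast_nonneg (α := ℝ)]) K hz')
        rw [h4 n z this, indicator_of_notMem hz]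
        simp
    · by_cases hz : z ∈ K
      · simp [indicator_of_mem hz, h2 _ z hz]
      · rw [indicator_of_notMem hz]
        have hpos := (hK.isClosed.notMem_iff_infDist_pos hne).mp hz
        refine tendsto_const_nhds.congr' ?_
        have hev := (tendsto_one_div_add_atTop_nhds_zero_nat (𝕜 := ℝ)).eventually_lt_const hpos
        filter_upwards [hev] with n hn
        have : z ∉ Metric.thickening (1 / ((n : ℝ) + 1)) K := by
          rw [Metric.mem_thickening_iff_infDist_lt hne]
          exact not_lt.mpr hn.le
        rw [h4 n z this, zero_smul]
  simp only [h _ (h1 _)] at hlim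
  exact tendsto_nhds_unique hlim tendsto_const_nhds

theorem ae_eq_of_forall_test {u v : Phase L → 𝕜} (hu : LocallyIntegrable u (phaseMeasure L))
    (hv : LocallyIntegrable v (phaseMeasure L))
    (h : ∀ φ : Phase L → ℝ, IsTestFunction φ →
      ∫ z, φ z • u z ∂phaseMeasure L = ∫ z, φ z • v z ∂phaseMeasure L) :
    u =ᵐ[phaseMeasure L] v := by
  refine Filter.eventuallyEq_iff_sub.mpr (ae_eq_zero_of_forall_test (hu.sub hv) fun φ hφ => ?_)
  simp only [Pi.sub_apply, smul_sub]
  rw [integral_sub (hφ.integrable_smul hu) (hφ.integrable_smul hv), h φ hφ, sub_self]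

end

section


variable {𝕜 : Type*} [RCLike 𝕜] {L : ℝ} [Fact (0 < L)]

/-! ### Duality with test functions -/

/-- The `L²` norm on phase space, as a real number. -/
def l2norm {E : Type*} [NormedAddCommGroup E] (f : Phase L → E) : ℝ :=
  (eLpNorm f 2 (phaseMeasure L)).toReal

theorem l2norm_nonneg {E : Type*} [NormedAddCommGroup E] (f : Phase L → E) : 0 ≤ l2norm f :=
  ENNReal.toReal_nonneg

theorem locallyIntegrable_of_memLp {u : Phase L → 𝕜} (hu : MemLp u 2 (phaseMeasure L)) :
    LocallyIntegrable u (phaseMeasure L) :=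
  hu.locallyIntegrable (by norm_num)

theorem measurePreserving_add_phase (q : Phase L) :
    MeasurePreserving (fun z : Phase L => z + q) (phaseMeasure L) (phaseMeasure L) :=
  measurePreserving_add_right _ q

theorem memLp_comp_add_right {E : Type*} [NormedAddCommGroup E] {f : Phase L → E}
    (hf : MemLp f 2 (phaseMeasure L)) (q : Phase L) :
    MemLp (fun z => f (z + q)) 2 (phaseMeasure L) :=
  hf.comp_measurePreserving (measurePreserving_add_phase q)

theorem eLpNorm_comp_add_right {E : Type*} [NormedAddCommGroup E] {f : Phase L → E}
    (hf : AEStronglyMeasurable f (phaseMeasure L)) (q : Phase L) :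
    eLpNorm (fun z => f (z + q)) 2 (phaseMeasure L) = eLpNorm f 2 (phaseMeasure L) :=
  eLpNorm_comp_measurePreserving hf (measurePreserving_add_phase q)

theorem norm_integral_smul_le {φ : Phase L → ℝ} {u : Phase L → 𝕜}
    (hφ : MemLp φ 2 (phaseMeasure L)) (hu : MemLp u 2 (phaseMeasure L)) :
    ‖∫ z, φ z • u z ∂phaseMeasure L‖ ≤ l2norm φ * l2norm u := by
  have h1 : ‖∫ z, φ z • u z ∂phaseMeasure L‖ₑ ≤
      eLpNorm φ 2 (phaseMeasure L) * eLpNorm u 2 (phaseMeasure L) := by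
    refine (enorm_integral_le_lintegral_enorm _).trans ?_
    have := eLpNorm_smul_le_mul_eLpNorm (p := 2) (q := 2) (r := 1) hu.1 hφ.1
    rwa [eLpNorm_one_eq_lintegral_enorm] at this
  rw [l2norm, l2norm, ← ENNReal.toReal_mul, ← toReal_enorm]
  exact ENNReal.toReal_mono (ENNReal.mul_ne_top hφ.2.ne hu.2.ne) h1

theorem integral_comp_add_smul (φ : Phase L → ℝ) (u : Phase L → 𝕜) (q : Phase L) :
    ∫ z, φ (z + q) • u z ∂phaseMeasure L = ∫ z, φ z • u (z - q) ∂phaseMeasure L := by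
  rw [← integral_add_right_eq_self (fun z => φ z • u (z - q)) q]
  simp

/-- The space of test functions. -/
def testSpace (L : ℝ) : Submodule ℝ (Phase L → ℝ) where
  carrier := {φ | IsTestFunction φ}
  zero_mem' := isTestFunction_zero
  add_mem' h h' := h.add h'
  smul_mem' r _ h := h.const_smul r

/-- The bound makes the functional continuous for the `L²` norm. It is extended from the image of
the test functions by Hahn-Banach, which preserves the norm, and represented by Riesz. -/
theorem exists_real_representative (Λ : testSpace L →ₗ[ℝ] ℝ) {C : ℝ} (hC : 0 ≤ C)
    (hΛ : ∀ φ : testSpace L, |Λ φ| ≤ C * l2norm φ.1) :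
    ∃ g : Phase L → ℝ, MemLp g 2 (phaseMeasure L) ∧
      eLpNorm g 2 (phaseMeasure L) ≤ ENNReal.ofReal C ∧
      ∀ φ : testSpace L, Λ φ = ∫ z, φ.1 z * g z ∂phaseMeasure L := by
  let ι : testSpace L →ₗ[ℝ] Lp ℝ 2 (phaseMeasure L) :=
    { toFun := fun φ => (IsTestFunction.memLp φ.2).toLp φ.1
      map_add' := fun φ ψ => MemLp.toLp_add _ _
      map_smul' := fun r φ => MemLp.toLp_const_smul r _ }
  have hιn : ∀ φ, ‖ι φ‖ = l2norm φ.1 := fun φ => Lp.norm_toLp φ.1 (IsTestFunction.memLp φ.2)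
  -- The functional depends only on the `L²` class of the test function, hence descends to the range
  -- of `ι`.
  have hker : LinearMap.ker ι ≤ LinearMap.ker Λ := by
    intro φ hφ
    rw [LinearMap.mem_ker] at hφ ⊢
    have := hΛ φ
    rw [← hιn, hφ, norm_zero, mul_zero] at this
    exact abs_nonpos_iff.mp this
  let Λ₁ : LinearMap.range ι →ₗ[ℝ] ℝ :=
    ((LinearMap.ker ι).liftQ Λ hker).comp ι.quotKerEquivRange.symm.toLinearMap
  have hΛ₁ : ∀ φ, Λ₁ ⟨ι φ, LinearMap.mem_range_self ι φ⟩ = Λ φ := by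
    intro φ
    simp only [Λ₁, LinearMap.comp_apply, LinearEquiv.coe_coe]
    rw [LinearMap.quotKerEquivRange_symm_apply_image ι φ, Submodule.mkQ_apply,
      Submodule.liftQ_apply]
  let Λ₂ : StrongDual ℝ (LinearMap.range ι) := Λ₁.mkContinuous C (by
    rintro ⟨_, φ, rfl⟩
    rw [hΛ₁, Real.norm_eq_abs]
    exact (hΛ φ).trans_eq (by rw [← hιn]; rfl))
  obtain ⟨G, hG, hGn⟩ := exists_extension_norm_eq _ Λ₂
  have hG2 : ‖G‖ ≤ C := hGn ▸ LinearMap.mkContinuous_norm_le _ hC _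
  set g := (InnerProductSpace.toDual ℝ (Lp ℝ 2 (phaseMeasure L))).symm G with hg
  refine ⟨g, Lp.memLp g, ?_, fun φ => ?_⟩
  · rw [← Lp.enorm_def, ← ofReal_norm]
    refine ENNReal.ofReal_le_ofReal ?_
    rw [hg, LinearIsometryEquiv.norm_map]
    exact hG2
  · have h1 : G (ι φ) = Λ φ := (hG ⟨ι φ, LinearMap.mem_range_self ι φ⟩).trans (hΛ₁ φ)
    rw [← h1, ← InnerProductSpace.toDual_symm_apply, ← hg, L2.inner_def]
    refine integral_congr_ae ?_
    filter_upwards [(IsTestFunction.memLp φ.2).coeFn_toLp] with z hz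
    simp only [ι, LinearMap.coe_mk, AddHom.coe_mk]
    rw [hz]
    rfl

theorem norm_RCLike_I_le_one : ‖(RCLike.I : 𝕜)‖ ≤ 1 := by
  rcases RCLike.I_eq_zero_or_im_I_eq_one (K := 𝕜) with h | h
  · simp [h]
  · rw [RCLike.norm_I_of_ne_zero]
    rintro h0
    simp [h0] at h

/-- Test functions are real, so the functional is only real-linear. Its real and imaginary parts are
represented separately, whence the factor `2`. -/
theorem exists_representative (Λ : testSpace L →ₗ[ℝ] 𝕜) {C : ℝ} (hC : 0 ≤ C)
    (hΛ : ∀ φ : testSpace L, ‖Λ φ‖ ≤ C * l2norm φ.1) :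
    ∃ g : Phase L → 𝕜, MemLp g 2 (phaseMeasure L) ∧
      eLpNorm g 2 (phaseMeasure L) ≤ ENNReal.ofReal (2 * C) ∧
      ∀ φ : testSpace L, Λ φ = ∫ z, φ.1 z • g z ∂phaseMeasure L := by
  obtain ⟨g₁, h1, h1n, h1i⟩ := exists_real_representative (RCLike.reLm.comp Λ) hC
    fun φ => (RCLike.abs_re_le_norm _).trans (hΛ φ)
  obtain ⟨g₂, h2, h2n, h2i⟩ := exists_real_representative (RCLike.imLm.comp Λ) hC
    fun φ => (RCLike.abs_im_le_norm _).trans (hΛ φ)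
  have m1 : MemLp (fun z => (g₁ z : 𝕜)) 2 (phaseMeasure L) := h1.ofReal
  have m2 : MemLp (fun z => (g₂ z : 𝕜) * RCLike.I) 2 (phaseMeasure L) := h2.ofReal.mul_const _
  refine ⟨fun z => g₁ z + g₂ z * RCLike.I, m1.add m2, ?_, fun φ => ?_⟩
  · refine (eLpNorm_add_le m1.1 m2.1 (by norm_num)).trans ?_
    rw [two_mul, ENNReal.ofReal_add hC hC]
    refine add_le_add ((eLpNorm_mono fun z => ?_).trans h1n) ((eLpNorm_mono fun z => ?_).trans h2n)
    · simp
    · rw [norm_mul]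
      calc _ ≤ ‖(g₂ z : 𝕜)‖ * 1 := by gcongr; exact norm_RCLike_I_le_one
        _ = _ := by simp
  · have hφ : MemLp φ.1 2 (phaseMeasure L) := IsTestFunction.memLp φ.2
    have i1 : Integrable (fun z => ((φ.1 z * g₁ z : ℝ) : 𝕜)) (phaseMeasure L) :=
      (hφ.integrable_mul h1).ofReal
    have i2 : Integrable (fun z => ((φ.1 z * g₂ z : ℝ) : 𝕜) * RCLike.I) (phaseMeasure L) :=
      (hφ.integrable_mul h2).ofReal.mul_const _
    calc Λ φ = (RCLike.re (Λ φ) : 𝕜) + RCLike.im (Λ φ) * RCLike.I := (RCLike.re_add_im _).symm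
      _ = ((∫ z, φ.1 z * g₁ z ∂phaseMeasure L : ℝ) : 𝕜) +
          ((∫ z, φ.1 z * g₂ z ∂phaseMeasure L : ℝ) : 𝕜) * RCLike.I := by
          rw [← h1i φ, ← h2i φ]; rfl
      _ = ∫ z, (((φ.1 z * g₁ z : ℝ) : 𝕜) + ((φ.1 z * g₂ z : ℝ) : 𝕜) * RCLike.I)
            ∂phaseMeasure L := by
          rw [integral_add i1 i2, integral_mul_const, integral_ofReal, integral_ofReal]
      _ = _ := by
          refine integral_congr_ae (ae_of_all _ fun z => ?_)
          simp only [RCLike.ofReal_mul, smul_add, RCLike.real_smul_eq_coe_mul]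
          ring

/-- The functional `φ ↦ ∫ Dφ • u`. -/
def testFunctional (D : testSpace L →ₗ[ℝ] testSpace L) (u : Phase L → 𝕜)
    (hu : LocallyIntegrable u (phaseMeasure L)) : testSpace L →ₗ[ℝ] 𝕜 where
  toFun φ := ∫ z, (D φ).1 z • u z ∂phaseMeasure L
  map_add' φ ψ := by
    rw [map_add]
    simp only [Submodule.coe_add, Pi.add_apply, add_smul]
    exact integral_add (IsTestFunction.integrable_smul (D φ).2 hu)
      (IsTestFunction.integrable_smul (D ψ).2 hu)
  map_smul' r φ := by
    rw [map_smul]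
    simp only [Submodule.coe_smul, Pi.smul_apply, smul_assoc, RingHom.id_apply]
    exact integral_smul r _

/-- The directional derivative as a linear map on test functions. -/
def dirDerivLM (w : V × V) : testSpace L →ₗ[ℝ] testSpace L where
  toFun φ := ⟨dirDeriv w φ.1, IsTestFunction.dirDeriv φ.2 w⟩
  map_add' φ ψ := by
    refine Subtype.ext (funext fun z => ?_)
    have h1 := (IsTestFunction.hasDerivAt φ.2 w z 0).add (IsTestFunction.hasDerivAt ψ.2 w z 0)
    have h2 := IsTestFunction.hasDerivAt (φ + ψ).2 w z 0
    simpa [phaseProj_zero] using h2.unique h1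
  map_smul' r φ := by
    refine Subtype.ext (funext fun z => ?_)
    have h1 := (IsTestFunction.hasDerivAt φ.2 w z 0).const_mul r
    have h2 := IsTestFunction.hasDerivAt (r • φ).2 w z 0
    simpa [phaseProj_zero] using h2.unique h1

/-! ### Weak derivatives and difference quotients -/

/-- The left side is the derivative at `0` of the integral against translates of `φ`. Moving the
translation onto `u` turns the hypothesis into a Lipschitz bound at `0`. -/
theorem norm_integral_dirDeriv_le_of_quotient {φ : Phase L → ℝ} (hφ : IsTestFunction φ)
    (w : V × V) {u : Phase L → 𝕜} (hu : MemLp u 2 (phaseMeasure L)) {A : ℝ}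
    (h : ∀ s : ℝ, ‖∫ z, φ z • (u (z + phaseProj L (s • w)) - u z) ∂phaseMeasure L‖ ≤ A * |s|) :
    ‖∫ z, dirDeriv w φ z • u z ∂phaseMeasure L‖ ≤ A := by
  have hul := locallyIntegrable_of_memLp hu
  have hA : 0 ≤ A := by simpa using (norm_nonneg _).trans (h 1)
  refine (hφ.hasDerivAt_integral w hul).le_of_lip' hA (Filter.Eventually.of_forall fun s => ?_)
  have hm := memLp_comp_add_right hu (-phaseProj L (s • w))
  simp only [← sub_eq_add_neg] at hm
  simp only [zero_smul, phaseProj_zero, add_zero, sub_zero]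
  rw [integral_comp_add_smul,
    ← integral_sub (hφ.integrable_smul (locallyIntegrable_of_memLp hm)) (hφ.integrable_smul hul)]
  simp only [← smul_sub]
  have hs := h (-s)
  rw [abs_neg, neg_smul, phaseProj_neg] at hs
  rw [Real.norm_eq_abs]
  simpa only [← sub_eq_add_neg] using hs

theorem norm_integral_dirDeriv_le {φ : Phase L → ℝ} (hφ : IsTestFunction φ) (w : V × V)
    {u : Phase L → 𝕜} (hu : MemLp u 2 (phaseMeasure L)) {A : ℝ}
    (h : ∀ s : ℝ, l2norm (fun z => u (z + phaseProj L (s • w)) - u z) ≤ A * |s|) :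
    ‖∫ z, dirDeriv w φ z • u z ∂phaseMeasure L‖ ≤ A * l2norm φ := by
  refine norm_integral_dirDeriv_le_of_quotient hφ w hu fun s => ?_
  refine (norm_integral_smul_le hφ.memLp ((memLp_comp_add_right hu _).sub hu)).trans ?_
  exact (mul_le_mul_of_nonneg_left (h s) (l2norm_nonneg φ)).trans_eq (by ring)

/-- The second-order analogue of `norm_integral_dirDeriv_le`. -/
theorem norm_integral_dirDeriv_dirDeriv_le {φ : Phase L → ℝ} (hφ : IsTestFunction φ)
    (w w' : V × V) {u : Phase L → 𝕜} (hu : MemLp u 2 (phaseMeasure L)) {A : ℝ}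
    (h : ∀ s s' : ℝ, l2norm (fun z =>
      (u (z + phaseProj L (s • w) + phaseProj L (s' • w')) - u (z + phaseProj L (s • w))) -
        (u (z + phaseProj L (s' • w')) - u z)) ≤ A * |s| * |s'|) :
    ‖∫ z, dirDeriv w' (dirDeriv w φ) z • u z ∂phaseMeasure L‖ ≤ A * l2norm φ := by
  -- The outer derivative becomes a difference of `u` in the direction `w'`; the first-order bound
  -- then applies to that difference in the direction `w`.
  refine norm_integral_dirDeriv_le_of_quotient (hφ.dirDeriv w) w' hu fun s' => ?_
  refine (norm_integral_dirDeriv_le hφ w ((memLp_comp_add_right hu _).sub hu)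
    (A := A * |s'|) fun s => ?_).trans_eq (by ring)
  exact (h s s').trans_eq (by ring)

theorem hasDerivAt_integral_test {φ : Phase L → ℝ} (hφ : IsTestFunction φ) (w : V × V)
    {u : Phase L → 𝕜} (hu : LocallyIntegrable u (phaseMeasure L)) (s : ℝ) :
    HasDerivAt (fun s : ℝ => ∫ z, φ (z + phaseProj L (s • w)) • u z ∂phaseMeasure L)
      (∫ z, dirDeriv w (fun z => φ (z + phaseProj L (s • w))) z • u z ∂phaseMeasure L) s := by
  have h := (hφ.comp_add_right (phaseProj L (s • w))).hasDerivAt_integral w hu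
  have h2 : HasDerivAt (fun r : ℝ => r - s) 1 s := (hasDerivAt_id s).sub_const s
  have h3 := HasDerivAt.scomp_of_eq s h h2 (by simp)
  rw [one_smul] at h3
  refine h3.congr_of_eventuallyEq (Filter.Eventually.of_forall fun r => ?_)
  simp only [Function.comp]
  refine integral_congr_ae (ae_of_all _ fun z => ?_)
  simp only
  rw [add_assoc, ← phaseProj_add, ← add_smul, sub_add_cancel]

/-- If `g` is the weak derivative of `f` in the direction `w`, then `f` is Lipschitz under
translations in this direction. -/
theorem l2norm_translate_sub_le (w : V × V) {f g : Phase L → 𝕜} (hf : MemLp f 2 (phaseMeasure L))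
    (hg : MemLp g 2 (phaseMeasure L))
    (hfg : ∀ φ : Phase L → ℝ, IsTestFunction φ →
      ∫ z, dirDeriv w φ z • f z ∂phaseMeasure L = -∫ z, φ z • g z ∂phaseMeasure L) (h : ℝ) :
    l2norm (fun z => f (z + phaseProj L (h • w)) - f z) ≤ 2 * (|h| * l2norm g) := by
  have hfl := locallyIntegrable_of_memLp hf
  set u : Phase L → 𝕜 := fun z => f (z + phaseProj L (h • w)) - f z with hu
  have hum : MemLp u 2 (phaseMeasure L) := (memLp_comp_add_right hf _).sub hf
  -- Paired with `φ`, the difference of `f` is an increment of the integral of `f` against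
  -- translates of `φ`; the mean value inequality bounds it by the weak derivative.
  have hbound : ∀ φ : testSpace L,
      ‖testFunctional LinearMap.id u (locallyIntegrable_of_memLp hum) φ‖ ≤
        |h| * l2norm g * l2norm φ.1 := by
    intro φ
    have hφ : IsTestFunction φ.1 := φ.2
    have e : testFunctional LinearMap.id u (locallyIntegrable_of_memLp hum) φ =
        (∫ z, φ.1 (z + phaseProj L ((-h) • w)) • f z ∂phaseMeasure L) -
          ∫ z, φ.1 (z + phaseProj L ((0 : ℝ) • w)) • f z ∂phaseMeasure L := by
      change ∫ z, φ.1 z • u z ∂phaseMeasure L = _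
      rw [integral_comp_add_smul, neg_smul, phaseProj_neg]
      simp only [sub_neg_eq_add, zero_smul, phaseProj_zero, add_zero, hu, smul_sub]
      exact integral_sub (hφ.integrable_smul (locallyIntegrable_of_memLp
        (memLp_comp_add_right hf _))) (hφ.integrable_smul hfl)
    rw [e]
    have := convex_univ.norm_image_sub_le_of_norm_hasDerivWithin_le (C := l2norm φ.1 * l2norm g)
      (fun s _ => (hasDerivAt_integral_test hφ w hfl s).hasDerivWithinAt)
      (fun s _ => ?_) (mem_univ (0 : ℝ)) (mem_univ (-h))
    · refine this.trans (le_of_eq ?_)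
      rw [sub_zero, norm_neg, Real.norm_eq_abs]
      ring
    · rw [hfg _ (hφ.comp_add_right _), norm_neg]
      refine (norm_integral_smul_le (hφ.comp_add_right _).memLp hg).trans (le_of_eq ?_)
      rw [l2norm, eLpNorm_comp_add_right hφ.memLp.1]
      rfl
  -- The representative coincides with `u` because test functions separate, and it carries the norm
  -- bound with its factor `2`.
  obtain ⟨g', hg', hn, hi⟩ := exists_representative _
    (mul_nonneg (abs_nonneg _) (l2norm_nonneg _)) hbound
  have hug : u =ᵐ[phaseMeasure L] g' := ae_eq_of_forall_test (locallyIntegrable_of_memLp hum)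
    (locallyIntegrable_of_memLp hg') fun φ hφ => hi ⟨φ, hφ⟩
  rw [l2norm, eLpNorm_congr_ae hug]
  refine ENNReal.toReal_le_of_le_ofReal ?_ hn
  have := l2norm_nonneg g
  positivity

end

/-! ### Transport and velocity integral operators on `L²` -/

section


variable {𝕜 : Type*} [RCLike 𝕜] {L : ℝ}

/-- The backward free flow on phase space. -/
def flow (τ : ℝ) (z : Phase L) : Phase L := (z.1 - toTorus L (τ • z.2), z.2)

/-- Transport along the free flow, followed by multiplication by a function of the velocity. -/
def mulFlow (m : V → ℝ) (τ : ℝ) (f : Phase L → 𝕜) : Phase L → 𝕜 :=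
  fun z => m z.2 • f (flow τ z)

theorem S_eq_mulFlow (a b τ : ℝ) (f : Phase L → 𝕜) :
    S a b τ f = mulFlow (fun ξ => Real.exp (-nu a b ξ * τ)) τ f := rfl

/-- The integral operator in the velocity variable with kernel `k`. -/
def kerFun (k : V → V → ℝ) (f : Phase L → 𝕜) : Phase L → 𝕜 :=
  fun z => ∫ η : V, k z.2 η • f (z.1, η)

theorem stronglyMeasurable_kerFun {k : V → V → ℝ}
    (hk : Measurable fun p : V × V => k p.1 p.2) {f : Phase L → 𝕜}
    (hf : StronglyMeasurable f) : StronglyMeasurable (kerFun k f) := by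
  refine StronglyMeasurable.integral_prod_right'
    (f := fun p : Phase L × V => k p.1.2 p.2 • f (p.1.1, p.2)) ?_
  exact (hk.comp (f := fun p : Phase L × V => (p.1.2, p.2)) (by fun_prop)).stronglyMeasurable.smul
    (hf.comp_measurable (g := fun p : Phase L × V => (p.1.1, p.2)) (by fun_prop))

variable [Fact (0 < L)]

/-! ### Operators on functions that descend to `L²` -/

theorem l2norm_add_le {f g : Phase L → 𝕜} (hf : MemLp f 2 (phaseMeasure L))
    (hg : MemLp g 2 (phaseMeasure L)) : l2norm (f + g) ≤ l2norm f + l2norm g := by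
  rw [l2norm, l2norm, l2norm, ← ENNReal.toReal_add hf.2.ne hg.2.ne]
  exact ENNReal.toReal_mono (ENNReal.add_ne_top.mpr ⟨hf.2.ne, hg.2.ne⟩)
    (eLpNorm_add_le hf.1 hg.1 (by norm_num))

theorem l2norm_congr_ae {f g : Phase L → 𝕜} (h : f =ᵐ[phaseMeasure L] g) :
    l2norm f = l2norm g := by
  rw [l2norm, l2norm, eLpNorm_congr_ae h]

/-- `T` induces a linear operator on `L²` of norm at most `C`. -/
structure IsL2Op (T : (Phase L → 𝕜) → (Phase L → 𝕜)) (C : ℝ) : Prop where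
  nonneg : 0 ≤ C
  memLp : ∀ {f}, MemLp f 2 (phaseMeasure L) → MemLp (T f) 2 (phaseMeasure L)
  norm_le : ∀ {f}, MemLp f 2 (phaseMeasure L) → l2norm (T f) ≤ C * l2norm f
  congr : ∀ {f g}, f =ᵐ[phaseMeasure L] g → T f =ᵐ[phaseMeasure L] T g
  add : ∀ {f g}, MemLp f 2 (phaseMeasure L) → MemLp g 2 (phaseMeasure L) →
    T (f + g) =ᵐ[phaseMeasure L] T f + T g
  smul : ∀ (r : 𝕜) {f}, MemLp f 2 (phaseMeasure L) → T (r • f) =ᵐ[phaseMeasure L] r • T f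

theorem norm_toLp_eq {f : Phase L → 𝕜} (hf : MemLp f 2 (phaseMeasure L)) :
    ‖hf.toLp f‖ = l2norm f := Lp.norm_toLp f hf

theorem exists_eq_toLp (G : Lp 𝕜 2 (phaseMeasure L)) :
    ∃ (g : Phase L → 𝕜) (hg : MemLp g 2 (phaseMeasure L)), StronglyMeasurable g ∧ G = hg.toLp g :=
  ⟨G, Lp.memLp G, Lp.stronglyMeasurable G, (Lp.toLp_coeFn G _).symm⟩

variable {T : (Phase L → 𝕜) → (Phase L → 𝕜)} {C : ℝ}

/-- The bounded operator induced on `L²`. -/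
def IsL2Op.toOp (h : IsL2Op T C) : Lp 𝕜 2 (phaseMeasure L) →L[𝕜] Lp 𝕜 2 (phaseMeasure L) :=
  LinearMap.mkContinuous
    { toFun := fun F => (h.memLp (Lp.memLp F)).toLp (T F)
      map_add' := fun F G => by
        rw [← MemLp.toLp_add, MemLp.toLp_eq_toLp_iff]
        exact (h.congr (Lp.coeFn_add F G)).trans (h.add (Lp.memLp F) (Lp.memLp G))
      map_smul' := fun r F => by
        rw [RingHom.id_apply, ← MemLp.toLp_const_smul, MemLp.toLp_eq_toLp_iff]
        exact (h.congr (Lp.coeFn_smul r F)).trans (h.smul r (Lp.memLp F)) } C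
    fun F => by
      have h1 := h.norm_le (Lp.memLp F)
      rw [← norm_toLp_eq (h.memLp (Lp.memLp F)), ← norm_toLp_eq (Lp.memLp F), Lp.toLp_coeFn] at h1
      exact h1

theorem IsL2Op.toOp_toLp (h : IsL2Op T C) {f : Phase L → 𝕜} (hf : MemLp f 2 (phaseMeasure L)) :
    h.toOp (hf.toLp f) = (h.memLp hf).toLp (T f) :=
  (MemLp.toLp_eq_toLp_iff (h.memLp (Lp.memLp _)) (h.memLp hf)).mpr (h.congr hf.coeFn_toLp)

theorem IsL2Op.norm_toOp_apply_le (h : IsL2Op T C) (F : Lp 𝕜 2 (phaseMeasure L)) :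
    ‖h.toOp F‖ ≤ C * ‖F‖ :=
  h.toOp.le_of_opNorm_le (LinearMap.mkContinuous_norm_le _ h.nonneg _) F

/-! ### Translations -/

/-- Translation of functions on phase space. -/
def trans (q : Phase L) (f : Phase L → 𝕜) : Phase L → 𝕜 := fun z => f (z + q)

theorem isL2Op_trans (q : Phase L) : IsL2Op (trans (𝕜 := 𝕜) q) 1 where
  nonneg := zero_le_one
  memLp hf := memLp_comp_add_right hf q
  norm_le hf := by
    rw [one_mul]
    exact (congrArg ENNReal.toReal (eLpNorm_comp_add_right hf.1 q)).le
  congr h := (measurePreserving_add_phase q).quasiMeasurePreserving.ae_eq_comp h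
  add _ _ := Filter.EventuallyEq.rfl
  smul _ _ _ := Filter.EventuallyEq.rfl

/-! ### Transport with a multiplier -/

theorem measurePreserving_flow (τ : ℝ) :
    MeasurePreserving (flow τ) (phaseMeasure L) (phaseMeasure L) := by
  have h1 : MeasurePreserving (fun p : V × Torus L => (p.1, p.2 - toTorus L (τ • p.1)))
      (volume.prod (torusMeasure L)) (volume.prod (torusMeasure L)) := by
    refine (MeasurePreserving.id volume).skew_product
      (g := fun (ξ : V) (x : Torus L) => x - toTorus L (τ • ξ)) ?_ (ae_of_all _ fun ξ => ?_)
    · exact (continuous_snd.sub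
        (continuous_toTorus.comp (continuous_fst.const_smul τ))).measurable
    · exact (measurePreserving_sub_right (torusMeasure L) _).map_eq
  exact Measure.measurePreserving_swap.comp (h1.comp Measure.measurePreserving_swap)

theorem isL2Op_mulFlow {m : V → ℝ} (hm : Measurable m) (hC : 0 ≤ C) (hmC : ∀ ξ, |m ξ| ≤ C)
    (τ : ℝ) : IsL2Op (mulFlow (𝕜 := 𝕜) (L := L) m τ) C := by
  have hfl : ∀ {f : Phase L → 𝕜}, MemLp f 2 (phaseMeasure L) →
      MemLp (fun z => f (flow τ z)) 2 (phaseMeasure L) := fun hf =>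
    hf.comp_measurePreserving (measurePreserving_flow τ)
  have hb : ∀ (f : Phase L → 𝕜) (z : Phase L), ‖mulFlow m τ f z‖ ≤ C * ‖f (flow τ z)‖ := by
    intro f z
    rw [mulFlow, norm_smul]
    gcongr
    exact hmC _
  have hmem : ∀ {f : Phase L → 𝕜}, MemLp f 2 (phaseMeasure L) →
      MemLp (mulFlow m τ f) 2 (phaseMeasure L) := fun {f} hf =>
    (hfl hf).of_le_mul ((hm.comp measurable_snd).aestronglyMeasurable.smul (hfl hf).1)
      (ae_of_all _ (hb f))
  exact {
    nonneg := hC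
    memLp := hmem
    norm_le := fun {f} hf => by
      have h1 := eLpNorm_le_mul_eLpNorm_of_ae_le_mul (p := 2) (μ := phaseMeasure L)
        (ae_of_all _ (hb f))
      have h2 : eLpNorm (fun z => f (flow τ z)) 2 (phaseMeasure L) =
          eLpNorm f 2 (phaseMeasure L) :=
        eLpNorm_comp_measurePreserving hf.1 (measurePreserving_flow τ)
      rw [h2] at h1
      have h3 := ENNReal.toReal_mono (ENNReal.mul_ne_top ENNReal.ofReal_ne_top hf.2.ne) h1
      rwa [ENNReal.toReal_mul, ENNReal.toReal_ofReal hC] at h3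
    congr := fun {f g} h => by
      have := (measurePreserving_flow τ).quasiMeasurePreserving.ae_eq_comp h
      filter_upwards [this] with z hz
      simp only [Function.comp] at hz
      simp only [mulFlow, hz]
    add := fun _ _ => ae_of_all _ fun z => by simp [mulFlow]
    smul := fun r _ _ => ae_of_all _ fun z => by simp [mulFlow] }

/-! ### Integral operators in velocity -/

theorem sq_lintegral_le {α : Type*} [MeasurableSpace α] (μ : Measure α) {F : α → ℝ≥0∞}
    (hF : AEMeasurable F μ) : (∫⁻ x, F x ∂μ) ^ 2 ≤ μ univ * ∫⁻ x, F x ^ 2 ∂μ := by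
  have h := ENNReal.lintegral_mul_le_Lp_mul_Lq μ Real.HolderConjugate.two_two hF
    (aemeasurable_const (b := (1 : ℝ≥0∞)))
  simp only [Pi.mul_apply, mul_one, ENNReal.rpow_two, one_pow, lintegral_one] at h
  calc _ ≤ ((∫⁻ x, F x ^ 2 ∂μ) ^ (1 / 2 : ℝ) * μ univ ^ (1 / 2 : ℝ)) ^ 2 := by gcongr
    _ = _ := by
        rw [mul_pow, ← ENNReal.rpow_natCast, ← ENNReal.rpow_natCast, ← ENNReal.rpow_mul,
          ← ENNReal.rpow_mul]
        norm_num
        rw [mul_comm]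

theorem eLpNorm_two_sq {α : Type*} [MeasurableSpace α] (μ : Measure α) {E : Type*}
    [NormedAddCommGroup E] (f : α → E) : eLpNorm f 2 μ ^ 2 = ∫⁻ x, ‖f x‖ₑ ^ 2 ∂μ := by
  rw [eLpNorm_eq_lintegral_rpow_enorm_toReal (by norm_num) (by norm_num), ← ENNReal.rpow_natCast,
    ← ENNReal.rpow_mul]
  norm_num

variable {k : V → V → ℝ} {A : ℝ≥0∞}

/-- **Schur's test**. -/
theorem lintegral_schur_le (hk : Measurable fun p : V × V => k p.1 p.2)
    (h1 : ∀ ξ, ∫⁻ η, ‖k ξ η‖ₑ ≤ A) (h2 : ∀ η, ∫⁻ ξ, ‖k ξ η‖ₑ ≤ A) {F : Phase L → ℝ≥0∞}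
    (hF : Measurable F) :
    ∫⁻ z, (∫⁻ η, ‖k z.2 η‖ₑ * F (z.1, η)) ^ 2 ∂phaseMeasure L ≤
      A ^ 2 * ∫⁻ z, F z ^ 2 ∂phaseMeasure L := by
  have hkξ : ∀ ξ, Measurable fun η => ‖k ξ η‖ₑ := fun ξ =>
    (hk.comp (f := fun η : V => (ξ, η)) (by fun_prop)).enorm
  have hkη : ∀ η, Measurable fun ξ => ‖k ξ η‖ₑ := fun η =>
    (hk.comp (f := fun ξ : V => (ξ, η)) (by fun_prop)).enorm
  have hFx : ∀ x, Measurable fun η => F (x, η) := fun x => hF.comp (by fun_prop)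
  have hm3 : Measurable fun p : (Torus L × V) × V => ‖k p.1.2 p.2‖ₑ * F (p.1.1, p.2) ^ 2 :=
    ((hk.comp (f := fun p : (Torus L × V) × V => (p.1.2, p.2)) (by fun_prop)).enorm).mul
      ((hF.comp (f := fun p : (Torus L × V) × V => (p.1.1, p.2)) (by fun_prop)).pow_const 2)
  have hcs : ∀ z : Phase L, (∫⁻ η, ‖k z.2 η‖ₑ * F (z.1, η)) ^ 2 ≤
      A * ∫⁻ η, ‖k z.2 η‖ₑ * F (z.1, η) ^ 2 := by
    intro z
    -- Cauchy-Schwarz for the measure `|k(ξ, η)| dη`, whose mass is at most `A`.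
    have h := sq_lintegral_le (volume.withDensity fun η => ‖k z.2 η‖ₑ) (hFx z.1).aemeasurable
    rw [lintegral_withDensity_eq_lintegral_mul _ (hkξ _) (hFx _),
      lintegral_withDensity_eq_lintegral_mul _ (hkξ _) ((hFx _).pow_const 2),
      withDensity_apply _ MeasurableSet.univ, Measure.restrict_univ] at h
    exact h.trans (mul_le_mul_left (h1 _) _)
  calc _ ≤ ∫⁻ z, (A * ∫⁻ η, ‖k z.2 η‖ₑ * F (z.1, η) ^ 2) ∂phaseMeasure L := lintegral_mono hcs
    _ = A * ∫⁻ x, (∫⁻ ξ, ∫⁻ η, ‖k ξ η‖ₑ * F (x, η) ^ 2) ∂torusMeasure L := by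
        rw [lintegral_const_mul _ hm3.lintegral_prod_right', phaseMeasure,
          lintegral_prod _ hm3.lintegral_prod_right'.aemeasurable]
    _ ≤ A * ∫⁻ x, (A * ∫⁻ η, F (x, η) ^ 2) ∂torusMeasure L := by
        gcongr with x
        have hm4 : Measurable fun p : V × V => ‖k p.1 p.2‖ₑ * F (x, p.2) ^ 2 :=
          hm3.comp (f := fun p : V × V => ((x, p.1), p.2)) (by fun_prop)
        rw [lintegral_lintegral_swap hm4.aemeasurable]
        rw [← lintegral_const_mul _ ((hFx x).pow_const 2)]
        refine lintegral_mono fun η => ?_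
        rw [lintegral_mul_const _ (hkη η)]
        gcongr
        exact h2 η
    _ = _ := by
        rw [lintegral_const_mul _ ((hF.pow_const 2).lintegral_prod_right'), ← mul_assoc, ← sq,
          phaseMeasure, lintegral_prod _ (hF.pow_const 2).aemeasurable]

/-- Velocity integrals see whole slices, so almost everywhere equality on phase space has to be
passed to almost every slice. -/
theorem ae_slices_eq {E : Type*} {f g : Phase L → E} (h : f =ᵐ[phaseMeasure L] g) :
    ∀ᵐ z ∂phaseMeasure L, ∀ᵐ η : V, f (z.1, η) = g (z.1, η) :=
  Measure.quasiMeasurePreserving_fst.ae (Measure.ae_ae_of_ae_prod h)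

theorem kerFun_congr {f g : Phase L → 𝕜} (h : f =ᵐ[phaseMeasure L] g) :
    kerFun k f =ᵐ[phaseMeasure L] kerFun k g := by
  filter_upwards [ae_slices_eq h] with z hz
  exact integral_congr_ae (hz.mono fun η hη => by simp only [hη])

/-- Finiteness of the Schur bound makes the integrals absolutely convergent for almost every point.
Without this the Bochner integral could take its default value `0` and additivity would fail. -/
theorem ae_integrable_kernel (hk : Measurable fun p : V × V => k p.1 p.2) (hA : A ≠ ⊤)
    (h1 : ∀ ξ, ∫⁻ η, ‖k ξ η‖ₑ ≤ A) (h2 : ∀ η, ∫⁻ ξ, ‖k ξ η‖ₑ ≤ A) {f : Phase L → 𝕜}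
    (hf : MemLp f 2 (phaseMeasure L)) :
    ∀ᵐ z ∂phaseMeasure L, Integrable fun η => k z.2 η • f (z.1, η) := by
  have hfm : StronglyMeasurable (hf.1.mk f) := hf.1.stronglyMeasurable_mk
  have hs := lintegral_schur_le hk h1 h2 (F := fun z => ‖hf.1.mk f z‖ₑ) hfm.enorm
  rw [← eLpNorm_two_sq, ← eLpNorm_congr_ae hf.1.ae_eq_mk] at hs
  have hm3 : Measurable fun p : (Torus L × V) × V => ‖k p.1.2 p.2‖ₑ * ‖hf.1.mk f (p.1.1, p.2)‖ₑ :=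
    ((hk.comp (f := fun p : (Torus L × V) × V => (p.1.2, p.2)) (by fun_prop)).enorm).mul
      (hfm.enorm.comp (f := fun p : (Torus L × V) × V => (p.1.1, p.2)) (by fun_prop))
  have hfin := ae_lt_top (hm3.lintegral_prod_right'.pow_const 2)
    (hs.trans_lt (ENNReal.mul_lt_top (by finiteness) (by have := hf.2; finiteness))).ne
  filter_upwards [hfin, ae_slices_eq hf.1.ae_eq_mk] with z hz hz2
  have hi : Integrable fun η => k z.2 η • hf.1.mk f (z.1, η) := by
    refine ⟨((hk.comp (f := fun η : V => (z.2, η)) (by fun_prop)).stronglyMeasurable.smul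
      (hfm.comp_measurable (g := fun η : V => (z.1, η)) (by fun_prop))).aestronglyMeasurable, ?_⟩
    rw [HasFiniteIntegral]
    simp only [enorm_smul]
    exact (ENNReal.pow_lt_top_iff.mp hz).resolve_right (by norm_num)
  exact hi.congr (hz2.mono fun η hη => by simp only [hη])

theorem isL2Op_kerFun (hk : Measurable fun p : V × V => k p.1 p.2) (hC : 0 ≤ C)
    (h1 : ∀ ξ, ∫⁻ η, ‖k ξ η‖ₑ ≤ ENNReal.ofReal C) (h2 : ∀ η, ∫⁻ ξ, ‖k ξ η‖ₑ ≤ ENNReal.ofReal C) :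
    IsL2Op (kerFun (𝕜 := 𝕜) (L := L) k) C := by
  have hbound : ∀ {f : Phase L → 𝕜}, MemLp f 2 (phaseMeasure L) →
      eLpNorm (kerFun k f) 2 (phaseMeasure L) ≤
        ENNReal.ofReal C * eLpNorm f 2 (phaseMeasure L) := by
    intro f hf
    have hfm : StronglyMeasurable (hf.1.mk f) := hf.1.stronglyMeasurable_mk
    have hs := lintegral_schur_le hk h1 h2 (F := fun z => ‖hf.1.mk f z‖ₑ) hfm.enorm
    rw [← eLpNorm_two_sq, ← mul_pow] at hs
    rw [← eLpNorm_congr_ae hf.1.ae_eq_mk] at hs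
    rw [eLpNorm_congr_ae (kerFun_congr hf.1.ae_eq_mk)]
    refine (ENNReal.pow_le_pow_left_iff two_ne_zero).mp (le_trans ?_ hs)
    rw [eLpNorm_two_sq]
    refine lintegral_mono fun z => ?_
    gcongr
    refine (enorm_integral_le_lintegral_enorm _).trans (le_of_eq ?_)
    simp only [enorm_smul]
  have hmeas : ∀ {f : Phase L → 𝕜}, MemLp f 2 (phaseMeasure L) →
      AEStronglyMeasurable (kerFun k f) (phaseMeasure L) := fun hf =>
    (stronglyMeasurable_kerFun hk hf.1.stronglyMeasurable_mk).aestronglyMeasurable.congr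
      (kerFun_congr hf.1.ae_eq_mk).symm
  exact {
    nonneg := hC
    memLp := fun hf => ⟨hmeas hf, (hbound hf).trans_lt
      (ENNReal.mul_lt_top ENNReal.ofReal_lt_top hf.2)⟩
    norm_le := fun hf => by
      have h3 := ENNReal.toReal_mono (ENNReal.mul_ne_top ENNReal.ofReal_ne_top hf.2.ne) (hbound hf)
      rwa [ENNReal.toReal_mul, ENNReal.toReal_ofReal hC] at h3
    congr := kerFun_congr
    add := fun hf hg => by
      filter_upwards [ae_integrable_kernel hk ENNReal.ofReal_ne_top h1 h2 hf,
        ae_integrable_kernel hk ENNReal.ofReal_ne_top h1 h2 hg] with z hz1 hz2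
      simp only [kerFun, Pi.add_apply, smul_add]
      exact integral_add hz1 hz2
    smul := fun r f _ => ae_of_all _ fun z => by
      simp only [kerFun, Pi.smul_apply]
      rw [← integral_smul]
      refine integral_congr_ae (ae_of_all _ fun η => ?_)
      exact smul_comm _ _ _ }

end

/-! ### The collision and transport operators under translations -/

section


/-- Quantitative properties of the collision frequency and the collision kernel. -/
structure KineticBounds (a b c d ν₀ M : ℝ) : Prop where
  pos : 0 < ν₀
  nonneg : 0 ≤ M
  le_nu : ∀ ξ, ν₀ ≤ nu a b ξ
  nu_sub : ∀ ξ η, |nu a b ξ - nu a b η| ≤ M * ‖ξ - η‖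
  W_le : ∀ ξ, ∫⁻ η, ‖W c d ξ η‖ₑ ≤ ENNReal.ofReal M
  W_sub_left : ∀ e : V, ‖e‖ = 1 → ∀ (h : ℝ) (ξ : V),
    ∫⁻ η, ‖W c d (ξ + h • e) η - W c d ξ η‖ₑ ≤ ENNReal.ofReal (M * |h|)
  W_sub_right : ∀ e : V, ‖e‖ = 1 → ∀ (h : ℝ) (η : V),
    ∫⁻ ξ, ‖W c d (ξ + h • e) η - W c d ξ η‖ₑ ≤ ENNReal.ofReal (M * |h|)

theorem exists_kineticBounds {a b c d ν₀ : ℝ} (hc : 0 ≤ c) (hd : 0 ≤ d) (hν₀ : 0 < ν₀)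
    (hν : ∀ ξ, ν₀ ≤ nu a b ξ) : ∃ M, KineticBounds a b c d ν₀ M := by
  obtain ⟨C₁, hC₁, h1⟩ := exists_abs_nu_sub_le a b
  obtain ⟨C₂, hC₂, h2⟩ := exists_lintegral_W_le hc hd
  obtain ⟨C₃, hC₃, h3⟩ := exists_lintegral_W_sub_le hc hd
  have e2 : C₂ = ENNReal.ofReal C₂.toReal := (ENNReal.ofReal_toReal hC₂.ne).symm
  have e3 : C₃ = ENNReal.ofReal C₃.toReal := (ENNReal.ofReal_toReal hC₃.ne).symm
  have n2 : 0 ≤ C₂.toReal := ENNReal.toReal_nonneg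
  have n3 : 0 ≤ C₃.toReal := ENNReal.toReal_nonneg
  have key : ∀ h : ℝ, C₃ * ENNReal.ofReal |h| ≤
      ENNReal.ofReal ((C₁ + C₂.toReal + C₃.toReal) * |h|) := by
    intro h
    rw [e3, ← ENNReal.ofReal_mul n3, ENNReal.toReal_ofReal n3]
    refine ENNReal.ofReal_le_ofReal ?_
    gcongr
    linarith
  refine ⟨C₁ + C₂.toReal + C₃.toReal, hν₀, by positivity, hν, fun ξ η => ?_, fun ξ => ?_,
    fun e he h ξ => ((h3 e he h).1 ξ).trans (key h),
    fun e he h η => ((h3 e he h).2 η).trans (key h)⟩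
  · refine (h1 ξ η).trans ?_
    gcongr
    linarith
  · refine (h2 ξ).trans ?_
    conv_lhs => rw [e2]
    exact ENNReal.ofReal_le_ofReal (by linarith)

section translations

variable {L : ℝ}

theorem phaseProj_smul_left (h : ℝ) (e : V) :
    phaseProj L (h • ((e, 0) : V × V)) = (toTorus L (h • e), 0) := by
  simp [phaseProj]

theorem phaseProj_smul_right (h : ℝ) (e : V) :
    phaseProj L (h • ((0, e) : V × V)) = (0, h • e) := by
  simp [phaseProj, toTorus_zero]

end translations

variable {𝕜 : Type*} [RCLike 𝕜] {L : ℝ} [Fact (0 < L)] {a b c d ν₀ M : ℝ}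

/-- Translation on `L²`. -/
def tr (q : Phase L) : Lp 𝕜 2 (phaseMeasure L) →L[𝕜] Lp 𝕜 2 (phaseMeasure L) :=
  (isL2Op_trans q).toOp

theorem tr_toLp (q : Phase L) {f : Phase L → 𝕜} (hf : MemLp f 2 (phaseMeasure L)) :
    tr q (hf.toLp f) = (memLp_comp_add_right hf q).toLp (fun z => f (z + q)) :=
  (isL2Op_trans q).toOp_toLp hf

namespace KineticBounds

theorem isL2Op_K (hB : KineticBounds a b c d ν₀ M) : IsL2Op (K (𝕜 := 𝕜) (L := L) c d) M :=
  isL2Op_kerFun (measurable_W c d) hB.nonneg hB.W_le fun η => by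
    simpa only [W_comm c d _ η] using hB.W_le η

theorem isL2Op_S (hB : KineticBounds a b c d ν₀ M) {τ : ℝ} (hτ : 0 ≤ τ) :
    IsL2Op (S (𝕜 := 𝕜) (L := L) a b τ) (Real.exp (-(ν₀ * τ))) :=
  isL2Op_mulFlow (m := fun ξ => Real.exp (-nu a b ξ * τ))
    (((measurable_nu a b).neg.mul_const τ).exp) (Real.exp_pos _).le (fun ξ => by
      rw [Real.abs_exp, neg_mul]
      exact Real.exp_le_exp.mpr (neg_le_neg (mul_le_mul_of_nonneg_right (hB.le_nu ξ) hτ))) τ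

/-- The operator `K` on `L²`. -/
def Kop (hB : KineticBounds a b c d ν₀ M) : Lp 𝕜 2 (phaseMeasure L) →L[𝕜] Lp 𝕜 2
    (phaseMeasure L) := hB.isL2Op_K.toOp

/-- The damped transport semigroup on `L²`. -/
def Sop (hB : KineticBounds a b c d ν₀ M) {τ : ℝ} (hτ : 0 ≤ τ) : Lp 𝕜 2
    (phaseMeasure L) →L[𝕜] Lp 𝕜 2 (phaseMeasure L) :=
  (hB.isL2Op_S hτ).toOp

theorem norm_Kop_le (hB : KineticBounds a b c d ν₀ M)
    (F : Lp 𝕜 2 (phaseMeasure L)) : ‖hB.Kop F‖ ≤ M * ‖F‖ :=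
  hB.isL2Op_K.norm_toOp_apply_le F

theorem norm_Sop_le (hB : KineticBounds a b c d ν₀ M) {τ : ℝ} (hτ : 0 ≤ τ)
    (F : Lp 𝕜 2 (phaseMeasure L)) :
    ‖hB.Sop hτ F‖ ≤ Real.exp (-(ν₀ * τ)) * ‖F‖ :=
  (hB.isL2Op_S hτ).norm_toOp_apply_le F

theorem Kop_toLp (hB : KineticBounds a b c d ν₀ M) {f : Phase L → 𝕜}
    (hf : MemLp f 2 (phaseMeasure L)) :
    hB.Kop (hf.toLp f) = (hB.isL2Op_K.memLp hf).toLp (K c d f) :=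
  hB.isL2Op_K.toOp_toLp hf

theorem Sop_toLp (hB : KineticBounds a b c d ν₀ M) {τ : ℝ} (hτ : 0 ≤ τ) {f : Phase L → 𝕜}
    (hf : MemLp f 2 (phaseMeasure L)) :
    hB.Sop hτ (hf.toLp f) = ((hB.isL2Op_S hτ).memLp hf).toLp (S a b τ f) :=
  (hB.isL2Op_S hτ).toOp_toLp hf

theorem tr_Kop (hB : KineticBounds a b c d ν₀ M) (x : Torus L) (F : Lp 𝕜 2 (phaseMeasure L)) :
    tr (x, 0) (hB.Kop F) = hB.Kop (tr (x, 0) F) := by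
  obtain ⟨f, hf, -, rfl⟩ := exists_eq_toLp F
  simp only [Kop_toLp, tr_toLp]
  congr 1
  funext z
  simp [K]

theorem tr_Sop (hB : KineticBounds a b c d ν₀ M) (x : Torus L) {τ : ℝ} (hτ : 0 ≤ τ)
    (F : Lp 𝕜 2 (phaseMeasure L)) :
    tr (x, 0) (hB.Sop hτ F) = hB.Sop hτ (tr (x, 0) F) := by
  obtain ⟨f, hf, -, rfl⟩ := exists_eq_toLp F
  simp only [Sop_toLp, tr_toLp]
  congr 1
  funext z
  simp [S, sub_add_eq_add_sub]

theorem ae_integrable_W (hB : KineticBounds a b c d ν₀ M) {f : Phase L → 𝕜}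
    (hf : MemLp f 2 (phaseMeasure L)) :
    ∀ᵐ z ∂phaseMeasure L, Integrable fun η => W c d z.2 η • f (z.1, η) :=
  ae_integrable_kernel (measurable_W c d) ENNReal.ofReal_ne_top hB.W_le
    (fun η => by simpa only [W_comm c d _ η] using hB.W_le η) hf

/-- `K` gains one velocity derivative. -/
theorem norm_tr_Kop_sub_le (hB : KineticBounds a b c d ν₀ M) {e : V} (he : ‖e‖ = 1) (h : ℝ)
    (F : Lp 𝕜 2 (phaseMeasure L)) :
    ‖tr (0, h • e) (hB.Kop F) - hB.Kop F‖ ≤ M * |h| * ‖F‖ := by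
  obtain ⟨f, hf, -, rfl⟩ := exists_eq_toLp F
  have hk : Measurable fun p : V × V => W c d (p.1 + h • e) p.2 - W c d p.1 p.2 :=
    ((measurable_W c d).comp (f := fun p : V × V => (p.1 + h • e, p.2)) (by fun_prop)).sub
      (measurable_W c d)
  -- The difference of `K f` is the integral operator whose kernel is the difference of `W`, so
  -- Schur's test gives the factor `|h|`.
  have hop := isL2Op_kerFun (𝕜 := 𝕜) (L := L) (k := fun ξ η => W c d (ξ + h • e) η - W c d ξ η) hk
    (mul_nonneg hB.nonneg (abs_nonneg h)) (hB.W_sub_left e he h) (hB.W_sub_right e he h)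
  rw [norm_toLp_eq]
  refine le_of_eq_of_le ?_ (hop.norm_le hf)
  rw [Kop_toLp, tr_toLp, ← MemLp.toLp_sub, norm_toLp_eq]
  refine l2norm_congr_ae ?_
  have h2 := (measurePreserving_add_phase ((0, h • e) : Phase L)).quasiMeasurePreserving.ae
    (hB.ae_integrable_W hf)
  filter_upwards [hB.ae_integrable_W hf, h2] with z hz1 hz2
  simp only [Prod.snd_add, Prod.fst_add, add_zero] at hz2
  simp only [Pi.sub_apply, K, kerFun, Prod.snd_add, Prod.fst_add, add_zero, sub_smul]
  rw [integral_sub hz2 hz1]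

/-- `K` absorbs one velocity derivative. -/
theorem norm_Kop_tr_sub_le (hB : KineticBounds a b c d ν₀ M) {e : V} (he : ‖e‖ = 1) (h : ℝ)
    (F : Lp 𝕜 2 (phaseMeasure L)) :
    ‖hB.Kop (tr (0, h • e) F) - hB.Kop F‖ ≤ M * |h| * ‖F‖ := by
  obtain ⟨f, hf, -, rfl⟩ := exists_eq_toLp F
  have hk : Measurable fun p : V × V => W c d p.1 (p.2 - h • e) - W c d p.1 p.2 :=
    ((measurable_W c d).comp (f := fun p : V × V => (p.1, p.2 - h • e)) (by fun_prop)).sub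
      (measurable_W c d)
  -- After a change of variables the shift sits on the second argument of `W`. Symmetry moves it to
  -- the first, with `-h` and the two Schur integrals exchanged.
  have hsym : ∀ ξ η : V, W c d ξ (η - h • e) - W c d ξ η =
      W c d (η + (-h) • e) ξ - W c d η ξ := by
    intro ξ η
    rw [W_comm c d ξ, W_comm c d ξ, neg_smul, ← sub_eq_add_neg]
  have hop := isL2Op_kerFun (𝕜 := 𝕜) (L := L) (k := fun ξ η => W c d ξ (η - h • e) - W c d ξ η) hk
    (mul_nonneg hB.nonneg (abs_nonneg h))
    (fun ξ => by
      simp only [hsym]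
      simpa using hB.W_sub_right e he (-h) ξ)
    (fun η => by
      simp only [hsym]
      simpa using hB.W_sub_left e he (-h) η)
  rw [norm_toLp_eq]
  refine le_of_eq_of_le ?_ (hop.norm_le hf)
  rw [tr_toLp, Kop_toLp, Kop_toLp, ← MemLp.toLp_sub, norm_toLp_eq]
  refine l2norm_congr_ae ?_
  filter_upwards [hB.ae_integrable_W hf,
    hB.ae_integrable_W (memLp_comp_add_right hf ((0, h • e) : Phase L))] with z hz1 hz2
  have hz3 := hz2.comp_sub_right (h • e)
  simp only [Prod.mk_add_mk, add_zero, sub_add_cancel] at hz3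
  simp only [Pi.sub_apply, K, kerFun, Prod.mk_add_mk, add_zero, sub_smul]
  rw [integral_sub hz3 hz1]
  congr 1
  rw [← integral_add_right_eq_self (fun η => W c d z.2 (η - h • e) • f (z.1, η)) (h • e)]
  simp

/-- Averaging of a transported function: an `x`-difference of `K S^τ G` of size `δ = τ h` is
controlled by a velocity difference of `G` of size `h`. -/
theorem norm_tr_Kop_Sop_sub_le (hB : KineticBounds a b c d ν₀ M) {e : V} (he : ‖e‖ = 1) {τ : ℝ}
    (hτ : 0 ≤ τ) (h : ℝ)
    (G : Lp 𝕜 2 (phaseMeasure L)) :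
    ‖tr (toTorus L ((τ * h) • e), 0) (hB.Kop (hB.Sop hτ G)) - hB.Kop (hB.Sop hτ G)‖ ≤
      Real.exp (-(ν₀ * τ)) * M * (|h| * (1 + M * τ) * ‖G‖ + ‖tr (0, h • e) G - G‖) := by
  obtain ⟨g, hg, -, rfl⟩ := exists_eq_toLp G
  set E := Real.exp (-(ν₀ * τ))
  have hM := hB.nonneg
  have hE : 0 ≤ E := (Real.exp_pos _).le
  set m : V → ℝ := fun ξ => Real.exp (-nu a b ξ * τ) with hm
  have hmm : Measurable m := ((measurable_nu a b).neg.mul_const τ).exp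
  have hmE : ∀ ξ, |m ξ| ≤ E := fun ξ => by
    rw [hm, Real.abs_exp, neg_mul]
    exact Real.exp_le_exp.mpr (neg_le_neg (mul_le_mul_of_nonneg_right (hB.le_nu ξ) hτ))
  set mh : V → ℝ := fun ξ => m (ξ + h • e) with hmh
  have hmhm : Measurable mh := hmm.comp (by fun_prop)
  have hmd : ∀ ξ, |(mh - m) ξ| ≤ M * |h| * τ * E := by
    intro ξ
    -- On `[ν₀ τ, ∞)` the slope of `exp(-x)` is at most `E`, so the change of damping keeps the full
    -- decay and costs only `τ` times the Lipschitz constant of `ν`.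
    have hd : ∀ x ∈ Ici (ν₀ * τ), HasDerivWithinAt (fun x : ℝ => Real.exp (-x))
        (-Real.exp (-x)) (Ici (ν₀ * τ)) x := fun x _ => by
      simpa using ((hasDerivAt_id x).neg.exp).hasDerivWithinAt
    have := (convex_Ici (ν₀ * τ)).norm_image_sub_le_of_norm_hasDerivWithin_le (C := E) hd
      (fun x hx => by
        rw [norm_neg, Real.norm_eq_abs, Real.abs_exp]
        exact Real.exp_le_exp.mpr (neg_le_neg hx))
      (mul_le_mul_of_nonneg_right (hB.le_nu ξ) hτ)
      (mul_le_mul_of_nonneg_right (hB.le_nu (ξ + h • e)) hτ)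
    simp only [hmh, hm, Pi.sub_apply, neg_mul]
    refine this.trans ?_
    rw [← sub_mul, norm_mul, Real.norm_eq_abs, Real.norm_eq_abs, abs_of_nonneg hτ]
    have h1 := hB.nu_sub (ξ + h • e) ξ
    rw [add_sub_cancel_left, norm_smul, he, mul_one, Real.norm_eq_abs] at h1
    nlinarith [mul_le_mul_of_nonneg_left (mul_le_mul_of_nonneg_right h1 hτ) hE]
  have hg1 := memLp_comp_add_right hg ((0, h • e) : Phase L)
  set g1 : Phase L → 𝕜 := fun z => g (z + (0, h • e)) with hg1d
  have op0 := isL2Op_mulFlow (𝕜 := 𝕜) (L := L) hmm hE hmE τ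
  have op1 := isL2Op_mulFlow (𝕜 := 𝕜) (L := L) hmhm hE (fun ξ => hmE _) τ
  have op2 := isL2Op_mulFlow (𝕜 := 𝕜) (L := L) (hmhm.sub hmm)
    (mul_nonneg (mul_nonneg (mul_nonneg hM (abs_nonneg h)) hτ) hE) hmd τ
  -- `Z` is the function `exp(-ν(ξ + h e) τ) g(x - τ ξ, ξ + h e)`: datum and damping are shifted in
  -- velocity, the flow is not.
  set Z : Lp 𝕜 2 (phaseMeasure L) := (op1.memLp hg1).toLp _ with hZ
  have hn1 : l2norm g1 = l2norm g := congrArg ENNReal.toReal (eLpNorm_comp_add_right hg.1 _)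
  have hZn : ‖Z‖ ≤ E * l2norm g := by
    rw [hZ, norm_toLp_eq, ← hn1]
    exact op1.norm_le hg1
  have hYG : ‖tr (0, h • e) (hg.toLp g) - hg.toLp g‖ = l2norm (g1 - g) := by
    rw [tr_toLp, ← MemLp.toLp_sub, norm_toLp_eq]
  have hZS : ‖Z - hB.Sop hτ (hg.toLp g)‖ ≤ M * |h| * τ * E * l2norm g + E * l2norm (g1 - g) := by
    rw [hZ, Sop_toLp, ← MemLp.toLp_sub, norm_toLp_eq]
    have e1 : mulFlow mh τ g1 - S a b τ g = mulFlow (mh - m) τ g1 + mulFlow m τ (g1 - g) := by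
      funext z
      simp only [S_eq_mulFlow, mulFlow, Pi.sub_apply, Pi.add_apply, sub_smul, smul_sub, ← hm]
      abel
    rw [e1]
    refine (l2norm_add_le (op2.memLp hg1) (op0.memLp (hg1.sub hg))).trans ?_
    refine add_le_add ?_ (op0.norm_le (hg1.sub hg))
    rw [← hn1]
    exact op2.norm_le hg1
  -- The central identity: shifting `Z` back by `-h e` restores datum and damping and leaves a
  -- displacement `τ h e` in the flow.
  have hkey : tr (toTorus L ((τ * h) • e), 0) (hB.Sop hτ (hg.toLp g)) = tr (0, (-h) • e) Z := by
    rw [hZ, Sop_toLp, tr_toLp, tr_toLp]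
    congr 1
    funext z
    simp only [S, mulFlow, flow, hg1d, hmh, hm, Prod.fst_add, Prod.snd_add, add_zero,
      Prod.mk_add_mk, neg_smul, neg_add_cancel_right]
    congr 3
    rw [smul_add, smul_neg, ← sub_eq_add_neg, toTorus_sub, smul_smul]
    abel
  rw [tr_Kop, hkey, norm_toLp_eq, hYG]
  calc _ = ‖(hB.Kop (tr (0, (-h) • e) Z) - hB.Kop Z) +
        hB.Kop (Z - hB.Sop hτ (hg.toLp g))‖ := by
        rw [map_sub]
        congr 1
        abel
    _ ≤ M * |-h| * ‖Z‖ + M * ‖Z - hB.Sop hτ (hg.toLp g)‖ :=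
        (norm_add_le _ _).trans (add_le_add (hB.norm_Kop_tr_sub_le he _ _) (hB.norm_Kop_le _))
    _ ≤ M * |h| * (E * l2norm g) +
        M * (M * |h| * τ * E * l2norm g + E * l2norm (g1 - g)) := by
        rw [abs_neg]
        gcongr
    _ = _ := by ring

end KineticBounds

end

section


variable {𝕜 : Type*} [RCLike 𝕜] {L : ℝ} [Fact (0 < L)] {a b c d ν₀ M : ℝ}

/-! ### Estimates at fixed times -/

/-- The spatial difference operator in the direction `e`. -/
def xDiff (δ : ℝ) (e : V) : Lp 𝕜 2 (phaseMeasure L) →L[𝕜] Lp 𝕜 2 (phaseMeasure L) :=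
  tr (toTorus L (δ • e), 0) - ContinuousLinearMap.id 𝕜 _

theorem xDiff_apply (δ : ℝ) (e : V) (F : Lp 𝕜 2 (phaseMeasure L)) :
    xDiff δ e F = tr (toTorus L (δ • e), 0) F - F := rfl

/-- Two nonintegrable time singularities are interpolated into one that is integrable. -/
theorem le_mul_inv_sqrt {y X α β : ℝ} (hX : 0 ≤ X) (hα : 0 < α) (hβ : 0 < β) (h1 : y ≤ X / α)
    (h2 : y ≤ X / β) : y ≤ X * ((√α)⁻¹ * (√β)⁻¹) := by
  have e : ∀ x : ℝ, 0 < x → X / x = X * ((√x)⁻¹ * (√x)⁻¹) := fun x hx => by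
    rw [← mul_inv, Real.mul_self_sqrt hx.le, div_eq_mul_inv]
  rcases le_total α β with h | h
  · refine h2.trans ?_
    rw [e β hβ]
    gcongr
  · refine h1.trans ?_
    rw [e α hα]
    gcongr

namespace KineticBounds

theorem xDiff_Kop (hB : KineticBounds a b c d ν₀ M) (δ : ℝ) (e : V) (F : Lp 𝕜 2 (phaseMeasure L)) :
    xDiff δ e (hB.Kop F) = hB.Kop (xDiff δ e F) := by
  rw [xDiff_apply, xDiff_apply, map_sub, tr_Kop]

theorem xDiff_Sop (hB : KineticBounds a b c d ν₀ M) (δ : ℝ) (e : V) {τ : ℝ} (hτ : 0 ≤ τ)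
    (F : Lp 𝕜 2 (phaseMeasure L)) :
    xDiff δ e (hB.Sop hτ F) = hB.Sop hτ (xDiff δ e F) := by
  rw [xDiff_apply, xDiff_apply, map_sub, tr_Sop]

/-- The averaging estimate with `h = δ / τ`. Constants are enlarged to depend on the total time `t`,
so that they are the same at every position along a path. -/
theorem norm_xDiff_Kop_Sop_le (hB : KineticBounds a b c d ν₀ M) {e : V} (he : ‖e‖ = 1) {τ t : ℝ}
    (hτ : 0 < τ) (hτt : τ ≤ t)
    {G : Lp 𝕜 2 (phaseMeasure L)} {B : ℝ} (hG : ‖G‖ ≤ B)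
    (hGe : ∀ h : ℝ, ‖tr (0, h • e) G - G‖ ≤ B * |h|) (δ : ℝ) :
    ‖xDiff δ e (hB.Kop (hB.Sop hτ.le G))‖ ≤
      Real.exp (-(ν₀ * τ)) * (2 * (1 + M) ^ 2 * (1 + t)) * B * (|δ| / τ) := by
  have hM := hB.nonneg
  have ht : 0 < t := hτ.trans_le hτt
  have hB0 : 0 ≤ B := (norm_nonneg _).trans hG
  have h := hB.norm_tr_Kop_Sop_sub_le he hτ.le (δ / τ) G
  rw [mul_div_cancel₀ _ hτ.ne', abs_div, abs_of_pos hτ] at h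
  have h2 := hGe (δ / τ)
  rw [abs_div, abs_of_pos hτ] at h2
  have hq : 0 ≤ |δ| / τ := by positivity
  have h3 : M * (1 + M * τ) + M ≤ 2 * (1 + M) ^ 2 * (1 + t) := by
    nlinarith [mul_nonneg hM hM, mul_nonneg (mul_nonneg hM hM) ht.le, mul_nonneg hM ht.le,
      mul_le_mul_of_nonneg_left hτt (mul_nonneg hM hM)]
  calc _ ≤ Real.exp (-(ν₀ * τ)) * M * (|δ| / τ * (1 + M * τ) * B + B * (|δ| / τ)) := by
        refine h.trans ?_
        gcongr
    _ = Real.exp (-(ν₀ * τ)) * (M * (1 + M * τ) + M) * B * (|δ| / τ) := by ring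
    _ ≤ _ := by gcongr

/-- No regularity of `F` is needed, because the inner `K` supplies the velocity derivative. -/
theorem norm_xDiff_Kop_Sop_Kop_le (hB : KineticBounds a b c d ν₀ M) {e : V} (he : ‖e‖ = 1)
    {τ t : ℝ} (hτ : 0 < τ) (hτt : τ ≤ t)
    {F : Lp 𝕜 2 (phaseMeasure L)} {B : ℝ} (hF : ‖F‖ ≤ B) (δ : ℝ) :
    ‖xDiff δ e (hB.Kop (hB.Sop hτ.le (hB.Kop F)))‖ ≤
      Real.exp (-(ν₀ * τ)) * (2 * (1 + M) ^ 3 * (1 + t)) * B * (|δ| / τ) := by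
  have hM := hB.nonneg
  have hB0 : 0 ≤ B := (norm_nonneg _).trans hF
  refine (hB.norm_xDiff_Kop_Sop_le he hτ hτt (B := (1 + M) * B) ?_ (fun h => ?_) δ).trans_eq
    (by ring)
  · refine (hB.norm_Kop_le F).trans ?_
    gcongr
    linarith
  · refine (hB.norm_tr_Kop_sub_le he h F).trans ?_
    calc M * |h| * ‖F‖ ≤ (1 + M) * |h| * B := by gcongr; linarith
      _ = _ := by ring

theorem norm_Kop_le' (hB : KineticBounds a b c d ν₀ M) {F : Lp 𝕜 2 (phaseMeasure L)} {B : ℝ}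
    (hF : ‖F‖ ≤ B) :
    ‖hB.Kop F‖ ≤ (1 + M) * B := by
  have hM := hB.nonneg
  refine (hB.norm_Kop_le F).trans ?_
  gcongr
  linarith

theorem norm_Sop_le' (hB : KineticBounds a b c d ν₀ M) {τ : ℝ} (hτ : 0 ≤ τ)
    {F : Lp 𝕜 2 (phaseMeasure L)} {B : ℝ} (hF : ‖F‖ ≤ B) :
    ‖hB.Sop hτ F‖ ≤ Real.exp (-(ν₀ * τ)) * B :=
  (hB.norm_Sop_le hτ F).trans (by gcongr)

/-- One spatial difference of the integrand of the first mixture operator. -/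
theorem norm_xDiff_path_le (hB : KineticBounds a b c d ν₀ M) {e : V} (he : ‖e‖ = 1)
    {τ₀ τ₁ τ₂ t : ℝ} (h0 : 0 ≤ τ₀) (h1 : 0 < τ₁)
    (h2 : 0 < τ₂) (ht : τ₀ + τ₁ + τ₂ = t) {F : Lp 𝕜 2 (phaseMeasure L)} {B : ℝ} (hF : ‖F‖ ≤ B)
    (hFe : ∀ h : ℝ, ‖tr (0, h • e) F - F‖ ≤ B * |h|) (δ : ℝ) :
    ‖xDiff δ e (hB.Sop h0 (hB.Kop (hB.Sop h1.le (hB.Kop (hB.Sop h2.le F)))))‖ ≤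
      Real.exp (-(ν₀ * t)) * (2 * (1 + M) ^ 3 * (1 + t)) * B * ((√τ₁)⁻¹ * (√τ₂)⁻¹) * |δ| := by
  have hM := hB.nonneg
  have hB0 : 0 ≤ B := (norm_nonneg _).trans hF
  have ht0 : 0 < t := by linarith
  set X := Real.exp (-(ν₀ * t)) * (2 * (1 + M) ^ 3 * (1 + t)) * B * |δ| with hX
  have hX0 : 0 ≤ X := by positivity
  have hexp : Real.exp (-(ν₀ * t)) =
      Real.exp (-(ν₀ * τ₀)) * Real.exp (-(ν₀ * τ₁)) * Real.exp (-(ν₀ * τ₂)) := by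
    rw [← Real.exp_add, ← Real.exp_add, ← ht]
    congr 1
    ring
  refine (le_mul_inv_sqrt hX0 h1 h2 ?_ ?_).trans_eq (by rw [hX]; ring)
  -- The difference is spent on `τ₁`, between the two factors `K`.
  · rw [xDiff_Sop]
    refine (hB.norm_Sop_le' h0 (hB.norm_xDiff_Kop_Sop_Kop_le he h1 (by linarith : τ₁ ≤ t)
      (hB.norm_Sop_le' h2.le hF) δ)).trans_eq ?_
    rw [hX, hexp]
    ring
  -- The difference is commuted inward and spent on `τ₂`, using the velocity regularity of `F`.
  · rw [xDiff_Sop, xDiff_Kop, xDiff_Sop]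
    refine (hB.norm_Sop_le' h0 (hB.norm_Kop_le' (hB.norm_Sop_le' h1.le
      (hB.norm_xDiff_Kop_Sop_le he h2 (by linarith : τ₂ ≤ t) hF hFe δ)))).trans_eq ?_
    rw [hX, hexp]
    ring

/-- Two spatial differences of the integrand of the second mixture operator. -/
theorem norm_xDiff_xDiff_path_le (hB : KineticBounds a b c d ν₀ M) {e e' : V} (he : ‖e‖ = 1)
    (he' : ‖e'‖ = 1) {τ₀ τ₁ τ₂ τ₃ τ₄ t : ℝ}
    (h0 : 0 ≤ τ₀) (h1 : 0 < τ₁) (h2 : 0 < τ₂) (h3 : 0 < τ₃) (h4 : 0 < τ₄)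
    (ht : τ₀ + τ₁ + τ₂ + τ₃ + τ₄ = t) {F : Lp 𝕜 2 (phaseMeasure L)} {B : ℝ} (hF : ‖F‖ ≤ B)
    (hFe : ∀ h : ℝ, ‖tr (0, h • e') F - F‖ ≤ B * |h|) (δ δ' : ℝ) :
    ‖xDiff δ e (xDiff δ' e' (hB.Sop h0 (hB.Kop (hB.Sop h1.le (hB.Kop (hB.Sop h2.le
      (hB.Kop (hB.Sop h3.le (hB.Kop (hB.Sop h4.le F))))))))))‖ ≤
      Real.exp (-(ν₀ * t)) * (2 * (1 + M) ^ 3 * (1 + t)) ^ 2 * B *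
        ((√τ₁)⁻¹ * (√τ₂)⁻¹ * (√τ₃)⁻¹ * (√τ₄)⁻¹) * |δ| * |δ'| := by
  have hM := hB.nonneg
  have hB0 : 0 ≤ B := (norm_nonneg _).trans hF
  have ht0 : 0 < t := by linarith
  set X := Real.exp (-(ν₀ * t)) * (2 * (1 + M) ^ 3 * (1 + t)) ^ 2 * B * |δ| * |δ'| with hX
  have hX0 : 0 ≤ X := by positivity
  have hexp : Real.exp (-(ν₀ * t)) = Real.exp (-(ν₀ * τ₀)) * Real.exp (-(ν₀ * τ₁)) *
      Real.exp (-(ν₀ * τ₂)) * Real.exp (-(ν₀ * τ₃)) * Real.exp (-(ν₀ * τ₄)) := by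
    rw [← Real.exp_add, ← Real.exp_add, ← Real.exp_add, ← Real.exp_add, ← ht]
    congr 1
    ring
  -- A block `K S^τ K` uses both adjacent factors `K`, so two differences need disjoint blocks:
  -- around `τ₁` and `τ₃`, or around `τ₂` and at the end `τ₄`, where `F` replaces the second `K`.
  refine (le_mul_inv_sqrt hX0 (mul_pos h1 h3) (mul_pos h2 h4) ?_ ?_).trans_eq ?_
  · rw [hB.xDiff_Sop δ' e' h0, hB.xDiff_Kop δ' e', hB.xDiff_Sop δ' e' h1.le, hB.xDiff_Kop δ' e',
      hB.xDiff_Sop δ' e' h2.le, hB.xDiff_Sop δ e h0]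
    refine (hB.norm_Sop_le' h0 (hB.norm_xDiff_Kop_Sop_Kop_le he h1 (by linarith : τ₁ ≤ t)
      (hB.norm_Sop_le' h2.le (hB.norm_xDiff_Kop_Sop_Kop_le he' h3 (by linarith : τ₃ ≤ t)
        (hB.norm_Sop_le' h4.le hF) δ')) δ)).trans_eq ?_
    rw [hX, hexp]
    field_simp
  · rw [hB.xDiff_Sop δ' e' h0, hB.xDiff_Kop δ' e', hB.xDiff_Sop δ' e' h1.le, hB.xDiff_Kop δ' e',
      hB.xDiff_Sop δ' e' h2.le, hB.xDiff_Kop δ' e', hB.xDiff_Sop δ' e' h3.le, hB.xDiff_Sop δ e h0,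
      hB.xDiff_Kop δ e, hB.xDiff_Sop δ e h1.le]
    refine (hB.norm_Sop_le' h0 (hB.norm_Kop_le' (hB.norm_Sop_le' h1.le
      (hB.norm_xDiff_Kop_Sop_Kop_le he h2 (by linarith : τ₂ ≤ t) (hB.norm_Sop_le' h3.le
        (hB.norm_xDiff_Kop_Sop_le he' h4 (by linarith : τ₄ ≤ t) hF hFe δ')) δ)))).trans_eq ?_
    rw [hX, hexp]
    field_simp
  · rw [hX, Real.sqrt_mul h1.le, Real.sqrt_mul h2.le, mul_inv, mul_inv]
    ring

end KineticBounds

end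

section


/-! ### Iterated time integrals -/

section nest

variable {Ω : Type*}

/-- The set of pairs `(s, p)` with `0 < s < t` and `p ∈ D s`. -/
def nest (D : ℝ → Set Ω) (t : ℝ) : Set (ℝ × Ω) := {p | p.1 ∈ Ioo 0 t ∧ p.2 ∈ D p.1}

theorem indicator_nest {β : Type*} [Zero β] {D : ℝ → Set Ω} (g : ℝ × Ω → β) (t s : ℝ)
    (w : Ω) :
    (nest D t).indicator g (s, w) =
      (Ioo 0 t).indicator (fun s => (D s).indicator (fun w => g (s, w)) w) s := by
  classical
  by_cases h1 : s ∈ Ioo 0 t <;> by_cases h2 : w ∈ D s <;>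
    simp [indicator, nest, h1, h2] <;> simp_all

theorem monotone_nest {D : ℝ → Set Ω} : Monotone (nest D) := by
  rintro t t' h ⟨s, w⟩ ⟨hs, hw⟩
  exact ⟨⟨hs.1, hs.2.trans_le h⟩, hw⟩

variable [MeasurableSpace Ω]

/-- A measurable family of sets. -/
def MeasurableFamily (D : ℝ → Set Ω) : Prop := MeasurableSet {q : ℝ × Ω | q.2 ∈ D q.1}

theorem measurableFamily_Ioo : MeasurableFamily fun t : ℝ => Ioo 0 t := by
  unfold MeasurableFamily
  simp only [mem_Ioo, ofPred_and]
  exact (measurableSet_lt measurable_const measurable_snd).inter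
    (measurableSet_lt measurable_snd measurable_fst)

theorem MeasurableFamily.measurableSet {D : ℝ → Set Ω} (h : MeasurableFamily D) (t : ℝ) :
    MeasurableSet (D t) :=
  (measurable_prodMk_left (x := t)) h

theorem MeasurableFamily.nest {D : ℝ → Set Ω} (h : MeasurableFamily D) :
    MeasurableFamily (nest D) := by
  have h1 : MeasurableSet {q : ℝ × ℝ × Ω | q.2.1 ∈ Ioo 0 q.1} :=
    (measurable_fst.prodMk (measurable_fst.comp measurable_snd)) measurableFamily_Ioo
  have h2 : MeasurableSet {q : ℝ × ℝ × Ω | q.2.2 ∈ D q.2.1} := measurable_snd h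
  exact h1.inter h2

variable {ρ : Measure Ω} [SFinite ρ] {D : ℝ → Set Ω} {E : Type*} [NormedAddCommGroup E]

theorem lintegral_nest (hD : MeasurableFamily D) {g : ℝ × Ω → ℝ≥0∞} (hg : Measurable g) (t : ℝ) :
    ∫⁻ p in nest D t, g p ∂(volume.prod ρ) =
      ∫⁻ s in Ioo 0 t, ∫⁻ w in D s, g (s, w) ∂ρ := by
  have hN := hD.nest.measurableSet t
  rw [← lintegral_indicator hN, lintegral_prod _ (hg.indicator hN).aemeasurable,
    ← lintegral_indicator measurableSet_Ioo]
  refine lintegral_congr fun s => ?_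
  simp only [indicator_nest]
  by_cases hs : s ∈ Ioo 0 t
  · simp only [indicator_of_mem hs]
    rw [lintegral_indicator (hD.measurableSet s)]
  · simp [indicator_of_notMem hs]

/-- Fubini on the nested region; integrability of almost every slice is kept so that the identity
can be iterated. -/
theorem integral_nest [NormedSpace ℝ E] (hD : MeasurableFamily D) {g : ℝ × Ω → E} {t : ℝ}
    (hg : IntegrableOn g (nest D t) (volume.prod ρ)) :
    (∀ᵐ s : ℝ, s ∈ Ioo 0 t → IntegrableOn (fun w => g (s, w)) (D s) ρ) ∧
      ∫ p in nest D t, g p ∂(volume.prod ρ) = ∫ s in Ioo 0 t, ∫ w in D s, g (s, w) ∂ρ := by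
  have hN := hD.nest.measurableSet t
  rw [← integrable_indicator_iff hN] at hg
  constructor
  · filter_upwards [hg.prod_right_ae] with s hs hst
    simp only [indicator_nest, indicator_of_mem hst] at hs
    exact (integrable_indicator_iff (hD.measurableSet s)).mp hs
  · rw [← integral_indicator hN, integral_prod _ hg, ← integral_indicator measurableSet_Ioo]
    refine integral_congr_ae (ae_of_all _ fun s => ?_)
    simp only [indicator_nest]
    by_cases hs : s ∈ Ioo 0 t
    · simp only [indicator_of_mem hs]
      rw [integral_indicator (hD.measurableSet s)]
    · simp [indicator_of_notMem hs]

theorem measure_nest_lt_top {D : ℝ → Set Ω} (hD : ∀ t, ρ (D t) < ⊤)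
    (hmono : Monotone D) (t : ℝ) : (volume.prod ρ) (nest D t) < ⊤ := by
  refine lt_of_le_of_lt (measure_mono (t := Ioo 0 t ×ˢ D t) ?_) ?_
  · rintro ⟨s, w⟩ ⟨hs, hw⟩
    exact ⟨hs, hmono hs.2.le hw⟩
  · rw [Measure.prod_prod]
    exact ENNReal.mul_lt_top (by simp) (hD t)

end nest

/-- The time simplex `0 < s₂ < s₁ < t`. -/
def simplex₂ : ℝ → Set (ℝ × ℝ) := nest fun t => Ioo 0 t

/-- The time simplex `0 < s₄ < s₃ < s₂ < s₁ < t`. -/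
def simplex₄ : ℝ → Set (ℝ × ℝ × ℝ × ℝ) := nest (nest simplex₂)

theorem measurableFamily_simplex₂ : MeasurableFamily simplex₂ := measurableFamily_Ioo.nest

theorem measurableFamily_simplex₄ : MeasurableFamily simplex₄ :=
  measurableFamily_simplex₂.nest.nest

theorem monotone_Ioo_zero : Monotone fun t : ℝ => Ioo 0 t :=
  fun _ _ h => Ioo_subset_Ioo_right h

theorem volume_simplex₂_lt_top (t : ℝ) : volume (simplex₂ t) < ⊤ :=
  measure_nest_lt_top (fun t => by simp) monotone_Ioo_zero t

theorem volume_simplex₄_lt_top (t : ℝ) : volume (simplex₄ t) < ⊤ :=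
  measure_nest_lt_top (fun t => measure_nest_lt_top volume_simplex₂_lt_top monotone_nest t)
    monotone_nest t

theorem intervalIntegral_eq_Ioo {E : Type*} [NormedAddCommGroup E] [NormedSpace ℝ E] {t : ℝ}
    (ht : 0 ≤ t) (f : ℝ → E) : ∫ s in (0 : ℝ)..t, f s = ∫ s in Ioo 0 t, f s := by
  rw [intervalIntegral.integral_of_le ht, integral_Ioc_eq_integral_Ioo]

theorem integral_simplex₂ {E : Type*} [NormedAddCommGroup E] [NormedSpace ℝ E] {t : ℝ}
    (ht : 0 ≤ t) {g : ℝ × ℝ → E} (hg : IntegrableOn g (simplex₂ t)) :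
    ∫ p in simplex₂ t, g p = ∫ s₁ in (0 : ℝ)..t, ∫ s₂ in (0 : ℝ)..s₁, g (s₁, s₂) := by
  rw [intervalIntegral_eq_Ioo ht]
  refine (integral_nest measurableFamily_Ioo hg).2.trans ?_
  refine setIntegral_congr_fun measurableSet_Ioo fun s hs => ?_
  exact (intervalIntegral_eq_Ioo hs.1.le _).symm

theorem integral_simplex₄ {E : Type*} [NormedAddCommGroup E] [NormedSpace ℝ E] {t : ℝ}
    (ht : 0 ≤ t) {g : ℝ × ℝ × ℝ × ℝ → E} (hg : IntegrableOn g (simplex₄ t)) :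
    ∫ p in simplex₄ t, g p = ∫ s₁ in (0 : ℝ)..t, ∫ s₂ in (0 : ℝ)..s₁, ∫ s₃ in (0 : ℝ)..s₂,
      ∫ s₄ in (0 : ℝ)..s₃, g (s₁, s₂, s₃, s₄) := by
  rw [intervalIntegral_eq_Ioo ht]
  obtain ⟨h1, h2⟩ := integral_nest measurableFamily_simplex₂.nest hg
  refine h2.trans (setIntegral_congr_ae measurableSet_Ioo ?_)
  filter_upwards [h1] with s₁ hs₁ hs
  rw [intervalIntegral_eq_Ioo hs.1.le]
  obtain ⟨h3, h4⟩ := integral_nest measurableFamily_simplex₂ (hs₁ hs)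
  refine h4.trans (setIntegral_congr_ae measurableSet_Ioo ?_)
  filter_upwards [h3] with s₂ hs₂ hs'
  exact integral_simplex₂ hs'.1.le (hs₂ hs')

/-! ### Singular time weights -/

theorem lintegral_inv_sqrt_le (s : ℝ) :
    ∫⁻ u in Ioo 0 s, ENNReal.ofReal (√u)⁻¹ ≤ ENNReal.ofReal (2 * √s) := by
  rcases le_or_gt s 0 with hs | hs
  · simp [Ioo_eq_empty_of_le hs]
  have e : ∀ u : ℝ, u ∈ Ioo 0 s → (√u)⁻¹ = u ^ (-(1 / 2) : ℝ) := fun u hu => by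
    rw [Real.rpow_neg hu.1.le, Real.sqrt_eq_rpow]
  have hi : IntervalIntegrable (fun u : ℝ => u ^ (-(1 / 2) : ℝ)) volume 0 s :=
    intervalIntegral.intervalIntegrable_rpow' (by norm_num)
  have hi2 : IntegrableOn (fun u : ℝ => u ^ (-(1 / 2) : ℝ)) (Ioo 0 s) :=
    ((intervalIntegrable_iff_integrableOn_Ioo_of_le hs.le).mp hi)
  rw [setLIntegral_congr_fun (g := fun u => ENNReal.ofReal (u ^ (-(1 / 2) : ℝ)))
    measurableSet_Ioo fun u hu => by simp only [e u hu]]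
  rw [← ofReal_integral_eq_lintegral_ofReal hi2 ?_]
  · rw [← intervalIntegral_eq_Ioo hs.le, integral_rpow (Or.inl (by norm_num)),
      Real.sqrt_eq_rpow]
    refine ENNReal.ofReal_le_ofReal (le_of_eq ?_)
    norm_num
    ring
  · exact (ae_restrict_iff' measurableSet_Ioo).mpr (ae_of_all _ fun u hu =>
      Real.rpow_nonneg hu.1.le _)

theorem lintegral_inv_sqrt_sub_le (s : ℝ) :
    ∫⁻ u in Ioo 0 s, ENNReal.ofReal (√(s - u))⁻¹ ≤ ENNReal.ofReal (2 * √s) := by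
  refine le_of_eq_of_le ?_ (lintegral_inv_sqrt_le s)
  rw [← lintegral_indicator measurableSet_Ioo, ← lintegral_indicator measurableSet_Ioo,
    ← lintegral_sub_left_eq_self _ s]
  refine lintegral_congr fun u => ?_
  have : s - u ∈ Ioo 0 s ↔ u ∈ Ioo 0 s := by
    simp only [mem_Ioo]
    constructor <;> rintro ⟨h1, h2⟩ <;> constructor <;> linarith
  by_cases hu : u ∈ Ioo 0 s
  · rw [indicator_of_mem hu, indicator_of_mem (this.mpr hu), sub_sub_cancel]
  · rw [indicator_of_notMem hu, indicator_of_notMem (this.not.mpr hu)]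

/-- From `√s ≤ √(s - u) + √u` the product is at most `2 / √s` times the sum of the two factors, and
each factor integrates to at most `2 √s`. -/
theorem lintegral_inv_sqrt_mul_le (s : ℝ) :
    ∫⁻ u in Ioo 0 s, ENNReal.ofReal ((√(s - u))⁻¹ * (√u)⁻¹) ≤ ENNReal.ofReal 8 := by
  rcases le_or_gt s 0 with hs | hs
  · simp [Ioo_eq_empty_of_le hs]
  have hss : 0 < √s := Real.sqrt_pos.mpr hs
  have key : ∀ u ∈ Ioo 0 s, (√(s - u))⁻¹ * (√u)⁻¹ ≤ 2 * (√s)⁻¹ * ((√(s - u))⁻¹ + (√u)⁻¹) := by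
    intro u hu
    have h1 : 0 < √u := Real.sqrt_pos.mpr hu.1
    have h2 : 0 < √(s - u) := Real.sqrt_pos.mpr (by linarith [hu.2])
    have h3 : √s ≤ √(s - u) + √u := by
      refine Real.sqrt_le_iff.mpr ⟨by positivity, ?_⟩
      nlinarith [Real.sq_sqrt hu.1.le, Real.sq_sqrt (by linarith [hu.2] : 0 ≤ s - u),
        mul_pos h1 h2]
    have e : 2 * (√s)⁻¹ * ((√(s - u))⁻¹ + (√u)⁻¹) =
        (2 * (√(s - u) + √u) / √s) * ((√(s - u))⁻¹ * (√u)⁻¹) := by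
      field_simp
      ring
    rw [e]
    refine le_mul_of_one_le_left (by positivity) ?_
    rw [one_le_div hss]
    linarith
  calc _ ≤ ∫⁻ u in Ioo 0 s, ENNReal.ofReal (2 * (√s)⁻¹) *
        (ENNReal.ofReal (√(s - u))⁻¹ + ENNReal.ofReal (√u)⁻¹) := by
        refine setLIntegral_mono' measurableSet_Ioo fun u hu => ?_
        rw [← ENNReal.ofReal_add (by positivity) (by positivity),
          ← ENNReal.ofReal_mul (by positivity)]
        exact ENNReal.ofReal_le_ofReal (key u hu)
    _ ≤ ENNReal.ofReal (2 * (√s)⁻¹) * (ENNReal.ofReal (2 * √s) + ENNReal.ofReal (2 * √s)) := by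
        rw [lintegral_const_mul _ (by fun_prop), lintegral_add_left (by fun_prop)]
        gcongr
        exacts [lintegral_inv_sqrt_sub_le s, lintegral_inv_sqrt_le s]
    _ = ENNReal.ofReal 8 := by
        rw [← ENNReal.ofReal_add (by positivity) (by positivity),
          ← ENNReal.ofReal_mul (by positivity)]
        congr 1
        field_simp
        norm_num

theorem lintegral_simplex₂_weight_le (t : ℝ) :
    ∫⁻ p in simplex₂ t, ENNReal.ofReal ((√(p.1 - p.2))⁻¹ * (√p.2)⁻¹) ≤
      ENNReal.ofReal 8 * ENNReal.ofReal t := by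
  refine (lintegral_nest (ρ := volume) measurableFamily_Ioo (g := fun p : ℝ × ℝ =>
    ENNReal.ofReal ((√(p.1 - p.2))⁻¹ * (√p.2)⁻¹)) (by fun_prop) t).trans_le ?_
  refine (lintegral_mono fun s => lintegral_inv_sqrt_mul_le s).trans ?_
  simp

/-- From the inside outwards: `s₄` gives `8`, `s₃` gives a factor `2 √s₂`, `s₂` gives `2 √s₁` after
bounding `√s₂ ≤ √s₁`, so `32 s₁ ≤ 32 t` remains for `s₁`. The outermost gap `t - s₁` carries no
weight. -/
theorem lintegral_simplex₄_weight_le (t : ℝ) :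
    ∫⁻ p in simplex₄ t, ENNReal.ofReal ((√(p.1 - p.2.1))⁻¹ * (√(p.2.1 - p.2.2.1))⁻¹ *
      (√(p.2.2.1 - p.2.2.2))⁻¹ * (√p.2.2.2)⁻¹) ≤
      ENNReal.ofReal 32 * ENNReal.ofReal t ^ 2 := by
  have hm : Measurable fun p : ℝ × ℝ × ℝ × ℝ => ENNReal.ofReal ((√(p.1 - p.2.1))⁻¹ *
      (√(p.2.1 - p.2.2.1))⁻¹ * (√(p.2.2.1 - p.2.2.2))⁻¹ * (√p.2.2.2)⁻¹) := by fun_prop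
  have hin : ∀ s₁ s₂ : ℝ, ∫⁻ p in simplex₂ s₂, ENNReal.ofReal ((√(s₁ - s₂))⁻¹ *
      (√(s₂ - p.1))⁻¹ * (√(p.1 - p.2))⁻¹ * (√p.2)⁻¹) ≤
      ENNReal.ofReal (√(s₁ - s₂))⁻¹ * ENNReal.ofReal (16 * √s₂) := by
    intro s₁ s₂
    refine (lintegral_nest (ρ := volume) measurableFamily_Ioo (g := fun p : ℝ × ℝ =>
      ENNReal.ofReal ((√(s₁ - s₂))⁻¹ * (√(s₂ - p.1))⁻¹ * (√(p.1 - p.2))⁻¹ * (√p.2)⁻¹))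
      (by fun_prop) s₂).trans_le ?_
    calc _ ≤ ∫⁻ s₃ in Ioo 0 s₂, ENNReal.ofReal (√(s₁ - s₂))⁻¹ * ENNReal.ofReal (√(s₂ - s₃))⁻¹ *
          ENNReal.ofReal 8 := by
          refine lintegral_mono fun s₃ => ?_
          refine le_trans (le_of_eq ?_) (mul_le_mul_right (lintegral_inv_sqrt_mul_le s₃) _)
          rw [← lintegral_const_mul _ (by fun_prop)]
          refine lintegral_congr fun s₄ => ?_
          rw [← ENNReal.ofReal_mul (by positivity), ← ENNReal.ofReal_mul (by positivity)]
          simp only [mul_assoc]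
      _ ≤ ENNReal.ofReal (√(s₁ - s₂))⁻¹ * ENNReal.ofReal (2 * √s₂) * ENNReal.ofReal 8 := by
          rw [lintegral_mul_const _ (by fun_prop), lintegral_const_mul _ (by fun_prop)]
          gcongr
          exact lintegral_inv_sqrt_sub_le s₂
      _ = _ := by
          rw [mul_assoc, ← ENNReal.ofReal_mul (by positivity)]
          congr 2
          ring
  have hmid : ∀ s₁ : ℝ, ∫⁻ p in nest simplex₂ s₁, ENNReal.ofReal ((√(s₁ - p.1))⁻¹ *
      (√(p.1 - p.2.1))⁻¹ * (√(p.2.1 - p.2.2))⁻¹ * (√p.2.2)⁻¹) ≤ ENNReal.ofReal (32 * s₁) := by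
    intro s₁
    rcases le_or_gt s₁ 0 with hs | hs
    · have : nest simplex₂ s₁ = ∅ := by
        ext ⟨s, w⟩
        simp [nest, Ioo_eq_empty_of_le hs]
      simp [this]
    refine (lintegral_nest (ρ := volume) measurableFamily_simplex₂ (g := fun p : ℝ × ℝ × ℝ =>
      ENNReal.ofReal ((√(s₁ - p.1))⁻¹ * (√(p.1 - p.2.1))⁻¹ * (√(p.2.1 - p.2.2))⁻¹ * (√p.2.2)⁻¹))
      (by fun_prop) s₁).trans_le ?_
    calc _ ≤ ∫⁻ s₂ in Ioo 0 s₁, ENNReal.ofReal (√(s₁ - s₂))⁻¹ * ENNReal.ofReal (16 * √s₁) := by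
          refine setLIntegral_mono' measurableSet_Ioo fun s₂ hs₂ => (hin s₁ s₂).trans ?_
          gcongr
          exact hs₂.2.le
      _ ≤ ENNReal.ofReal (2 * √s₁) * ENNReal.ofReal (16 * √s₁) := by
          rw [lintegral_mul_const _ (by fun_prop)]
          gcongr
          exact lintegral_inv_sqrt_sub_le s₁
      _ = _ := by
          rw [← ENNReal.ofReal_mul (by positivity)]
          congr 1
          nlinarith [Real.mul_self_sqrt hs.le]
  refine (lintegral_nest (ρ := volume) measurableFamily_simplex₂.nest hm t).trans_le ?_
  calc _ ≤ ∫⁻ s₁ in Ioo 0 t, ENNReal.ofReal 32 * ENNReal.ofReal t := by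
        refine setLIntegral_mono' measurableSet_Ioo fun s₁ hs₁ => (hmid s₁).trans ?_
        rw [← ENNReal.ofReal_mul (by norm_num)]
        exact ENNReal.ofReal_le_ofReal (by linarith [hs₁.2])
    _ = _ := by
        simp [sq, mul_assoc]

end

section


variable {𝕜 : Type*} [RCLike 𝕜] {L : ℝ} [Fact (0 < L)]

/-! ### Families of functions on phase space depending on a parameter -/

section parameter

variable {Ω : Type*} [MeasurableSpace Ω] {ρ : Measure Ω} {f : Ω → Phase L → 𝕜}

theorem measurePreserving_prod_flow [SFinite ρ] {σ : Ω → ℝ} (hσ : Measurable σ) :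
    MeasurePreserving (fun p : Ω × Phase L => (p.1, flow (σ p.1) p.2)) (ρ.prod (phaseMeasure L))
      (ρ.prod (phaseMeasure L)) := by
  refine (MeasurePreserving.id ρ).skew_product (g := fun s z => flow (σ s) z) ?_
    (ae_of_all _ fun s => (measurePreserving_flow (σ s)).map_eq)
  have h : Measurable fun p : Ω × Phase L => toTorus L (σ p.1 • p.2.2) :=
    continuous_toTorus.measurable.comp (by fun_prop)
  unfold flow Function.uncurry
  fun_prop

theorem aestronglyMeasurable_S [SFinite ρ]
    (hf : AEStronglyMeasurable (fun p : Ω × Phase L => f p.1 p.2) (ρ.prod (phaseMeasure L)))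
    (a b : ℝ) {σ : Ω → ℝ} (hσ : Measurable σ) :
    AEStronglyMeasurable (fun p : Ω × Phase L => S a b (σ p.1) (f p.1) p.2)
      (ρ.prod (phaseMeasure L)) := by
  have h1 : Measurable fun p : Ω × Phase L => Real.exp (-nu a b p.2.2 * σ p.1) :=
    (((measurable_nu a b).comp (by fun_prop : Measurable fun p : Ω × Phase L => p.2.2)).neg.mul
      (hσ.comp measurable_fst)).exp
  exact h1.aestronglyMeasurable.smul
    (hf.comp_measurePreserving (measurePreserving_prod_flow (ρ := ρ) hσ))

/-- The map forgets the old velocity and so does not preserve measure, but Fubini shows that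
preimages of null sets are null. This is what transfers almost everywhere measurability through `K`.
-/
theorem quasiMeasurePreserving_velocity_swap [SFinite ρ] :
    Measure.QuasiMeasurePreserving (fun q : (Ω × Phase L) × V => (q.1.1, (q.1.2.1, q.2)))
      ((ρ.prod (phaseMeasure L)).prod volume) (ρ.prod (phaseMeasure L)) := by
  refine ⟨by fun_prop, Measure.AbsolutelyContinuous.mk fun s hs h0 => ?_⟩
  have hm : Measurable fun q : (Ω × Phase L) × V => (q.1.1, (q.1.2.1, q.2)) := by fun_prop
  rw [Measure.map_apply hm hs, Measure.measure_prod_null (hm hs)]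
  have h1 := Measure.ae_ae_of_ae_prod (measure_eq_zero_iff_ae_notMem.mp h0)
  have h2 : ∀ᵐ p : Ω × Phase L ∂ρ.prod (phaseMeasure L), ∀ᵐ z ∂phaseMeasure L, (p.1, z) ∉ s :=
    Measure.quasiMeasurePreserving_fst.ae h1
  have h3 : MeasurableSet {p : Ω × Phase L | ∀ᵐ η : V, (p.1, (p.2.1, η)) ∉ s} := by
    have := measurable_measure_prodMk_left (ν := (volume : Measure V)) (hm hs)
    convert this (measurableSet_singleton 0) using 1
    ext p
    exact measure_eq_zero_iff_ae_notMem.symm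
  have h4 : ∀ᵐ p : Ω × Phase L ∂ρ.prod (phaseMeasure L), ∀ᵐ η : V, (p.1, (p.2.1, η)) ∉ s := by
    rw [Measure.ae_prod_iff_ae_ae h3]
    filter_upwards [h1] with w hw
    exact Measure.quasiMeasurePreserving_fst.ae (Measure.ae_ae_of_ae_prod hw)
  filter_upwards [h4] with p hp
  exact measure_eq_zero_iff_ae_notMem.mpr hp

theorem aestronglyMeasurable_K [SFinite ρ]
    (hf : AEStronglyMeasurable (fun p : Ω × Phase L => f p.1 p.2) (ρ.prod (phaseMeasure L)))
    (c d : ℝ) :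
    AEStronglyMeasurable (fun p : Ω × Phase L => K c d (f p.1) p.2) (ρ.prod (phaseMeasure L)) := by
  refine AEStronglyMeasurable.integral_prod_right'
    (f := fun q : (Ω × Phase L) × V => W c d q.1.2.2 q.2 • f q.1.1 (q.1.2.1, q.2)) ?_
  have h1 : Measurable fun q : (Ω × Phase L) × V => W c d q.1.2.2 q.2 :=
    (measurable_W c d).comp (f := fun q : (Ω × Phase L) × V => (q.1.2.2, q.2)) (by fun_prop)
  exact h1.aestronglyMeasurable.smul
    (hf.comp_quasiMeasurePreserving quasiMeasurePreserving_velocity_swap)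

variable [IsFiniteMeasure ρ] {A : ℝ}

theorem memLp_prod_of_slices
    (hf : AEStronglyMeasurable (fun p : Ω × Phase L => f p.1 p.2) (ρ.prod (phaseMeasure L)))
    (hA : ∀ᵐ s ∂ρ, eLpNorm (f s) 2 (phaseMeasure L) ≤ ENNReal.ofReal A) :
    MemLp (fun p : Ω × Phase L => f p.1 p.2) 2 (ρ.prod (phaseMeasure L)) := by
  refine ⟨hf, ?_⟩
  refine (ENNReal.pow_lt_top_iff.mp ?_).resolve_right two_ne_zero
  rw [eLpNorm_two_sq, lintegral_prod _ (hf.enorm.pow_const 2)]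
  calc _ ≤ ∫⁻ _, ENNReal.ofReal A ^ 2 ∂ρ := lintegral_mono_ae (by
        filter_upwards [hA] with s hs
        rw [← eLpNorm_two_sq]
        gcongr)
    _ < ⊤ := by
        rw [lintegral_const]
        finiteness

/-- Cauchy-Schwarz in the parameter, whose measure is finite. -/
theorem ae_integrable_and_memLp_integral
    (hf : MemLp (fun p : Ω × Phase L => f p.1 p.2) 2 (ρ.prod (phaseMeasure L))) :
    (∀ᵐ z ∂phaseMeasure L, Integrable (fun s => f s z) ρ) ∧
      MemLp (fun z => ∫ s, f s z ∂ρ) 2 (phaseMeasure L) := by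
  have hsw : AEStronglyMeasurable (fun p : Phase L × Ω => f p.2 p.1)
      ((phaseMeasure L).prod ρ) := hf.1.prod_swap
  have hslice : ∀ᵐ z ∂phaseMeasure L, AEStronglyMeasurable (fun s => f s z) ρ := hsw.prodMk_left
  have h2 : ∫⁻ z, ∫⁻ s, ‖f s z‖ₑ ^ 2 ∂ρ ∂phaseMeasure L < ⊤ := by
    rw [← lintegral_prod_symm _ (hf.1.enorm.pow_const 2), ← eLpNorm_two_sq]
    exact ENNReal.pow_lt_top hf.2
  have hcs : ∀ᵐ z ∂phaseMeasure L,
      (∫⁻ s, ‖f s z‖ₑ ∂ρ) ^ 2 ≤ ρ univ * ∫⁻ s, ‖f s z‖ₑ ^ 2 ∂ρ := by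
    filter_upwards [hslice] with z hz
    exact sq_lintegral_le ρ hz.enorm
  have hm : AEMeasurable (fun z => ∫⁻ s, ‖f s z‖ₑ ^ 2 ∂ρ) (phaseMeasure L) :=
    (hsw.enorm.pow_const 2).lintegral_prod_right'
  refine ⟨?_, hsw.integral_prod_right', ?_⟩
  · filter_upwards [hslice, hcs, ae_lt_top' hm h2.ne] with z h3 h4 h5
    refine ⟨h3, (ENNReal.pow_lt_top_iff.mp ?_).resolve_right two_ne_zero⟩
    exact h4.trans_lt (ENNReal.mul_lt_top (measure_lt_top _ _) h5)
  · refine (ENNReal.pow_lt_top_iff.mp ?_).resolve_right two_ne_zero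
    rw [eLpNorm_two_sq]
    calc _ ≤ ∫⁻ z, ρ univ * ∫⁻ s, ‖f s z‖ₑ ^ 2 ∂ρ ∂phaseMeasure L := lintegral_mono_ae (by
          filter_upwards [hcs] with z hz
          refine le_trans ?_ hz
          gcongr
          exact enorm_integral_le_lintegral_enorm _)
      _ < ⊤ := by
          rw [lintegral_const_mul'' _ hm]
          exact ENNReal.mul_lt_top (measure_lt_top _ _) h2

theorem integral_smul_integral_comm
    (hf : MemLp (fun p : Ω × Phase L => f p.1 p.2) 2 (ρ.prod (phaseMeasure L)))
    {ψ : Phase L → ℝ} (hψ : MemLp ψ 2 (phaseMeasure L)) :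
    ∫ z, ψ z • ∫ s, f s z ∂ρ ∂phaseMeasure L = ∫ s, ∫ z, ψ z • f s z ∂phaseMeasure L ∂ρ := by
  have h1 : MemLp (fun p : Ω × Phase L => ψ p.2) 2 (ρ.prod (phaseMeasure L)) := hψ.comp_snd ρ
  have h2 : Integrable (fun p : Ω × Phase L => ψ p.2 • f p.1 p.2) (ρ.prod (phaseMeasure L)) :=
    memLp_one_iff_integrable.mp (hf.smul h1)
  rw [integral_integral_swap h2]
  simp only [integral_smul]

/-- Superposition of weak derivatives. -/
theorem exists_representative_integral
    (hf : MemLp (fun p : Ω × Phase L => f p.1 p.2) 2 (ρ.prod (phaseMeasure L)))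
    (D : testSpace L →ₗ[ℝ] testSpace L) {w : Ω → ℝ} {Y R : ℝ} (hY : 0 ≤ Y) (hR : 0 ≤ R)
    (hw : ∫⁻ s, ENNReal.ofReal (w s) ∂ρ ≤ ENNReal.ofReal R)
    (h : ∀ᵐ s ∂ρ, ∀ φ : testSpace L,
      ‖∫ z, (D φ).1 z • f s z ∂phaseMeasure L‖ ≤ w s * (Y * l2norm φ.1)) :
    ∃ g : Phase L → 𝕜, MemLp g 2 (phaseMeasure L) ∧
      eLpNorm g 2 (phaseMeasure L) ≤ ENNReal.ofReal (2 * (R * Y)) ∧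
      ∀ φ : testSpace L, ∫ z, (D φ).1 z • ∫ s, f s z ∂ρ ∂phaseMeasure L =
        ∫ z, φ.1 z • g z ∂phaseMeasure L := by
  have hF := (ae_integrable_and_memLp_integral hf).2
  -- The weight `w` may be singular in the parameter: only its total mass enters the bound on the
  -- functional.
  refine exists_representative (testFunctional D _ (locallyIntegrable_of_memLp hF))
    (mul_nonneg hR hY) fun φ => ?_
  have hφ := mul_nonneg hY (l2norm_nonneg φ.1)
  change ‖∫ z, (D φ).1 z • ∫ s, f s z ∂ρ ∂phaseMeasure L‖ ≤ _
  rw [integral_smul_integral_comm hf (IsTestFunction.memLp (D φ).2), ← toReal_enorm]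
  refine ENNReal.toReal_le_of_le_ofReal (mul_nonneg (mul_nonneg hR hY) (l2norm_nonneg _)) ?_
  calc _ ≤ ∫⁻ s, ‖∫ z, (D φ).1 z • f s z ∂phaseMeasure L‖ₑ ∂ρ :=
        enorm_integral_le_lintegral_enorm _
    _ ≤ ∫⁻ s, ENNReal.ofReal (w s) * ENNReal.ofReal (Y * l2norm φ.1) ∂ρ := lintegral_mono_ae (by
        filter_upwards [h] with s hs
        rw [← ENNReal.ofReal_mul' hφ, ← ofReal_norm]
        exact ENNReal.ofReal_le_ofReal (hs φ))
    _ ≤ ENNReal.ofReal R * ENNReal.ofReal (Y * l2norm φ.1) := by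
        rw [lintegral_mul_const' _ _ ENNReal.ofReal_ne_top]
        gcongr
    _ = _ := by rw [← ENNReal.ofReal_mul hR, mul_assoc]

end parameter

end

/-! ### Weak-derivative bounds for the integrands -/

section


variable {𝕜 : Type*} [RCLike 𝕜] {L : ℝ} [Fact (0 < L)] {a b c d ν₀ M : ℝ}

theorem xDiff_toLp (δ : ℝ) (e : V) {u : Phase L → 𝕜} (hu : MemLp u 2 (phaseMeasure L)) :
    xDiff δ e (hu.toLp u) = ((memLp_comp_add_right hu (phaseProj L (δ • ((e, 0) : V × V)))).sub
      hu).toLp (fun z => u (z + phaseProj L (δ • ((e, 0) : V × V))) - u z) := by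
  rw [xDiff_apply, tr_toLp, ← MemLp.toLp_sub]
  simp only [phaseProj_smul_left]
  rfl

/-- The integrand of the first mixture operator. -/
def path₁ (a b c d t : ℝ) (f : Phase L → 𝕜) (p : ℝ × ℝ) : Phase L → 𝕜 :=
  S a b (t - p.1) (K c d (S a b (p.1 - p.2) (K c d (S a b p.2 f))))

/-- The integrand of the second mixture operator. -/
def path₂ (a b c d t : ℝ) (f : Phase L → 𝕜) (p : ℝ × ℝ × ℝ × ℝ) : Phase L → 𝕜 :=
  S a b (t - p.1) (K c d (S a b (p.1 - p.2.1) (K c d (S a b (p.2.1 - p.2.2.1)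
    (K c d (S a b (p.2.2.1 - p.2.2.2) (K c d (S a b p.2.2.2 f))))))))

namespace KineticBounds

theorem l2norm_K_le (hB : KineticBounds a b c d ν₀ M) {f : Phase L → 𝕜}
    (hf : MemLp f 2 (phaseMeasure L)) :
    MemLp (K c d f) 2 (phaseMeasure L) ∧ l2norm (K c d f) ≤ M * l2norm f :=
  ⟨hB.isL2Op_K.memLp hf, hB.isL2Op_K.norm_le hf⟩

theorem l2norm_S_le (hB : KineticBounds a b c d ν₀ M) {τ : ℝ} (hτ : 0 ≤ τ) {f : Phase L → 𝕜}
    (hf : MemLp f 2 (phaseMeasure L)) :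
    MemLp (S a b τ f) 2 (phaseMeasure L) ∧ l2norm (S a b τ f) ≤ l2norm f := by
  refine ⟨(hB.isL2Op_S hτ).memLp hf, ((hB.isL2Op_S hτ).norm_le hf).trans ?_⟩
  refine mul_le_of_le_one_left (l2norm_nonneg _) (Real.exp_le_one_iff.mpr ?_)
  have := mul_nonneg hB.pos.le hτ
  linarith

theorem l2norm_KS_le (hB : KineticBounds a b c d ν₀ M) {τ : ℝ} (hτ : 0 ≤ τ) {f : Phase L → 𝕜}
    {B : ℝ} (hf : MemLp f 2 (phaseMeasure L) ∧ l2norm f ≤ B) :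
    MemLp (K c d (S a b τ f)) 2 (phaseMeasure L) ∧ l2norm (K c d (S a b τ f)) ≤ M * B := by
  have h1 := hB.l2norm_S_le hτ hf.1
  have h2 := hB.l2norm_K_le h1.1
  exact ⟨h2.1, h2.2.trans (mul_le_mul_of_nonneg_left (h1.2.trans hf.2) hB.nonneg)⟩

theorem l2norm_path₁_le (hB : KineticBounds a b c d ν₀ M) {f : Phase L → 𝕜}
    (hf : MemLp f 2 (phaseMeasure L)) {t : ℝ} {p : ℝ × ℝ} (hp : p ∈ simplex₂ t) :
    MemLp (path₁ a b c d t f p) 2 (phaseMeasure L) ∧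
      l2norm (path₁ a b c d t f p) ≤ M ^ 2 * l2norm f := by
  obtain ⟨⟨-, h1⟩, h2, h3⟩ := hp
  have k1 := hB.l2norm_KS_le h2.le ⟨hf, le_rfl⟩
  have k2 := hB.l2norm_KS_le (sub_nonneg.mpr h3.le) k1
  have k3 := hB.l2norm_S_le (sub_nonneg.mpr h1.le) k2.1
  exact ⟨k3.1, (k3.2.trans k2.2).trans_eq (by ring)⟩

theorem l2norm_path₂_le (hB : KineticBounds a b c d ν₀ M) {f : Phase L → 𝕜}
    (hf : MemLp f 2 (phaseMeasure L)) {t : ℝ} {p : ℝ × ℝ × ℝ × ℝ} (hp : p ∈ simplex₄ t) :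
    MemLp (path₂ a b c d t f p) 2 (phaseMeasure L) ∧
      l2norm (path₂ a b c d t f p) ≤ M ^ 4 * l2norm f := by
  obtain ⟨⟨-, h1⟩, ⟨-, h2⟩, ⟨-, h3⟩, h4, h5⟩ := hp
  have k1 := hB.l2norm_KS_le h4.le ⟨hf, le_rfl⟩
  have k2 := hB.l2norm_KS_le (sub_nonneg.mpr h5.le) k1
  have k3 := hB.l2norm_KS_le (sub_nonneg.mpr h3.le) k2
  have k4 := hB.l2norm_KS_le (sub_nonneg.mpr h2.le) k3
  have k5 := hB.l2norm_S_le (sub_nonneg.mpr h1.le) k4.1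
  exact ⟨k5.1, (k5.2.trans k4.2).trans_eq (by ring)⟩

theorem norm_integral_dirDeriv_path₁_le (hB : KineticBounds a b c d ν₀ M) {f : Phase L → 𝕜}
    (hf : MemLp f 2 (phaseMeasure L)) {e : V} (he : ‖e‖ = 1) {B : ℝ} (hfB : l2norm f ≤ B)
    (hfe : ∀ h : ℝ, l2norm (fun z => f (z + phaseProj L (h • ((0, e) : V × V))) - f z) ≤ B * |h|)
    {t : ℝ} {p : ℝ × ℝ} (hp : p ∈ simplex₂ t) {φ : Phase L → ℝ} (hφ : IsTestFunction φ) :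
    ‖∫ z, dirDeriv (e, 0) φ z • path₁ a b c d t f p z ∂phaseMeasure L‖ ≤
      ((√(p.1 - p.2))⁻¹ * (√p.2)⁻¹) *
        (Real.exp (-(ν₀ * t)) * (2 * (1 + M) ^ 3 * (1 + t)) * B * l2norm φ) := by
  have hm := (hB.l2norm_path₁_le hf hp).1
  obtain ⟨⟨-, h1⟩, h2, h3⟩ := hp
  have key := hB.norm_xDiff_path_le he (sub_nonneg.mpr h1.le) (sub_pos.mpr h3) h2
    (by ring : t - p.1 + (p.1 - p.2) + p.2 = t) (F := hf.toLp f) (B := B)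
    (by rwa [norm_toLp_eq]) (fun h => by
      rw [tr_toLp, ← MemLp.toLp_sub, norm_toLp_eq]
      have k := hfe h
      rw [phaseProj_smul_right] at k
      exact k)
  -- The product of operators on `L²` becomes the class of the explicit integrand.
  simp only [Sop_toLp, Kop_toLp] at key
  refine (norm_integral_dirDeriv_le hφ (e, 0) hm (A := Real.exp (-(ν₀ * t)) *
    (2 * (1 + M) ^ 3 * (1 + t)) * B * ((√(p.1 - p.2))⁻¹ * (√p.2)⁻¹)) fun s => ?_).trans_eq
    (by ring)
  have k := key s
  rwa [xDiff_toLp, norm_toLp_eq] at k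

theorem norm_integral_dirDeriv_dirDeriv_path₂_le (hB : KineticBounds a b c d ν₀ M)
    {f : Phase L → 𝕜} (hf : MemLp f 2 (phaseMeasure L)) {e e' : V} (he : ‖e‖ = 1)
    (he' : ‖e'‖ = 1) {B : ℝ} (hfB : l2norm f ≤ B)
    (hfe : ∀ h : ℝ, l2norm (fun z => f (z + phaseProj L (h • ((0, e') : V × V))) - f z) ≤ B * |h|)
    {t : ℝ} {p : ℝ × ℝ × ℝ × ℝ} (hp : p ∈ simplex₄ t) {φ : Phase L → ℝ} (hφ : IsTestFunction φ) :
    ‖∫ z, dirDeriv (e', 0) (dirDeriv (e, 0) φ) z • path₂ a b c d t f p z ∂phaseMeasure L‖ ≤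
      ((√(p.1 - p.2.1))⁻¹ * (√(p.2.1 - p.2.2.1))⁻¹ * (√(p.2.2.1 - p.2.2.2))⁻¹ * (√p.2.2.2)⁻¹) *
        (Real.exp (-(ν₀ * t)) * (2 * (1 + M) ^ 3 * (1 + t)) ^ 2 * B * l2norm φ) := by
  have hm := (hB.l2norm_path₂_le hf hp).1
  obtain ⟨⟨-, h1⟩, ⟨-, h2⟩, ⟨-, h3⟩, h4, h5⟩ := hp
  have key := hB.norm_xDiff_xDiff_path_le he he' (sub_nonneg.mpr h1.le) (sub_pos.mpr h2)
    (sub_pos.mpr h3) (sub_pos.mpr h5) h4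
    (by ring : t - p.1 + (p.1 - p.2.1) + (p.2.1 - p.2.2.1) + (p.2.2.1 - p.2.2.2) + p.2.2.2 = t)
    (F := hf.toLp f) (B := B)
    (by rwa [norm_toLp_eq]) (fun h => by
      rw [tr_toLp, ← MemLp.toLp_sub, norm_toLp_eq]
      have k := hfe h
      rw [phaseProj_smul_right] at k
      exact k)
  simp only [Sop_toLp, Kop_toLp] at key
  refine (norm_integral_dirDeriv_dirDeriv_le hφ (e, 0) (e', 0) hm (A := Real.exp (-(ν₀ * t)) *
    (2 * (1 + M) ^ 3 * (1 + t)) ^ 2 * B * ((√(p.1 - p.2.1))⁻¹ * (√(p.2.1 - p.2.2.1))⁻¹ *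
      (√(p.2.2.1 - p.2.2.2))⁻¹ * (√p.2.2.2)⁻¹)) fun s s' => ?_).trans_eq (by ring)
  have k := key s s'
  rw [xDiff_toLp, xDiff_toLp, norm_toLp_eq] at k
  exact k

end KineticBounds

end

/-! ### Integration over the time simplex -/

section


variable {𝕜 : Type*} [RCLike 𝕜] {L : ℝ} [Fact (0 < L)] {a b c d ν₀ M : ℝ}

theorem aestronglyMeasurable_KS {Ω : Type*} [MeasurableSpace Ω] {ρ : Measure Ω} [SFinite ρ]
    {f : Ω → Phase L → 𝕜}
    (hf : AEStronglyMeasurable (fun p : Ω × Phase L => f p.1 p.2) (ρ.prod (phaseMeasure L)))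
    (a b c d : ℝ) {σ : Ω → ℝ} (hσ : Measurable σ) :
    AEStronglyMeasurable (fun p : Ω × Phase L => K c d (S a b (σ p.1) (f p.1)) p.2)
      (ρ.prod (phaseMeasure L)) :=
  aestronglyMeasurable_K (f := fun w => S a b (σ w) (f w)) (aestronglyMeasurable_S hf a b hσ) c d

theorem isFiniteMeasure_simplex₂ (t : ℝ) :
    IsFiniteMeasure ((volume : Measure (ℝ × ℝ)).restrict (simplex₂ t)) :=
  isFiniteMeasure_restrict.mpr (volume_simplex₂_lt_top t).ne

theorem isFiniteMeasure_simplex₄ (t : ℝ) :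
    IsFiniteMeasure ((volume : Measure (ℝ × ℝ × ℝ × ℝ)).restrict (simplex₄ t)) :=
  isFiniteMeasure_restrict.mpr (volume_simplex₄_lt_top t).ne

namespace KineticBounds

theorem memLp_path₁ (hB : KineticBounds a b c d ν₀ M) {f : Phase L → 𝕜}
    (hf : MemLp f 2 (phaseMeasure L)) (t : ℝ) :
    MemLp (fun q : (ℝ × ℝ) × Phase L => path₁ a b c d t f q.1 q.2) 2
      ((volume.restrict (simplex₂ t)).prod (phaseMeasure L)) := by
  have := isFiniteMeasure_simplex₂ t
  refine memLp_prod_of_slices (A := M ^ 2 * l2norm f) ?_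
    (ae_restrict_of_forall_mem (measurableFamily_simplex₂.measurableSet t) fun p hp => ?_)
  · have h0 := hf.1.comp_snd (μ := (volume : Measure (ℝ × ℝ)).restrict (simplex₂ t))
    have h1 := aestronglyMeasurable_KS (f := fun _ => f) h0 a b c d
      (σ := fun p : ℝ × ℝ => p.2) (by fun_prop)
    have h2 := aestronglyMeasurable_KS (f := fun p => K c d (S a b p.2 f)) h1 a b c d
      (σ := fun p : ℝ × ℝ => p.1 - p.2) (by fun_prop)
    exact aestronglyMeasurable_S
      (f := fun p => K c d (S a b (p.1 - p.2) (K c d (S a b p.2 f)))) h2 a b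
      (σ := fun p : ℝ × ℝ => t - p.1) (by fun_prop)
  · have k := hB.l2norm_path₁_le hf hp
    exact (ENNReal.le_ofReal_iff_toReal_le k.1.2.ne
      (mul_nonneg (pow_nonneg hB.nonneg _) (l2norm_nonneg _))).mpr k.2

theorem memLp_path₂ (hB : KineticBounds a b c d ν₀ M) {f : Phase L → 𝕜}
    (hf : MemLp f 2 (phaseMeasure L)) (t : ℝ) :
    MemLp (fun q : (ℝ × ℝ × ℝ × ℝ) × Phase L => path₂ a b c d t f q.1 q.2) 2
      ((volume.restrict (simplex₄ t)).prod (phaseMeasure L)) := by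
  have := isFiniteMeasure_simplex₄ t
  refine memLp_prod_of_slices (A := M ^ 4 * l2norm f) ?_
    (ae_restrict_of_forall_mem (measurableFamily_simplex₄.measurableSet t) fun p hp => ?_)
  · set ρ := (volume : Measure (ℝ × ℝ × ℝ × ℝ)).restrict (simplex₄ t)
    let F₁ : ℝ × ℝ × ℝ × ℝ → Phase L → 𝕜 := fun p => K c d (S a b p.2.2.2 f)
    let F₂ : ℝ × ℝ × ℝ × ℝ → Phase L → 𝕜 := fun p => K c d (S a b (p.2.2.1 - p.2.2.2) (F₁ p))
    let F₃ : ℝ × ℝ × ℝ × ℝ → Phase L → 𝕜 := fun p => K c d (S a b (p.2.1 - p.2.2.1) (F₂ p))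
    let F₄ : ℝ × ℝ × ℝ × ℝ → Phase L → 𝕜 := fun p => K c d (S a b (p.1 - p.2.1) (F₃ p))
    have h1 : AEStronglyMeasurable (fun q => F₁ q.1 q.2) (ρ.prod (phaseMeasure L)) :=
      aestronglyMeasurable_KS (f := fun _ => f) (hf.1.comp_snd (μ := ρ)) a b c d
        (σ := fun p => p.2.2.2) (by fun_prop)
    have h2 : AEStronglyMeasurable (fun q => F₂ q.1 q.2) (ρ.prod (phaseMeasure L)) :=
      aestronglyMeasurable_KS h1 a b c d (σ := fun p => p.2.2.1 - p.2.2.2) (by fun_prop)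
    have h3 : AEStronglyMeasurable (fun q => F₃ q.1 q.2) (ρ.prod (phaseMeasure L)) :=
      aestronglyMeasurable_KS h2 a b c d (σ := fun p => p.2.1 - p.2.2.1) (by fun_prop)
    have h4 : AEStronglyMeasurable (fun q => F₄ q.1 q.2) (ρ.prod (phaseMeasure L)) :=
      aestronglyMeasurable_KS h3 a b c d (σ := fun p => p.1 - p.2.1) (by fun_prop)
    exact aestronglyMeasurable_S h4 a b (σ := fun p => t - p.1) (by fun_prop)
  · have k := hB.l2norm_path₂_le hf hp
    exact (ENNReal.le_ofReal_iff_toReal_le k.1.2.ne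
      (mul_nonneg (pow_nonneg hB.nonneg _) (l2norm_nonneg _))).mpr k.2

/-- The mixture operator is a pointwise iterated integral. Square integrability jointly in time and
phase space gives integrability on the simplex for almost every point, where Fubini applies. -/
theorem mixture_one_ae_eq (hB : KineticBounds a b c d ν₀ M) {f : Phase L → 𝕜}
    (hf : MemLp f 2 (phaseMeasure L)) {t : ℝ} (ht : 0 ≤ t) :
    mixture a b c d 1 t f =ᵐ[phaseMeasure L]
      fun z => ∫ p in simplex₂ t, path₁ a b c d t f p z := by
  have := isFiniteMeasure_simplex₂ t
  filter_upwards [(ae_integrable_and_memLp_integral (f := path₁ a b c d t f)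
    (hB.memLp_path₁ hf t)).1] with z hz
  exact (integral_simplex₂ ht hz).symm

theorem mixture_two_ae_eq (hB : KineticBounds a b c d ν₀ M) {f : Phase L → 𝕜}
    (hf : MemLp f 2 (phaseMeasure L)) {t : ℝ} (ht : 0 ≤ t) :
    mixture a b c d 2 t f =ᵐ[phaseMeasure L]
      fun z => ∫ p in simplex₄ t, path₂ a b c d t f p z := by
  have := isFiniteMeasure_simplex₄ t
  filter_upwards [(ae_integrable_and_memLp_integral (f := path₂ a b c d t f)
    (hB.memLp_path₂ hf t)).1] with z hz
  exact (integral_simplex₄ ht hz).symm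

theorem memLp_mixture_one (hB : KineticBounds a b c d ν₀ M) {f : Phase L → 𝕜}
    (hf : MemLp f 2 (phaseMeasure L)) {t : ℝ} (ht : 0 ≤ t) :
    MemLp (mixture a b c d 1 t f) 2 (phaseMeasure L) := by
  have := isFiniteMeasure_simplex₂ t
  exact (memLp_congr_ae (hB.mixture_one_ae_eq hf ht)).mpr
    (ae_integrable_and_memLp_integral (f := path₁ a b c d t f) (hB.memLp_path₁ hf t)).2

theorem memLp_mixture_two (hB : KineticBounds a b c d ν₀ M) {f : Phase L → 𝕜}
    (hf : MemLp f 2 (phaseMeasure L)) {t : ℝ} (ht : 0 ≤ t) :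
    MemLp (mixture a b c d 2 t f) 2 (phaseMeasure L) := by
  have := isFiniteMeasure_simplex₄ t
  exact (memLp_congr_ae (hB.mixture_two_ae_eq hf ht)).mpr
    (ae_integrable_and_memLp_integral (f := path₂ a b c d t f) (hB.memLp_path₂ hf t)).2

/-- First-order spatial regularity of the first mixture operator. -/
theorem exists_deriv_mixture_one (hB : KineticBounds a b c d ν₀ M) {f : Phase L → 𝕜}
    (hf : MemLp f 2 (phaseMeasure L)) {e : V} (he : ‖e‖ = 1) {B : ℝ} (hfB : l2norm f ≤ B)
    (hfe : ∀ h : ℝ, l2norm (fun z => f (z + phaseProj L (h • ((0, e) : V × V))) - f z) ≤ B * |h|)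
    {t : ℝ} (ht : 0 ≤ t) :
    ∃ g : Phase L → 𝕜, MemLp g 2 (phaseMeasure L) ∧
      eLpNorm g 2 (phaseMeasure L) ≤ ENNReal.ofReal (2 * (8 * t *
        (Real.exp (-(ν₀ * t)) * (2 * (1 + M) ^ 3 * (1 + t)) * B))) ∧
      ∀ φ : Phase L → ℝ, IsTestFunction φ →
        ∫ z, dirDeriv (e, 0) φ z • mixture a b c d 1 t f z ∂phaseMeasure L =
          ∫ z, φ z • g z ∂phaseMeasure L := by
  have := isFiniteMeasure_simplex₂ t
  have hM := hB.nonneg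
  have hB0 : 0 ≤ B := (l2norm_nonneg f).trans hfB
  obtain ⟨g, h1, h2, h3⟩ := exists_representative_integral (f := path₁ a b c d t f)
    (hB.memLp_path₁ hf t) (dirDerivLM (e, 0))
    (Y := Real.exp (-(ν₀ * t)) * (2 * (1 + M) ^ 3 * (1 + t)) * B) (R := 8 * t) (by positivity)
    (by positivity) ((lintegral_simplex₂_weight_le t).trans_eq
      (ENNReal.ofReal_mul (by norm_num)).symm)
    (ae_restrict_of_forall_mem (measurableFamily_simplex₂.measurableSet t) fun p hp φ =>
      hB.norm_integral_dirDeriv_path₁_le hf he hfB hfe hp φ.2)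
  refine ⟨g, h1, h2, fun φ hφ => (integral_congr_ae ?_).trans (h3 ⟨φ, hφ⟩)⟩
  filter_upwards [hB.mixture_one_ae_eq hf ht] with z hz
  rw [hz]
  rfl

/-- Second-order spatial regularity of the second mixture operator. -/
theorem exists_deriv_mixture_two (hB : KineticBounds a b c d ν₀ M) {f : Phase L → 𝕜}
    (hf : MemLp f 2 (phaseMeasure L)) {e e' : V} (he : ‖e‖ = 1) (he' : ‖e'‖ = 1) {B : ℝ}
    (hfB : l2norm f ≤ B)
    (hfe : ∀ h : ℝ, l2norm (fun z => f (z + phaseProj L (h • ((0, e') : V × V))) - f z) ≤ B * |h|)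
    {t : ℝ} (ht : 0 ≤ t) :
    ∃ g : Phase L → 𝕜, MemLp g 2 (phaseMeasure L) ∧
      eLpNorm g 2 (phaseMeasure L) ≤ ENNReal.ofReal (2 * (32 * t ^ 2 *
        (Real.exp (-(ν₀ * t)) * (2 * (1 + M) ^ 3 * (1 + t)) ^ 2 * B))) ∧
      ∀ φ : Phase L → ℝ, IsTestFunction φ →
        ∫ z, dirDeriv (e', 0) (dirDeriv (e, 0) φ) z • mixture a b c d 2 t f z ∂phaseMeasure L =
          ∫ z, φ z • g z ∂phaseMeasure L := by
  have := isFiniteMeasure_simplex₄ t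
  have hM := hB.nonneg
  have hB0 : 0 ≤ B := (l2norm_nonneg f).trans hfB
  obtain ⟨g, h1, h2, h3⟩ := exists_representative_integral (f := path₂ a b c d t f)
    (hB.memLp_path₂ hf t) (dirDerivLM (e', 0) ∘ₗ dirDerivLM (e, 0))
    (Y := Real.exp (-(ν₀ * t)) * (2 * (1 + M) ^ 3 * (1 + t)) ^ 2 * B) (R := 32 * t ^ 2)
    (by positivity) (by positivity) ((lintegral_simplex₄_weight_le t).trans_eq
      (by rw [← ENNReal.ofReal_pow ht, ← ENNReal.ofReal_mul (by norm_num)]))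
    (ae_restrict_of_forall_mem (measurableFamily_simplex₄.measurableSet t) fun p hp φ =>
      hB.norm_integral_dirDeriv_dirDeriv_path₂_le hf he he' hfB hfe hp φ.2)
  refine ⟨g, h1, h2, fun φ hφ => (integral_congr_ae ?_).trans (h3 ⟨φ, hφ⟩)⟩
  filter_upwards [hB.mixture_two_ae_eq hf ht] with z hz
  rw [hz]
  rfl

end KineticBounds

end

/-! ### Multi-indices, Sobolev norms and the final constants -/

section


variable {𝕜 : Type*} [RCLike 𝕜] {L : ℝ}

theorem multiDeriv_single (D : Fin 3 → (Phase L → ℝ) → (Phase L → ℝ)) (i : Fin 3)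
    (φ : Phase L → ℝ) : multiDeriv D (Pi.single i 1) φ = D i φ := by
  fin_cases i <;> simp [multiDeriv]

theorem exists_multiDeriv_eq_of_sum_eq_one (D : Fin 3 → (Phase L → ℝ) → (Phase L → ℝ))
    {α : Fin 3 → ℕ} (h : ∑ i, α i = 1) : ∃ i, ∀ φ, multiDeriv D α φ = D i φ := by
  rw [Fin.sum_univ_three] at h
  have : (α 0 = 1 ∧ α 1 = 0 ∧ α 2 = 0) ∨ (α 0 = 0 ∧ α 1 = 1 ∧ α 2 = 0) ∨
      (α 0 = 0 ∧ α 1 = 0 ∧ α 2 = 1) := by omega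
  rcases this with ⟨h0, h1, h2⟩ | ⟨h0, h1, h2⟩ | ⟨h0, h1, h2⟩
  exacts [⟨0, fun φ => by simp [multiDeriv, h0, h1, h2]⟩,
    ⟨1, fun φ => by simp [multiDeriv, h0, h1, h2]⟩, ⟨2, fun φ => by simp [multiDeriv, h0, h1, h2]⟩]

theorem exists_multiDeriv_eq_of_sum_eq_two (D : Fin 3 → (Phase L → ℝ) → (Phase L → ℝ))
    {α : Fin 3 → ℕ} (h : ∑ i, α i = 2) : ∃ i k, ∀ φ, multiDeriv D α φ = D i (D k φ) := by
  rw [Fin.sum_univ_three] at h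
  have : (α 0 = 2 ∧ α 1 = 0 ∧ α 2 = 0) ∨ (α 0 = 0 ∧ α 1 = 2 ∧ α 2 = 0) ∨
      (α 0 = 0 ∧ α 1 = 0 ∧ α 2 = 2) ∨ (α 0 = 1 ∧ α 1 = 1 ∧ α 2 = 0) ∨
      (α 0 = 1 ∧ α 1 = 0 ∧ α 2 = 1) ∨ (α 0 = 0 ∧ α 1 = 1 ∧ α 2 = 1) := by omega
  rcases this with ⟨h0, h1, h2⟩ | ⟨h0, h1, h2⟩ | ⟨h0, h1, h2⟩ | ⟨h0, h1, h2⟩ | ⟨h0, h1, h2⟩ |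
    ⟨h0, h1, h2⟩
  exacts [⟨0, 0, fun φ => by simp [multiDeriv, h0, h1, h2]⟩,
    ⟨1, 1, fun φ => by simp [multiDeriv, h0, h1, h2]⟩,
    ⟨2, 2, fun φ => by simp [multiDeriv, h0, h1, h2]⟩,
    ⟨0, 1, fun φ => by simp [multiDeriv, h0, h1, h2]⟩,
    ⟨0, 2, fun φ => by simp [multiDeriv, h0, h1, h2]⟩,
    ⟨1, 2, fun φ => by simp [multiDeriv, h0, h1, h2]⟩]

variable [Fact (0 < L)] {D : Fin 3 → (Phase L → ℝ) → (Phase L → ℝ)} {α : Fin 3 → ℕ}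
  {f g : Phase L → 𝕜}

/-- The representatives obtained by duality lack the sign `(-1)^|α|` of integration by parts; it is
its own inverse. -/
theorem isL2WeakDeriv_smul_of_forall (hg : MemLp g 2 (phaseMeasure L))
    (h : ∀ φ : Phase L → ℝ, IsTestFunction φ →
      ∫ z, multiDeriv D α φ z • f z ∂phaseMeasure L = ∫ z, φ z • g z ∂phaseMeasure L) :
    IsL2WeakDeriv D α f ((-1 : ℝ) ^ (∑ i, α i) • g) := by
  refine ⟨hg.const_smul _, fun φ hφ => ?_⟩
  have e : (fun z => φ z • ((-1 : ℝ) ^ (∑ i, α i) • g) z) =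
      fun z => (-1 : ℝ) ^ (∑ i, α i) • (φ z • g z) := by
    funext z
    rw [Pi.smul_apply, smul_comm]
  rw [h φ hφ, e, integral_smul, smul_smul, ← mul_pow]
  simp

theorem eLpNorm_neg_one_pow_smul (n : ℕ) (g : Phase L → 𝕜) :
    eLpNorm ((-1 : ℝ) ^ n • g) 2 (phaseMeasure L) = eLpNorm g 2 (phaseMeasure L) := by
  rw [eLpNorm_const_smul]
  simp

theorem IsL2WeakDeriv.ae_eq {g' : Phase L → 𝕜} (h : IsL2WeakDeriv D α f g)
    (h' : IsL2WeakDeriv D α f g') : g =ᵐ[phaseMeasure L] g' :=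
  ae_eq_of_forall_test (locallyIntegrable_of_memLp h.1) (locallyIntegrable_of_memLp h'.1)
    fun φ hφ => smul_right_injective 𝕜 (pow_ne_zero _ (by norm_num : (-1 : ℝ) ≠ 0))
      ((h.2 φ hφ).symm.trans (h'.2 φ hφ))

/-- All competitors in the infimum agree almost everywhere. -/
theorem IsL2WeakDeriv.weakDerivNorm_eq (h : IsL2WeakDeriv D α f g) :
    weakDerivNorm D α f = eLpNorm g 2 (phaseMeasure L) :=
  le_antisymm (iInf₂_le g h) (le_iInf₂ fun _ h' => (eLpNorm_congr_ae (h.ae_eq h')).le)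

theorem sq_rpow_half (x : ℝ≥0∞) : (x ^ 2) ^ (1 / 2 : ℝ) = x := by
  rw [← ENNReal.rpow_natCast, ← ENNReal.rpow_mul]
  norm_num

theorem mem_piAntidiag_univ {n : ℕ} :
    α ∈ (Finset.univ : Finset (Fin 3)).piAntidiag n ↔ ∑ i, α i = n := by
  simp [Finset.mem_piAntidiag]

theorem IsL2WeakDeriv.eLpNorm_le_l2HNorm (h : IsL2WeakDeriv dxi α f g) {j : ℕ}
    (hα : ∑ i, α i ≤ j) : eLpNorm g 2 (phaseMeasure L) ≤ l2HNorm j f := by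
  rw [← h.weakDerivNorm_eq, ← sq_rpow_half (weakDerivNorm dxi α f), l2HNorm]
  gcongr
  refine le_trans ?_ (Finset.single_le_sum
    (f := fun k => ∑ α ∈ (Finset.univ : Finset (Fin 3)).piAntidiag k, weakDerivNorm dxi α f ^ 2)
    (fun _ _ => zero_le) (Finset.mem_range_succ_iff.mpr hα))
  exact Finset.single_le_sum (f := fun α => weakDerivNorm dxi α f ^ 2) (fun _ _ => zero_le)
    (mem_piAntidiag_univ.mpr rfl)

theorem MemL2H.l2HNorm_lt_top {j : ℕ} (hf : MemL2H j f) : l2HNorm j f < ⊤ := by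
  refine ENNReal.rpow_lt_top_of_nonneg (by norm_num) (ne_of_lt ?_)
  refine ENNReal.sum_lt_top.mpr fun k hk => ENNReal.sum_lt_top.mpr fun α hα => ?_
  obtain ⟨g, hg⟩ := hf.2 α
    ((mem_piAntidiag_univ.mp hα).le.trans (Finset.mem_range_succ_iff.mp hk))
  rw [hg.weakDerivNorm_eq]
  exact ENNReal.pow_lt_top hg.1.2

theorem isL2WeakDeriv_zero (D : Fin 3 → (Phase L → ℝ) → (Phase L → ℝ))
    (hf : MemLp f 2 (phaseMeasure L)) : IsL2WeakDeriv D 0 f f :=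
  ⟨hf, fun φ _ => by simp [multiDeriv]⟩

theorem MemL2H.l2norm_le {j : ℕ} (hf : MemL2H j f) : l2norm f ≤ (l2HNorm j f).toReal :=
  ENNReal.toReal_mono hf.l2HNorm_lt_top.ne
    ((isL2WeakDeriv_zero dxi hf.1).eLpNorm_le_l2HNorm (by simp))

theorem MemL2H.l2norm_translate_sub_le {j : ℕ} (hf : MemL2H j f) (hj : 1 ≤ j) (i : Fin 3) (h : ℝ) :
    l2norm (fun z =>
      f (z + phaseProj L (h • ((0, EuclideanSpace.single i 1) : V × V))) - f z) ≤
      2 * (l2HNorm j f).toReal * |h| := by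
  have hs : ∑ k, (Pi.single i 1 : Fin 3 → ℕ) k = 1 := by simp
  obtain ⟨g, hg⟩ := hf.2 (Pi.single i 1) (hs.trans_le hj)
  have h1 : l2norm g ≤ (l2HNorm j f).toReal :=
    ENNReal.toReal_mono hf.l2HNorm_lt_top.ne (hg.eLpNorm_le_l2HNorm (hs.trans_le hj))
  refine (MixtureLemma.l2norm_translate_sub_le _ hf.1 hg.1 (fun φ hφ => ?_) h).trans ?_
  · have := hg.2 φ hφ
    rw [multiDeriv_single, dxi_eq_dirDeriv, hs] at this
    simpa using this
  · nlinarith [mul_le_mul_of_nonneg_left h1 (abs_nonneg h)]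

/-- There are `3` or `6` multi-indices of order `j`, hence at most `9 = 3²`. -/
theorem xDerivNorm_le {j : ℕ} (hj : j = 1 ∨ j = 2) {A : ℝ≥0∞}
    (h : ∀ α : Fin 3 → ℕ, ∑ i, α i = j → weakDerivNorm dx α f ≤ A) :
    xDerivNorm j f ≤ 3 * A := by
  rw [xDerivNorm, ← sq_rpow_half (3 * A)]
  gcongr
  have hc : ((Finset.univ : Finset (Fin 3)).piAntidiag j).card ≤ 9 := by
    rcases hj with rfl | rfl <;> decide
  calc _ ≤ ∑ α ∈ (Finset.univ : Finset (Fin 3)).piAntidiag j, A ^ 2 :=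
        Finset.sum_le_sum fun α hα => by
          gcongr
          exact h α (mem_piAntidiag_univ.mp hα)
    _ ≤ 9 * A ^ 2 := by
        rw [Finset.sum_const, nsmul_eq_mul]
        gcongr
        exact_mod_cast hc
    _ = _ := by rw [mul_pow]; norm_num

/-- `(1 + t)² ≤ 2 + 2 t²`, and the quadratic term of the exponential series gives `t² ≤ (18 / ν₀²)
exp(ν₀ t / 3)`. This is where a third of the decay rate is spent. -/
theorem sq_mul_exp_neg_le {ν₀ t : ℝ} (hν : 0 < ν₀) (ht : 0 ≤ t) :
    (1 + t) ^ 2 * Real.exp (-(ν₀ * t)) ≤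
      (2 + 36 / ν₀ ^ 2) * Real.exp (-(2 * ν₀ * t / 3)) := by
  have hx : 0 ≤ ν₀ * t / 3 := by positivity
  have h1 := Real.quadratic_le_exp_of_nonneg hx
  have h2 : t ^ 2 = 18 / ν₀ ^ 2 * ((ν₀ * t / 3) ^ 2 / 2) := by
    field_simp
    ring
  have h3 : t ^ 2 ≤ 18 / ν₀ ^ 2 * Real.exp (ν₀ * t / 3) := by
    rw [h2]
    gcongr
    linarith
  have h4 : (1 + t) ^ 2 ≤ (2 + 36 / ν₀ ^ 2) * Real.exp (ν₀ * t / 3) := by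
    have : 36 / ν₀ ^ 2 = 2 * (18 / ν₀ ^ 2) := by ring
    rw [this]
    nlinarith [sq_nonneg (1 - t), sq_nonneg (ν₀ * t / 3)]
  calc _ ≤ (2 + 36 / ν₀ ^ 2) * Real.exp (ν₀ * t / 3) * Real.exp (-(ν₀ * t)) := by gcongr
    _ = _ := by
        rw [mul_assoc, ← Real.exp_add]
        congr 2
        ring

namespace KineticBounds

variable {a b c d ν₀ M : ℝ}

/-- The constant in the mixture lemma. -/
def mixtureConst (ν₀ M : ℝ) : ℝ := 3 * (512 * (1 + M) ^ 6 * (2 + 36 / ν₀ ^ 2))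

theorem mixtureConst_pos (hB : KineticBounds a b c d ν₀ M) : 0 < mixtureConst ν₀ M := by
  have := hB.nonneg
  have := hB.pos
  unfold mixtureConst
  positivity

theorem exists_isL2WeakDeriv_mixture_one (hB : KineticBounds a b c d ν₀ M) (hf : MemL2H 1 f) {t : ℝ}
    (ht : 0 ≤ t) (hα : ∑ i, α i = 1) :
    ∃ g, IsL2WeakDeriv dx α (mixture a b c d 1 t f) g ∧ eLpNorm g 2 (phaseMeasure L) ≤
      ENNReal.ofReal (mixtureConst ν₀ M / 3 * t ^ 1 * Real.exp (-(2 * ν₀ * t / 3)) *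
        (l2HNorm 1 f).toReal) := by
  obtain ⟨i, hi⟩ := exists_multiDeriv_eq_of_sum_eq_one (L := L) dx hα
  set N := (l2HNorm 1 f).toReal with hN
  have hN0 : 0 ≤ N := ENNReal.toReal_nonneg
  have hM := hB.nonneg
  -- The `2` in `B` is the duality constant in the translation bound for the datum.
  obtain ⟨g, h1, h2, h3⟩ := hB.exists_deriv_mixture_one hf.1 (e := EuclideanSpace.single i 1)
    (B := 2 * N) (by simp) (hf.l2norm_le.trans (by linarith))
    (hf.l2norm_translate_sub_le le_rfl i) ht
  refine ⟨_, isL2WeakDeriv_smul_of_forall h1 fun φ hφ => ?_, ?_⟩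
  · rw [hi, dx_eq_dirDeriv]
    exact h3 φ hφ
  · rw [eLpNorm_neg_one_pow_smul]
    refine h2.trans (ENNReal.ofReal_le_ofReal ?_)
    have k1 : (1 + M) ^ 3 ≤ (1 + M) ^ 6 := pow_le_pow_right₀ (by linarith) (by norm_num)
    have k2 : (1 + t) ≤ (1 + t) ^ 2 := le_self_pow₀ (by linarith) two_ne_zero
    have k3 := sq_mul_exp_neg_le hB.pos ht
    -- `64 = 2 · 8 · 2 · 2`; powers are then raised to share one constant with the second-order
    -- case.
    calc _ = 64 * (1 + M) ^ 3 * t * N * ((1 + t) * Real.exp (-(ν₀ * t))) := by ring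
      _ ≤ 512 * (1 + M) ^ 6 * t * N * ((1 + t) ^ 2 * Real.exp (-(ν₀ * t))) := by
          gcongr
          norm_num
      _ ≤ 512 * (1 + M) ^ 6 * t * N *
          ((2 + 36 / ν₀ ^ 2) * Real.exp (-(2 * ν₀ * t / 3))) := by gcongr
      _ = _ := by rw [mixtureConst]; ring

theorem exists_isL2WeakDeriv_mixture_two (hB : KineticBounds a b c d ν₀ M) (hf : MemL2H 2 f) {t : ℝ}
    (ht : 0 ≤ t) (hα : ∑ i, α i = 2) :
    ∃ g, IsL2WeakDeriv dx α (mixture a b c d 2 t f) g ∧ eLpNorm g 2 (phaseMeasure L) ≤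
      ENNReal.ofReal (mixtureConst ν₀ M / 3 * t ^ 2 * Real.exp (-(2 * ν₀ * t / 3)) *
        (l2HNorm 2 f).toReal) := by
  obtain ⟨i, k, hik⟩ := exists_multiDeriv_eq_of_sum_eq_two (L := L) dx hα
  set N := (l2HNorm 2 f).toReal with hN
  have hN0 : 0 ≤ N := ENNReal.toReal_nonneg
  have hM := hB.nonneg
  -- Only the direction `i` of the outer derivative uses velocity regularity of the datum, since
  -- only that difference is spent on the last gap.
  obtain ⟨g, h1, h2, h3⟩ := hB.exists_deriv_mixture_two hf.1 (e := EuclideanSpace.single k 1)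
    (e' := EuclideanSpace.single i 1)
    (B := 2 * N) (by simp) (by simp) (hf.l2norm_le.trans (by linarith))
    (hf.l2norm_translate_sub_le one_le_two i) ht
  refine ⟨_, isL2WeakDeriv_smul_of_forall h1 fun φ hφ => ?_, ?_⟩
  · rw [hik, dx_eq_dirDeriv, dx_eq_dirDeriv]
    exact h3 φ hφ
  · rw [eLpNorm_neg_one_pow_smul]
    refine h2.trans (ENNReal.ofReal_le_ofReal ?_)
    have k3 := sq_mul_exp_neg_le hB.pos ht
    -- `512 = 2 · 32 · 2² · 2`.
    calc _ = 512 * (1 + M) ^ 6 * t ^ 2 * N * ((1 + t) ^ 2 * Real.exp (-(ν₀ * t))) := by ring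
      _ ≤ 512 * (1 + M) ^ 6 * t ^ 2 * N *
          ((2 + 36 / ν₀ ^ 2) * Real.exp (-(2 * ν₀ * t / 3))) := by gcongr
      _ = _ := by rw [mixtureConst]; ring

end KineticBounds

end

end MixtureLemma

end

/-! ### The mixture lemma -/

theorem mainTheorem4 {𝕜 : Type*} [RCLike 𝕜]
    (a b c d : ℝ) (ha : 0 < a) (hb : 0 < b) (hc : 0 < c) (hd : 0 < d)
    (ν₀ : ℝ) (hν₀ : 0 < ν₀) (hν : ∀ ξ : MixtureLemma.V, ν₀ ≤ MixtureLemma.nu a b ξ) :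
    ∃ C : ℝ, 0 < C ∧ ∀ (L : ℝ) [Fact (0 < L)] (j : ℕ), j = 1 ∨ j = 2 →
      ∀ f₀ : MixtureLemma.Phase L → 𝕜, MixtureLemma.MemL2H j f₀ → ∀ t : ℝ, 0 ≤ t →
        MemLp (MixtureLemma.mixture a b c d j t f₀) 2 (MixtureLemma.phaseMeasure L) ∧
        (∀ α : Fin 3 → ℕ, ∑ i, α i = j → ∃ g : MixtureLemma.Phase L → 𝕜,
          MixtureLemma.IsL2WeakDeriv MixtureLemma.dx α
            (MixtureLemma.mixture a b c d j t f₀) g) ∧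
        MixtureLemma.xDerivNorm j (MixtureLemma.mixture a b c d j t f₀) ≤
          ENNReal.ofReal (C * t ^ j * Real.exp (-(2 * ν₀ * t / 3))) *
            MixtureLemma.l2HNorm j f₀ := by
  obtain ⟨M, hB⟩ := MixtureLemma.exists_kineticBounds hc.le hd.le hν₀ hν
  refine ⟨MixtureLemma.KineticBounds.mixtureConst ν₀ M, hB.mixtureConst_pos, ?_⟩
  intro L _ j hj f₀ hf₀ t ht
  set C := MixtureLemma.KineticBounds.mixtureConst ν₀ M
  have hC : 0 < C := hB.mixtureConst_pos
  have hderiv : ∀ α : Fin 3 → ℕ, ∑ i, α i = j → ∃ g : MixtureLemma.Phase L → 𝕜,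
      MixtureLemma.IsL2WeakDeriv MixtureLemma.dx α (MixtureLemma.mixture a b c d j t f₀) g ∧
        eLpNorm g 2 (MixtureLemma.phaseMeasure L) ≤
          ENNReal.ofReal (C / 3 * t ^ j * Real.exp (-(2 * ν₀ * t / 3)) *
            (MixtureLemma.l2HNorm j f₀).toReal) := by
    intro α hα
    rcases hj with rfl | rfl
    · exact hB.exists_isL2WeakDeriv_mixture_one hf₀ ht hα
    · exact hB.exists_isL2WeakDeriv_mixture_two hf₀ ht hα
  refine ⟨?_, fun α hα => (hderiv α hα).imp fun g hg => hg.1, ?_⟩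
  · rcases hj with rfl | rfl
    · exact hB.memLp_mixture_one hf₀.1 ht
    · exact hB.memLp_mixture_two hf₀.1 ht
  · refine (MixtureLemma.xDerivNorm_le hj (A := ENNReal.ofReal (C / 3 * t ^ j *
        Real.exp (-(2 * ν₀ * t / 3)) * (MixtureLemma.l2HNorm j f₀).toReal)) fun α hα => ?_).trans_eq
      ?_
    · obtain ⟨g, hg, hgn⟩ := hderiv α hα
      exact hg.weakDerivNorm_eq.trans_le hgn
    -- The `3` from counting multi-indices cancels the division by `3`; finiteness of the norm of
    -- the datum allows the return from real to extended values.
    · have h3 : (3 : ℝ≥0∞) = ENNReal.ofReal 3 := by simp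
      rw [ENNReal.ofReal_mul (by positivity), ENNReal.ofReal_toReal hf₀.l2HNorm_lt_top.ne,
        ← mul_assoc, h3, ← ENNReal.ofReal_mul (by norm_num)]
      congr 2
      ring
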